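/- For $\alpha\in[0,2)$ let $\mathcal P=\mathcal P_\alpha$ be the operator $\mathcal P\vartheta=-(x^\alpha\vartheta')'$ in $L^2(0,1)$ (real-valued functions), with domain $$D(\mathcal P)=\{\vartheta\in H^1_{\alpha,0}(0,1):\ \mathcal P\vartheta\in L^2(0,1),\ \mathrm{BC}_\alpha(\vartheta)=0\},$$ where $H^1_{\alpha,0}(0,1)$ is the space of all $\vartheta\in L^2(0,1)$ that are locally absolutely continuous in $(0,1]$ with $\int_0^1x^\alpha|\vartheta'|^2<\infty$ and $\vartheta(1)=0$, and where $\mathrm{BC}_\alpha(\vartheta)=\vartheta|_{x=0}$ if $\alpha\in[0,1)$ and $\mathrm{BC}_\alpha(\vartheta)=(x^\alpha\vartheta')|_{x=0}$ if $\alpha\in[1,2)$ (limits as $x\to0^+$). **Proposition 2.2.** Let $0<a<b<1$ and $T>0$. There exist $c>0$ and $\delta\in(0,1)$ such that for all $\alpha\in[0,2)$, all finite linear combinations $\varphi_0,\varphi_1$ of eigenfunctions of $\mathcal P_\alpha$, and the solution $\varphi=\varphi(x,t)$ of $$\begin{cases}\partial_t^2\varphi-\mathcal P\varphi=0&\text{in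 }(0,1)\times(0,T),\\ \mathrm{BC}_\alpha(\varphi)=0&\text{on }\{0\}\times(0,T),\\ \varphi=0&\text{on }\{1\}\times(0,T),\\ \varphi(\cdot,0)=\varphi_0,\quad \partial_t\varphi(\cdot,0)=\varphi_1&\text{in }(0,1)\end{cases}$$ (that is, $t\mapsto\varphi(\cdot,t)$ belongs to $C^1([0,T];L^2(0,1))\cap C^2((0,T);L^2(0,1))$, takes values in $D(\mathcal P)$ for $0<t<T$, satisfies $\partial_t^2\varphi=\mathcal P\varphi$ there, and has the initial values $\varphi_0,\varphi_1$), one has $\varphi\in H^1((a,b)\times(0,T))$, $\varphi_0\in H^1(a,b)$, $\varphi_1\in L^2(a,b)$ and $$\|\varphi\|_{H^1\left(\left(\frac{2a+b}3,\frac{a+2b}3\right)\times\left(0,\frac T4\right)\right)}\le c\,\|\varphi\|_{H^1((a,b)\times(0,T))}^{1-\delta}\left(\|\varphi_0\|_{H^1(a,b)}+\|\varphi_1\|_{L^2(a,b)}\right)^{\delta}.$$ In particular $c$ and $\delta$ depend neither on $\alpha$ nor on the number of eigenfunctions involved. Here $\|f\|_{H^1}^2$ is the sum of the squared $L^2$ norms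 of $f$ and of its first-order weak partial derivatives. -/

import Mathlib

open MeasureTheory Set Filter Topology
open scoped ContDiff

noncomputable section

namespace DegenerateElliptic

/-! ### The Sobolev space `H¹` on an open set, through weak derivatives -/

section Sobolev

variable {E : Type*} [NormedAddCommGroup E] [NormedSpace ℝ E] [MeasureSpace E]

/-- `g` is the weak derivative of `f` in the direction `v` on the open set `Ω`. -/
def HasWeakDeriv (Ω : Set E) (v : E) (f g : E → ℝ) : Prop :=
  LocallyIntegrableOn f Ω volume ∧ LocallyIntegrableOn g Ω volume ∧
    ∀ η : E → ℝ, ContDiff ℝ ∞ η → HasCompactSupport η → tsupport η ⊆ Ω →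
      ∫ x in Ω, f x * fderiv ℝ η x v = -∫ x in Ω, g x * η x

/-- The `L²(Ω)` norm of `f`, in `[0, ∞]`. -/
def eL2Norm (Ω : Set E) (f : E → ℝ) : ENNReal :=
  eLpNorm f 2 (volume.restrict Ω)

/-- The (real) `L²(Ω)` norm of `f`. -/
def l2Norm (Ω : Set E) (f : E → ℝ) : ℝ := (eL2Norm Ω f).toReal

variable {ι : Type*} [Fintype ι]

/-- `f` belongs to `H¹(Ω)`: it is in `L²(Ω)` and has weak derivatives in `L²(Ω)` in the directions
`e i` (in the applications, the vectors of the canonical basis). -/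
def MemH1 (e : ι → E) (Ω : Set E) (f : E → ℝ) : Prop :=
  MemLp f 2 (volume.restrict Ω) ∧
    ∃ g : ι → E → ℝ, ∀ i, HasWeakDeriv Ω (e i) f (g i) ∧ MemLp (g i) 2 (volume.restrict Ω)

/-- The `H¹(Ω)` norm `(‖f‖² + ∑ᵢ ‖∂ᵢ f‖²)^{1/2}` of `f`, in `[0, ∞]`; the `∂ᵢ f` are the weak
derivatives of `f` in the directions `e i`. These are unique almost everywhere, so that the infimum
runs over one value; it is `∞` if `f` has no weak derivatives. -/
def eH1Norm (e : ι → E) (Ω : Set E) (f : E → ℝ) : ENNReal :=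
  ⨅ (g : ι → E → ℝ) (_ : ∀ i, HasWeakDeriv Ω (e i) f (g i)),
    (eL2Norm Ω f ^ 2 + ∑ i, eL2Norm Ω (g i) ^ 2) ^ (1 / 2 : ℝ)

/-- The (real) `H¹(Ω)` norm of `f ∈ H¹(Ω)`. -/
def h1Norm (e : ι → E) (Ω : Set E) (f : E → ℝ) : ℝ := (eH1Norm e Ω f).toReal

end Sobolev

/-- The canonical basis of `ℝ`. -/
def basis1 : Fin 1 → ℝ := ![1]

/-- The canonical basis of `ℝ × ℝ`: the directions of `∂ₓ` and `∂ₜ`. -/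
def basis2 : Fin 2 → ℝ × ℝ := ![(1, 0), (0, 1)]

/-! ### The degenerate operator `P ϑ = -(x^α ϑ')'` on `(0, 1)` -/

/-- Lebesgue measure on `(0, 1)`. -/
abbrev μ01 : Measure ℝ := volume.restrict (Ioo (0 : ℝ) 1)

/-- The flux `x^α ϑ'`. -/
def flux (α : ℝ) (ϑ : ℝ → ℝ) : ℝ → ℝ := fun x => x ^ α * deriv ϑ x

/-- `P ϑ = -(x^α ϑ')'`. -/
def opP (α : ℝ) (ϑ : ℝ → ℝ) : ℝ → ℝ := fun x => -deriv (flux α ϑ) x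

/-- The space `H¹_{α,0}(0,1)`. A function `ℝ → ℝ` stands for its restriction to `(0, 1]`. -/
structure MemH1Zero (α : ℝ) (ϑ : ℝ → ℝ) : Prop where
  memLp : MemLp ϑ 2 μ01
  locallyAC : ∀ s ∈ Ioo (0 : ℝ) 1, AbsolutelyContinuousOnInterval ϑ s 1
  energy : IntegrableOn (fun x => x ^ α * deriv ϑ x ^ 2) (Ioo 0 1)
  eq_zero : ϑ 1 = 0

/-- The boundary condition at `x = 0`: `ϑ = 0` if `α < 1`, and `x^α ϑ' = 0` if `1 ≤ α`, the values
at `0` being limits from the right. -/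
def BC (α : ℝ) (ϑ : ℝ → ℝ) : Prop :=
  (α < 1 → Tendsto ϑ (𝓝[>] 0) (𝓝 0)) ∧ (1 ≤ α → Tendsto (flux α ϑ) (𝓝[>] 0) (𝓝 0))

/-- The domain `D(P)`: all `ϑ ∈ H¹_{α,0}(0,1)` with `P ϑ ∈ L²(0,1)` and the boundary condition at
`x = 0`. That `P ϑ` is a function in `L²(0,1)` (and not only a distribution) means that the flux is
locally absolutely continuous in `(0, 1)` and that its almost everywhere derivative is in
`L²(0,1)`. -/
structure MemDomain (α : ℝ) (ϑ : ℝ → ℝ) : Prop where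
  memH1Zero : MemH1Zero α ϑ
  flux_locallyAC : ∀ s ∈ Ioo (0 : ℝ) 1, ∀ r ∈ Ioo (0 : ℝ) 1,
    AbsolutelyContinuousOnInterval (flux α ϑ) s r
  memLp_opP : MemLp (opP α ϑ) 2 μ01
  bc : BC α ϑ

/-- `ϑ` is an eigenfunction of `P`. -/
def IsEigenfunction (α : ℝ) (ϑ : ℝ → ℝ) : Prop :=
  MemDomain α ϑ ∧ ¬ (ϑ =ᵐ[μ01] 0) ∧ ∃ lam : ℝ, opP α ϑ =ᵐ[μ01] fun x => lam * ϑ x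

/-- All finite linear combinations of eigenfunctions of `P`, which is the union over `N` of the
spans of the first `N` eigenfunctions. -/
def eigenSpan (α : ℝ) : Submodule ℝ (ℝ → ℝ) :=
  Submodule.span ℝ {ϑ | IsEigenfunction α ϑ}

/-- `φ` (a function of `(x, t)`) solves
`∂ₜ² φ - P φ = 0` in `(0,1) × (0,T)`, with `BC_α(φ) = 0` at `x = 0`, `φ = 0` at `x = 1`,
`φ(·,0) = φ₀` and `∂ₜ φ(·,0) = φ₁`:
the curve `u : t ↦ φ(·,t)` is in `C¹([0,T]; L²(0,1)) ∩ C²((0,T); L²(0,1))`, takes its values for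
`0 < t < T` in `D(P)`, and satisfies `u'' = P u` on `(0,T)`, `u(0) = φ₀` and `u'(0) = φ₁`. The
boundary conditions are part of `D(P)`. -/
def IsSolution (α T : ℝ) (φ₀ φ₁ : ℝ → ℝ) (φ : ℝ × ℝ → ℝ) : Prop :=
  ∃ u : ℝ → Lp ℝ 2 μ01,
    (∀ t ∈ Ioo 0 T, ((u t : Lp ℝ 2 μ01) : ℝ → ℝ) =ᵐ[μ01] fun x => φ (x, t)) ∧
    ContDiffOn ℝ 1 u (Icc 0 T) ∧
    ContDiffOn ℝ 2 u (Ioo 0 T) ∧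
    (∀ t ∈ Ioo 0 T, MemDomain α (fun x => φ (x, t)) ∧
      ((deriv (deriv u) t : Lp ℝ 2 μ01) : ℝ → ℝ) =ᵐ[μ01] opP α (fun x => φ (x, t))) ∧
    ((u 0 : Lp ℝ 2 μ01) : ℝ → ℝ) =ᵐ[μ01] φ₀ ∧
    ((derivWithin u (Icc 0 T) 0 : Lp ℝ 2 μ01) : ℝ → ℝ) =ᵐ[μ01] φ₁

end DegenerateElliptic

end

open DegenerateElliptic

/-!
The equation `φ_tt + (x^α φ_x)_x = 0` is elliptic, and on `[a, b] ⊂ (0, 1)` its coefficient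
satisfies `a² ≤ x^α ≤ 1` and `|(x^α)'| ≤ 2 / a` for every `α ∈ [0, 2)`. The inequality is the
interior form of the stability of the Cauchy problem at `t = 0`, and the constants of a Carleman
estimate depend on the coefficient only through these bounds, hence not on `α`.

*Reduction to classical solutions.* Functions in the domain of `P` have continuous derivatives and
fluxes in `(0, 1)`, so that eigenfunctions are of class `C²` there. The operator is symmetric on its
domain (`MemDomain.integral_opP_mul_comm`), because the boundary terms `x^α u' v` vanish at both
ends: at `1`, and at `0` for `α < 1`, the flux `x^α u'` has a limit and `v` tends to `0`; for
`1 ≤ α` the flux is `O(√x)` at `0`, so that a nonzero limit of `x^α u' v` would contradict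
`v ∈ L²`. For a symmetric operator the problem `w'' = P w`, although ill-posed, has at most one
solution with given initial values: if `w(0) = w'(0) = 0`, then `‖w‖²` is logarithmically convex
where it is positive, and so cannot leave the value zero
(`eq_zero_of_symm_of_initial_eq_zero`). Consequently `φ` is the finite sum
`∑ cᵢ(t) eᵢ(x)` of separated solutions with the same initial values (`ModalSum.eq_of_isSolution`).

*Carleman estimate.* The weight is `e^{sE}` with `E = e^{-λρ}` and
`ρ = t / T + 4 (x - x₀)² / (b - a)²`, where `x₀` is the midpoint of `(a, b)`. For `z = e^{sE} φ`, a
divergence identity (`dFluxX_add_dFluxT`) expresses a quadratic form in `z, z_x, z_t` as the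
divergence of a quadratic vector field; the form is coercive for `λ` and then `s` large
(`exists_carlemanForm_ge`). The identity is multiplied by a cutoff that vanishes where `1 ≤ ρ`, in
particular at `x = a`, `x = b` and `t = T`, and is `1` where `ρ ≤ 1/2`. After integration, only the
data at `t = 0` and the region `1/2 ≤ ρ ≤ 1` remain on the right-hand side. In the inner rectangle
`ρ ≤ 1/4 + 1/9 < 1/2`, so that the weight is larger there than in that region
(`carleman_estimate`), and the choice of `s` that balances the two terms gives the interpolation
inequality (`exists_interpolation`).

*Norms.* Weak derivatives are unique almost everywhere, so that the `H¹` norms of the statement are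
the integrals of the classical derivatives (`memH1_and_h1Norm_rectangle`, `memH1_and_h1Norm_Ioo`).
-/

/-! ### Regularity of the functions in the domain -/

/-- A locally absolutely continuous function whose almost everywhere derivative agrees with a
continuous function is continuously differentiable. -/
lemma hasDerivAt_of_locallyAC {f g : ℝ → ℝ}
    (hf : ∀ s ∈ Ioo (0 : ℝ) 1, ∀ r ∈ Ioo (0 : ℝ) 1, AbsolutelyContinuousOnInterval f s r)
    (hg : ContinuousOn g (Ioo 0 1)) (h : deriv f =ᵐ[μ01] g) {x : ℝ} (hx : x ∈ Ioo (0 : ℝ) 1) :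
    HasDerivAt f (g x) x := by
  have hFTC : ∀ y ∈ Ioo (0 : ℝ) 1, f y = f x + ∫ z in x..y, g z := by
    intro y hy
    have h1 := (hf x hx y hy).integral_deriv_eq_sub
    have h2 : ∫ z in x..y, deriv f z = ∫ z in x..y, g z := by
      apply intervalIntegral.integral_congr_ae
      rw [Filter.EventuallyEq, ae_restrict_iff' measurableSet_Ioo] at h
      filter_upwards [h] with z hz hzm
      exact hz ((ordConnected_Ioo.uIcc_subset hx hy) (uIoc_subset_uIcc hzm))
    rw [← h2, h1]; ring
  have hnhds : Ioo (0 : ℝ) 1 ∈ 𝓝 x := isOpen_Ioo.mem_nhds hx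
  have h3 : HasDerivAt (fun y => f x + ∫ z in x..y, g z) (g x) x :=
    (intervalIntegral.integral_hasDerivAt_right (by simp)
      (hg.stronglyMeasurableAtFilter isOpen_Ioo x hx) (hg.continuousAt hnhds)).const_add _
  exact h3.congr_of_eventuallyEq (by filter_upwards [hnhds] with y hy using hFTC y hy)

lemma continuousOn_of_locallyAC {f : ℝ → ℝ}
    (hf : ∀ s ∈ Ioo (0 : ℝ) 1, ∀ r ∈ Ioo (0 : ℝ) 1, AbsolutelyContinuousOnInterval f s r) :
    ContinuousOn f (Ioo 0 1) := by
  intro x hx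
  have h1 : x / 2 ∈ Ioo (0 : ℝ) 1 := ⟨by linarith [hx.1], by linarith [hx.1, hx.2]⟩
  have h2 : (x + 1) / 2 ∈ Ioo (0 : ℝ) 1 := ⟨by linarith [hx.1], by linarith [hx.2]⟩
  have hc := (hf _ h1 _ h2).continuousOn
  rw [uIcc_of_le (by linarith)] at hc
  have hn := Icc_mem_nhds (show x / 2 < x by linarith [hx.1])
    (show x < (x + 1) / 2 by linarith [hx.2])
  exact (hc.continuousAt hn).continuousWithinAt

namespace DegenerateElliptic

variable {α : ℝ} {u v ϑ : ℝ → ℝ}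

lemma MemH1Zero.locallyAC_Ioo (h : MemH1Zero α ϑ) :
    ∀ s ∈ Ioo (0 : ℝ) 1, ∀ r ∈ Ioo (0 : ℝ) 1, AbsolutelyContinuousOnInterval ϑ s r := by
  intro s hs r hr
  refine (h.locallyAC (min s r) ⟨lt_min hs.1 hr.1, (min_le_left _ _).trans_lt hs.2⟩).mono ?_
  rw [uIcc_of_le (a := min s r) ((min_le_left _ _).trans hs.2.le)]
  exact fun z hz => ⟨hz.1, hz.2.trans (max_le hs.2.le hr.2.le)⟩

lemma MemDomain.continuousOn_flux (h : MemDomain α ϑ) : ContinuousOn (flux α ϑ) (Ioo 0 1) :=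
  continuousOn_of_locallyAC h.flux_locallyAC

lemma MemDomain.continuousOn (h : MemDomain α ϑ) : ContinuousOn ϑ (Ioo 0 1) :=
  continuousOn_of_locallyAC h.memH1Zero.locallyAC_Ioo

lemma continuousOn_rpow_Ioo (α : ℝ) : ContinuousOn (fun x : ℝ => x ^ α) (Ioo 0 1) :=
  continuousOn_id.rpow_const fun _ hx => Or.inl hx.1.ne'

lemma deriv_eq_rpow_neg_mul_flux {x : ℝ} (hx : 0 < x) : deriv ϑ x = x ^ (-α) * flux α ϑ x := by
  rw [flux, ← mul_assoc, ← Real.rpow_add hx]; simp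

lemma MemDomain.continuousOn_deriv (h : MemDomain α ϑ) : ContinuousOn (deriv ϑ) (Ioo 0 1) :=
  ((continuousOn_rpow_Ioo (-α)).mul h.continuousOn_flux).congr
    fun _ hx => deriv_eq_rpow_neg_mul_flux hx.1

lemma MemDomain.hasDerivAt (h : MemDomain α ϑ) {x : ℝ} (hx : x ∈ Ioo (0 : ℝ) 1) :
    HasDerivAt ϑ (deriv ϑ x) x :=
  hasDerivAt_of_locallyAC h.memH1Zero.locallyAC_Ioo h.continuousOn_deriv ae_eq_rfl hx

/-- The equation `(x^α ϑ')' = -λ ϑ` holds pointwise for an eigenfunction, whose flux is therefore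
continuously differentiable. -/
lemma MemDomain.hasDerivAt_flux (h : MemDomain α ϑ) {lam : ℝ}
    (hlam : opP α ϑ =ᵐ[μ01] fun x => lam * ϑ x) {x : ℝ} (hx : x ∈ Ioo (0 : ℝ) 1) :
    HasDerivAt (flux α ϑ) (-(lam * ϑ x)) x := by
  refine hasDerivAt_of_locallyAC (g := fun x => -(lam * ϑ x)) h.flux_locallyAC
    (continuousOn_const.mul h.continuousOn).neg ?_ hx
  filter_upwards [hlam] with y hy
  rw [← hy, opP, neg_neg]

/-- The second derivative of an eigenfunction, as given by the equation. -/
noncomputable def secondDeriv (α lam : ℝ) (ϑ : ℝ → ℝ) (x : ℝ) : ℝ :=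
  -α * x ^ (-α - 1) * flux α ϑ x - x ^ (-α) * (lam * ϑ x)

lemma MemDomain.hasDerivAt_deriv (h : MemDomain α ϑ) {lam : ℝ}
    (hlam : opP α ϑ =ᵐ[μ01] fun x => lam * ϑ x) {x : ℝ} (hx : x ∈ Ioo (0 : ℝ) 1) :
    HasDerivAt (deriv ϑ) (secondDeriv α lam ϑ x) x := by
  have h1 := (Real.hasDerivAt_rpow_const (p := -α) (Or.inl hx.1.ne')).mul
    (h.hasDerivAt_flux hlam hx)
  refine (h1.congr_of_eventuallyEq ?_).congr_deriv ?_
  · filter_upwards [isOpen_Ioo.mem_nhds hx] with y hy using deriv_eq_rpow_neg_mul_flux hy.1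
  · rw [secondDeriv]; ring

lemma MemDomain.continuousOn_secondDeriv (h : MemDomain α ϑ) (lam : ℝ) :
    ContinuousOn (secondDeriv α lam ϑ) (Ioo 0 1) :=
  ((continuousOn_const.mul (continuousOn_rpow_Ioo (-α - 1))).mul h.continuousOn_flux).sub
    ((continuousOn_rpow_Ioo (-α)).mul (continuousOn_const.mul h.continuousOn))

/-- The eigenvalue equation in non-divergence form. -/
lemma rpow_mul_secondDeriv {lam : ℝ} {x : ℝ} (hx : 0 < x) :
    x ^ α * secondDeriv α lam ϑ x + α * x ^ (α - 1) * deriv ϑ x = -(lam * ϑ x) := by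
  have h1 : x ^ (-α - 1) = x ^ (-α) * x⁻¹ := by rw [Real.rpow_sub_one hx.ne']; rfl
  have h2 : x ^ (α - 1) = x ^ α * x⁻¹ := by rw [Real.rpow_sub_one hx.ne']; rfl
  have h3 : x ^ α * x ^ (-α) = 1 := by rw [← Real.rpow_add hx]; simp
  rw [secondDeriv, flux, h1, h2]
  linear_combination (-α * x⁻¹ * x ^ α * deriv ϑ x - lam * ϑ x) * h3

/-! ### Symmetry of the operator -/

/-- A locally absolutely continuous function on `(0, 1)` with integrable derivative `K` has limits
at both end points; the limits differ by the integral of `K`. -/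
lemma exists_limits_of_integrable {B K : ℝ → ℝ} (hK : IntegrableOn K (Ioo 0 1))
    (hB : ∀ s ∈ Ioo (0 : ℝ) 1, ∀ r ∈ Ioo (0 : ℝ) 1, ∫ x in s..r, K x = B r - B s) :
    ∃ L₀ L₁ : ℝ, Tendsto B (𝓝[>] 0) (𝓝 L₀) ∧ Tendsto B (𝓝[<] 1) (𝓝 L₁) ∧
      (∫ x in Ioo (0 : ℝ) 1, K x) = L₁ - L₀ ∧
      ∀ x ∈ Ioo (0 : ℝ) 1, B x = L₀ + ∫ y in Ioo 0 x, K y := by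
  have hI : IntervalIntegrable K volume 0 1 :=
    (intervalIntegrable_iff_integrableOn_Ioo_of_le zero_le_one).2 hK
  have hc : ContinuousOn (fun r => ∫ x in (0 : ℝ)..r, K x) (Icc 0 1) := by
    have := intervalIntegral.continuousOn_primitive_interval' hI left_mem_uIcc
    rwa [uIcc_of_le zero_le_one] at this
  have hh : (1 / 2 : ℝ) ∈ Ioo (0 : ℝ) 1 := by constructor <;> norm_num
  have hsub : ∀ r ∈ Icc (0 : ℝ) 1, IntervalIntegrable K volume 0 r := fun r hr =>
    hI.mono_set (by rw [uIcc_of_le hr.1, uIcc_of_le zero_le_one]; exact Icc_subset_Icc_right hr.2)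
  set L₀ := B (1 / 2) - ∫ x in (0 : ℝ)..(1 / 2), K x with hL₀
  have hBx : ∀ x ∈ Ioo (0 : ℝ) 1, B x = L₀ + ∫ y in (0 : ℝ)..x, K y := by
    intro x hx
    have h1 := hB _ hh x hx
    have h2 := intervalIntegral.integral_add_adjacent_intervals (hsub _ (Ioo_subset_Icc_self hh))
      ((hsub _ (Ioo_subset_Icc_self hh)).symm.trans (hsub x (Ioo_subset_Icc_self hx)))
    rw [hL₀]; linarith
  have h0 : Tendsto (fun r => ∫ x in (0 : ℝ)..r, K x) (𝓝[>] 0) (𝓝 0) := by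
    have := (hc 0 (by simp)).tendsto
    simp only [intervalIntegral.integral_same] at this
    refine this.mono_left ?_
    rw [← nhdsWithin_Ioo_eq_nhdsGT (zero_lt_one' ℝ)]
    exact nhdsWithin_mono _ Ioo_subset_Icc_self
  have h1 : Tendsto (fun r => ∫ x in (0 : ℝ)..r, K x) (𝓝[<] 1) (𝓝 (∫ x in (0 : ℝ)..1, K x)) := by
    refine (hc 1 (by simp)).tendsto.mono_left ?_
    rw [← nhdsWithin_Ioo_eq_nhdsLT (zero_lt_one' ℝ)]
    exact nhdsWithin_mono _ Ioo_subset_Icc_self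
  refine ⟨L₀, L₀ + ∫ x in (0 : ℝ)..1, K x, ?_, ?_, ?_, ?_⟩
  · have := h0.const_add L₀
    rw [add_zero] at this
    refine this.congr' ?_
    filter_upwards [Ioo_mem_nhdsGT (zero_lt_one' ℝ)] with x hx using (hBx x hx).symm
  · refine (h1.const_add L₀).congr' ?_
    filter_upwards [Ioo_mem_nhdsLT (zero_lt_one' ℝ)] with x hx using (hBx x hx).symm
  · rw [intervalIntegral.integral_of_le zero_le_one, integral_Ioc_eq_integral_Ioo]; ring
  · intro x hx
    rw [hBx x hx, intervalIntegral.integral_of_le hx.1.le, integral_Ioc_eq_integral_Ioo]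

lemma MemDomain.integrable_opP (hu : MemDomain α u) : IntegrableOn (opP α u) (Ioo 0 1) :=
  hu.memLp_opP.integrable (by norm_num)

lemma MemDomain.flux_limits (hu : MemDomain α u) :
    ∃ L₀ L₁ : ℝ, Tendsto (flux α u) (𝓝[>] 0) (𝓝 L₀) ∧ Tendsto (flux α u) (𝓝[<] 1) (𝓝 L₁) ∧
      ∀ x ∈ Ioo (0 : ℝ) 1, flux α u x = L₀ - ∫ y in Ioo 0 x, opP α u y := by
  obtain ⟨L₀, L₁, h0, h1, -, h2⟩ := exists_limits_of_integrable (B := flux α u)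
    (K := fun x => -opP α u x) hu.integrable_opP.neg (by
      intro s hs r hr
      simp only [opP, neg_neg]
      exact (hu.flux_locallyAC s hs r hr).integral_deriv_eq_sub)
  refine ⟨L₀, L₁, h0, h1, fun x hx => ?_⟩
  rw [h2 x hx, integral_neg]; ring

/-- By the Cauchy-Schwarz inequality, a flux that vanishes at `0` is `O(√x)` there. -/
lemma MemDomain.abs_flux_le (hu : MemDomain α u) (h0 : Tendsto (flux α u) (𝓝[>] 0) (𝓝 0)) :
    ∃ C : ℝ, 0 < C ∧ ∀ x ∈ Ioo (0 : ℝ) 1, |flux α u x| ≤ C * √x := by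
  obtain ⟨L₀, -, h0', -, h2⟩ := hu.flux_limits
  obtain rfl : L₀ = 0 := tendsto_nhds_unique h0' h0
  set J := ∫ y in Ioo (0 : ℝ) 1, opP α u y ^ 2
  have hJ : 0 ≤ J := integral_nonneg fun _ => sq_nonneg _
  refine ⟨(1 + J) / 2, by positivity, fun x hx => ?_⟩
  have hs : 0 < √x := Real.sqrt_pos.2 hx.1
  have hsub : Ioo 0 x ⊆ Ioo (0 : ℝ) 1 := Ioo_subset_Ioo_right hx.2.le
  have hsq : IntegrableOn (fun y => opP α u y ^ 2) (Ioo 0 1) := hu.memLp_opP.integrable_sq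
  rw [h2 x hx, zero_sub, abs_neg]
  calc |∫ y in Ioo 0 x, opP α u y| ≤ ∫ y in Ioo 0 x, |opP α u y| := abs_integral_le_integral_abs
    _ ≤ ∫ y in Ioo 0 x, ((√x)⁻¹ / 2 + √x / 2 * opP α u y ^ 2) := by
        refine integral_mono (hu.integrable_opP.mono_set hsub).abs ?_ fun y => ?_
        · exact (integrableOn_const (by simp)).add
            ((hsq.mono_set hsub).const_mul _)
        · have h3 := sq_nonneg (√x * |opP α u y| - 1)
          have h4 : √x * |opP α u y| * 2 ≤ 1 + √x ^ 2 * opP α u y ^ 2 := by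
            rw [← sq_abs (opP α u y)]; nlinarith
          calc |opP α u y| = (√x)⁻¹ / 2 * (√x * |opP α u y| * 2) := by field_simp
            _ ≤ (√x)⁻¹ / 2 * (1 + √x ^ 2 * opP α u y ^ 2) := by gcongr
            _ = _ := by field_simp
    _ = √x / 2 + √x / 2 * ∫ y in Ioo 0 x, opP α u y ^ 2 := by
        have hc : IntegrableOn (fun _ : ℝ => (√x)⁻¹ / 2) (Ioo 0 x) := integrableOn_const (by simp)
        rw [integral_add hc ((hsq.mono_set hsub).const_mul _), integral_const_mul]
        simp only [integral_const, MeasurableSet.univ, measureReal_restrict_apply, univ_inter,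
          Real.volume_real_Ioo_of_le hx.1.le, smul_eq_mul, sub_zero]
        have : x = √x * √x := (Real.mul_self_sqrt hx.1.le).symm
        congr 1
        nth_rewrite 1 [this]
        field_simp
    _ ≤ √x / 2 + √x / 2 * J := by
        gcongr
        exact setIntegral_mono_set hsq (ae_of_all _ fun _ => sq_nonneg _) hsub.eventuallyLE
    _ = (1 + J) / 2 * √x := by ring

/-- The boundary term of the integration by parts vanishes at `0`. For `1 ≤ α` the function `v` may
be unbounded there; but as the flux is `O(√x)`, a nonzero limit would give `v² ≥ c / x`, and `v`
would not be square integrable. -/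
lemma MemDomain.limit_flux_mul_eq_zero (hu : MemDomain α u) (hv : MemDomain α v) {L : ℝ}
    (hL : Tendsto (fun x => flux α u x * v x) (𝓝[>] 0) (𝓝 L)) : L = 0 := by
  rcases lt_or_ge α 1 with hα | hα
  · obtain ⟨L₀, -, h0, -, -⟩ := hu.flux_limits
    have := h0.mul (hv.bc.1 hα)
    rw [mul_zero] at this
    exact tendsto_nhds_unique hL this
  · by_contra hne
    obtain ⟨C, hC, hflux⟩ := hu.abs_flux_le (hu.bc.2 hα)
    have hpos : 0 < |L| / 2 := by positivity
    have hev : ∀ᶠ x in 𝓝[>] (0 : ℝ), |L| / 2 < |flux α u x * v x| :=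
      hL.abs.eventually (lt_mem_nhds (by linarith))
    obtain ⟨ε, hε, hεs⟩ := (mem_nhdsGT_iff_exists_Ioo_subset).1
      (Filter.inter_mem hev (Ioo_mem_nhdsGT (zero_lt_one' ℝ)))
    have hε0 : (0 : ℝ) < ε := hε
    have hlow : ∀ x ∈ Ioo (0 : ℝ) ε, x⁻¹ ≤ (2 * C / |L|) ^ 2 * v x ^ 2 := by
      intro x hx
      obtain ⟨h1, h2⟩ := hεs hx
      simp only [mem_ofPred_eq, abs_mul] at h1
      have h3 : |L| / 2 ≤ C * √x * |v x| :=
        h1.le.trans (mul_le_mul_of_nonneg_right (hflux x h2) (abs_nonneg _))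
      have h4 : (|L| / 2) ^ 2 ≤ (C * √x * |v x|) ^ 2 := pow_le_pow_left₀ hpos.le h3 2
      rw [mul_pow, mul_pow, Real.sq_sqrt hx.1.le, sq_abs] at h4
      have hL0 : 0 < |L| := abs_pos.2 hne
      have hx0 := hx.1
      calc x⁻¹ = x⁻¹ * (2 / |L|) ^ 2 * (|L| / 2) ^ 2 := by field_simp
        _ ≤ x⁻¹ * (2 / |L|) ^ 2 * (C ^ 2 * x * v x ^ 2) := by gcongr
        _ = _ := by field_simp
    have hsub : Ioo (0 : ℝ) ε ⊆ Ioo 0 1 := fun x hx => (hεs hx).2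
    have hint : IntegrableOn (fun x : ℝ => x⁻¹) (Ioo 0 ε) := by
      refine Integrable.mono' ((hv.memH1Zero.memLp.integrable_sq.mono_measure
        (Measure.restrict_mono hsub le_rfl)).const_mul ((2 * C / |L|) ^ 2))
        measurable_inv.aestronglyMeasurable ?_
      filter_upwards [ae_restrict_mem measurableSet_Ioo] with x hx
      rw [Real.norm_of_nonneg (inv_nonneg.2 hx.1.le)]
      exact hlow x hx
    have := (intervalIntegrable_iff_integrableOn_Ioo_of_le hε0.le).2 hint
    rw [intervalIntegrable_inv_iff] at this
    rcases this with h | h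
    · exact hε0.ne h
    · exact h left_mem_uIcc

lemma MemDomain.integrable_energy (hu : MemDomain α u) (hv : MemDomain α v) :
    IntegrableOn (fun x => x ^ α * (deriv u x * deriv v x)) (Ioo 0 1) := by
  refine Integrable.mono' (hu.memH1Zero.energy.add hv.memH1Zero.energy) ?_ ?_
  · exact ((continuousOn_rpow_Ioo α).mul
      (hu.continuousOn_deriv.mul hv.continuousOn_deriv)).aestronglyMeasurable measurableSet_Ioo
  · filter_upwards [ae_restrict_mem measurableSet_Ioo] with x hx
    have hp : 0 ≤ x ^ α := Real.rpow_nonneg hx.1.le _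
    rw [norm_mul, Real.norm_of_nonneg hp, Pi.add_apply, ← mul_add]
    refine mul_le_mul_of_nonneg_left ?_ hp
    rw [Real.norm_eq_abs, abs_mul, ← sq_abs (deriv u x), ← sq_abs (deriv v x)]
    nlinarith [sq_nonneg (|deriv u x| - |deriv v x|), sq_nonneg (|deriv u x|),
      sq_nonneg (|deriv v x|)]

/-- The boundary term of the integration by parts vanishes at `1` because `v(1) = 0`. -/
lemma MemDomain.integral_opP_mul (hu : MemDomain α u) (hv : MemDomain α v) :
    ∫ x in Ioo (0 : ℝ) 1, opP α u x * v x =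
      ∫ x in Ioo (0 : ℝ) 1, x ^ α * (deriv u x * deriv v x) := by
  have hPv : IntegrableOn (fun x => opP α u x * v x) (Ioo 0 1) :=
    hu.memLp_opP.integrable_mul hv.memH1Zero.memLp
  obtain ⟨L₀, L₁, h0, h1, h2, -⟩ := exists_limits_of_integrable
    (B := fun x => flux α u x * v x)
    (K := fun x => x ^ α * (deriv u x * deriv v x) - opP α u x * v x)
    ((hu.integrable_energy hv).sub hPv) (by
      intro s hs r hr
      rw [← (hu.flux_locallyAC s hs r hr).integral_deriv_mul_eq_sub
        (hv.memH1Zero.locallyAC_Ioo s hs r hr)]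
      refine intervalIntegral.integral_congr fun x _ => ?_
      simp only [opP, flux]; ring)
  have hL₀ : L₀ = 0 := hu.limit_flux_mul_eq_zero hv h0
  have hL₁ : L₁ = 0 := by
    obtain ⟨-, l, -, hl, -⟩ := hu.flux_limits
    have hv1 : Tendsto v (𝓝[<] 1) (𝓝 0) := by
      have hc := (hv.memH1Zero.locallyAC (1 / 2) (by constructor <;> norm_num)).continuousOn
      rw [uIcc_of_le (by norm_num)] at hc
      have := (hc 1 (by norm_num)).tendsto
      rw [hv.memH1Zero.eq_zero] at this
      refine this.mono_left ?_
      rw [← nhdsWithin_Ioo_eq_nhdsLT (show (1 / 2 : ℝ) < 1 by norm_num)]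
      exact nhdsWithin_mono _ Ioo_subset_Icc_self
    have := hl.mul hv1
    rw [mul_zero] at this
    exact tendsto_nhds_unique h1 this
  rw [integral_sub (hu.integrable_energy hv) hPv, hL₀, hL₁] at h2
  linarith

lemma MemDomain.integral_opP_mul_comm (hu : MemDomain α u) (hv : MemDomain α v) :
    ∫ x in Ioo (0 : ℝ) 1, opP α u x * v x = ∫ x in Ioo (0 : ℝ) 1, u x * opP α v x := by
  rw [hu.integral_opP_mul hv]
  simp_rw [mul_comm (u _), hv.integral_opP_mul hu, mul_comm (deriv u _)]

end DegenerateElliptic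

/-! ### Uniqueness for `w'' = P w` with a symmetric operator -/

section Uniqueness

open scoped InnerProductSpace

variable {H : Type*} [NormedAddCommGroup H] [InnerProductSpace ℝ H]

/-- The symmetry makes up for the missing derivative of `w₂`. -/
lemma hasDerivAt_inner_of_symm {T : ℝ} {w w₁ w₂ : ℝ → H} (hw₂ : ContinuousOn w₂ (Ioo 0 T))
    (h₁ : ∀ t ∈ Ioo 0 T, HasDerivAt w (w₁ t) t)
    (hsymm : ∀ s ∈ Ioo 0 T, ∀ t ∈ Ioo 0 T, ⟪w₂ s, w t⟫_ℝ = ⟪w s, w₂ t⟫_ℝ)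
    {t : ℝ} (ht : t ∈ Ioo 0 T) :
    HasDerivAt (fun t => ⟪w₂ t, w t⟫_ℝ) (2 * ⟪w₂ t, w₁ t⟫_ℝ) t := by
  have hn : Ioo 0 T ∈ 𝓝 t := isOpen_Ioo.mem_nhds ht
  have hsl := hasDerivAt_iff_tendsto_slope.1 (h₁ t ht)
  have hw₂t : Tendsto w₂ (𝓝[≠] t) (𝓝 (w₂ t)) :=
    (hw₂.continuousAt hn).tendsto.mono_left nhdsWithin_le_nhds
  rw [hasDerivAt_iff_tendsto_slope]
  have hlim := (hw₂t.inner (𝕜 := ℝ) hsl).add (hsl.inner (𝕜 := ℝ) (tendsto_const_nhds (x := w₂ t)))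
  rw [real_inner_comm (w₂ t) (w₁ t), ← two_mul] at hlim
  refine hlim.congr' ?_
  filter_upwards [nhdsWithin_le_nhds hn] with y hy
  simp only [slope_def_module, real_inner_smul_right, real_inner_smul_left, inner_sub_right,
    inner_sub_left, smul_eq_mul]
  rw [hsymm y hy t ht, real_inner_comm (w₂ t) (w t)]
  ring

/-- The energy `⟨w'', w⟩ - ‖w'‖²` is constant, and zero if the initial data vanish: then
`⟨w', w⟩ = o(t)`, while the derivative of `⟨w', w⟩` tends to the energy as `t → 0`. -/
lemma energy_eq_zero {T : ℝ} {w w₁ w₂ : ℝ → H} (hw : ContinuousOn w (Icc 0 T))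
    (hw₁ : ContinuousOn w₁ (Icc 0 T)) (hw₂ : ContinuousOn w₂ (Ioo 0 T))
    (h₁ : ∀ t ∈ Ioo 0 T, HasDerivAt w (w₁ t) t) (h₂ : ∀ t ∈ Ioo 0 T, HasDerivAt w₁ (w₂ t) t)
    (hsymm : ∀ s ∈ Ioo 0 T, ∀ t ∈ Ioo 0 T, ⟪w₂ s, w t⟫_ℝ = ⟪w s, w₂ t⟫_ℝ)
    (h0 : w 0 = 0) (h01 : w₁ 0 = 0) {t : ℝ} (ht : t ∈ Ioo 0 T) :
    ⟪w₂ t, w t⟫_ℝ = ‖w₁ t‖ ^ 2 := by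
  set e : ℝ → ℝ := fun t => ⟪w₂ t, w t⟫_ℝ - ⟪w₁ t, w₁ t⟫_ℝ with he
  have hder : ∀ s ∈ Ioo 0 T, HasDerivAt e 0 s := by
    intro s hs
    refine ((hasDerivAt_inner_of_symm hw₂ h₁ hsymm hs).sub
      ((h₂ s hs).inner ℝ (h₂ s hs))).congr_deriv ?_
    rw [real_inner_comm (w₂ s) (w₁ s)]; ring
  have hconst : ∀ s ∈ Ioo 0 T, e s = e t := fun s hs =>
    isOpen_Ioo.is_const_of_deriv_eq_zero isPreconnected_Ioo
      (fun x hx => (hder x hx).differentiableAt.differentiableWithinAt)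
      (fun x hx => (hder x hx).deriv) hs ht
  have hm : ∀ s ∈ Ioo 0 T, HasDerivAt (fun s => ⟪w₁ s, w s⟫_ℝ) (2 * ‖w₁ s‖ ^ 2 + e t) s := by
    intro s hs
    refine ((h₂ s hs).inner ℝ (h₁ s hs)).congr_deriv ?_
    rw [← hconst s hs, he, ← real_inner_self_eq_norm_sq]; ring
  have hT : 0 < T := ht.1.trans ht.2
  have hbound : ∀ ε : ℝ, 0 < ε → |e t| ≤ 3 * ε ^ 2 := by
    intro ε hε
    have hev : ∀ᶠ s in 𝓝[Icc 0 T] (0 : ℝ), ‖w₁ s‖ < ε := by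
      have := (hw₁ 0 ⟨le_rfl, hT.le⟩).tendsto.norm
      rw [h01, norm_zero] at this
      exact this.eventually (gt_mem_nhds hε)
    rw [nhdsWithin_Icc_eq_nhdsGE hT] at hev
    obtain ⟨δ, hδ, hδs⟩ := mem_nhdsGE_iff_exists_Ico_subset.1 hev
    have hδ0 : (0 : ℝ) < δ := hδ
    set r := min (δ / 2) (T / 2) with hr
    have hr0 : 0 < r := lt_min (by linarith) (by linarith)
    have hrT : r < T := (min_le_right _ _).trans_lt (by linarith)
    have hrδ : r < δ := (min_le_left _ _).trans_lt (by linarith)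
    have hsub : Icc 0 r ⊆ Icc 0 T := Icc_subset_Icc_right hrT.le
    have hw₁b : ∀ s ∈ Icc 0 r, ‖w₁ s‖ ≤ ε := fun s hs =>
      (show ‖w₁ s‖ < ε from hδs ⟨hs.1, hs.2.trans_lt hrδ⟩).le
    have hwr : ‖w r‖ ≤ ε * r := by
      have := image_norm_le_of_norm_deriv_right_le_deriv_boundary (f := w) (f' := w₁)
        (a := 0) (b := r) (B := fun s => ε * s) (B' := fun _ => ε)
        (hw.mono hsub) ?_ (by simp [h0]) (fun x => by simpa using (hasDerivAt_id x).const_mul ε)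
        (fun x hx => hw₁b x (Ico_subset_Icc_self hx)) (right_mem_Icc.2 hr0.le)
      · exact this
      · intro x hx
        rcases hx.1.eq_or_lt with rfl | hx0
        · have hlim : Tendsto w₁ (𝓝[>] 0) (𝓝 (w₁ 0)) := by
            refine (hw₁ 0 ⟨le_rfl, hT.le⟩).tendsto.mono_left ?_
            rw [← nhdsWithin_Ioo_eq_nhdsGT hT]
            exact nhdsWithin_mono _ Ioo_subset_Icc_self
          refine hasDerivWithinAt_Ici_of_tendsto_deriv (s := Ioo 0 T)
            (fun y hy => (h₁ y hy).differentiableAt.differentiableWithinAt)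
            ((hw 0 ⟨le_rfl, hT.le⟩).mono Ioo_subset_Icc_self) (Ioo_mem_nhdsGT hT)
            (hlim.congr' ?_)
          filter_upwards [Ioo_mem_nhdsGT hT] with y hy using (h₁ y hy).deriv.symm
        · exact (h₁ x ⟨hx0, hx.2.trans hrT⟩).hasDerivWithinAt
    obtain ⟨ξ, hξ, hslope⟩ := exists_hasDerivAt_eq_slope (fun s => ⟪w₁ s, w s⟫_ℝ)
      (fun s => 2 * ‖w₁ s‖ ^ 2 + e t) hr0 ((hw₁.mono hsub).inner (hw.mono hsub))
      (fun s hs => hm s ⟨hs.1, hs.2.trans hrT⟩)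
    simp only [h0, inner_zero_right, sub_zero] at hslope
    have hmr : |⟪w₁ r, w r⟫_ℝ / r| ≤ ε ^ 2 := by
      rw [abs_div, abs_of_pos hr0, div_le_iff₀ hr0]
      calc |⟪w₁ r, w r⟫_ℝ| ≤ ‖w₁ r‖ * ‖w r‖ := abs_real_inner_le_norm _ _
        _ ≤ ε * (ε * r) := mul_le_mul (hw₁b r (right_mem_Icc.2 hr0.le)) hwr (norm_nonneg _) hε.le
        _ = ε ^ 2 * r := by ring
    rw [← hslope] at hmr
    have h3 : ‖w₁ ξ‖ ^ 2 ≤ ε ^ 2 :=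
      pow_le_pow_left₀ (norm_nonneg _) (hw₁b ξ (Ioo_subset_Icc_self hξ)) 2
    have h4 := abs_le.1 hmr
    have h5 := sq_nonneg ‖w₁ ξ‖
    rw [abs_le]; constructor <;> linarith [h4.1, h4.2]
  have : |e t| ≤ 0 := by
    refine le_of_forall_pos_le_add fun η hη => ?_
    have := hbound √(η / 3) (Real.sqrt_pos.2 (by positivity))
    rw [Real.sq_sqrt (by positivity)] at this
    linarith
  have h6 : e t = 0 := abs_nonpos_iff.1 this
  rw [he] at h6
  rw [← real_inner_self_eq_norm_sq]
  linarith

/-- Uniqueness by logarithmic convexity: where `‖w‖² > 0`, the zero energy makes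
`⟨w', w⟩ / ‖w‖²` nondecreasing, so that `‖w‖²` cannot leave the value zero. -/
theorem eq_zero_of_symm_of_initial_eq_zero {T : ℝ} {w w₁ w₂ : ℝ → H}
    (hw : ContinuousOn w (Icc 0 T))
    (hw₁ : ContinuousOn w₁ (Icc 0 T)) (hw₂ : ContinuousOn w₂ (Ioo 0 T))
    (h₁ : ∀ t ∈ Ioo 0 T, HasDerivAt w (w₁ t) t) (h₂ : ∀ t ∈ Ioo 0 T, HasDerivAt w₁ (w₂ t) t)
    (hsymm : ∀ s ∈ Ioo 0 T, ∀ t ∈ Ioo 0 T, ⟪w₂ s, w t⟫_ℝ = ⟪w s, w₂ t⟫_ℝ)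
    (h0 : w 0 = 0) (h01 : w₁ 0 = 0) {t : ℝ} (ht : t ∈ Ioo 0 T) : w t = 0 := by
  by_contra hne
  set f : ℝ → ℝ := fun s => ⟪w s, w s⟫_ℝ with hf
  set m : ℝ → ℝ := fun s => ⟪w₁ s, w s⟫_ℝ with hm
  have hIcc : Icc 0 t ⊆ Icc 0 T := Icc_subset_Icc_right ht.2.le
  have hfc : ContinuousOn f (Icc 0 t) := (hw.mono hIcc).inner (hw.mono hIcc)
  have hcl : IsCompact (Icc 0 t ∩ f ⁻¹' {0}) :=
    isCompact_Icc.of_isClosed_subset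
      (hfc.preimage_isClosed_of_isClosed isClosed_Icc isClosed_singleton) inter_subset_left
  obtain ⟨t₀, ⟨ht₀, hft₀⟩, hmax⟩ := hcl.exists_isGreatest ⟨0, ⟨le_rfl, ht.1.le⟩, by simp [f, h0]⟩
  have hft₀' : f t₀ = 0 := hft₀
  have hft : f t ≠ 0 := fun h => hne (inner_self_eq_zero.1 h)
  have hlt : t₀ < t := lt_of_le_of_ne ht₀.2 fun h => hft (h ▸ hft₀')
  have hfpos : ∀ s ∈ Ioc t₀ t, 0 < f s := by
    intro s hs
    refine lt_of_le_of_ne real_inner_self_nonneg fun h => ?_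
    exact absurd (hmax ⟨⟨ht₀.1.trans hs.1.le, hs.2⟩, h.symm⟩) (not_le.2 hs.1)
  have hsubT : ∀ s ∈ Ioc t₀ t, s ∈ Ioo 0 T := fun s hs =>
    ⟨ht₀.1.trans_lt hs.1, hs.2.trans_lt ht.2⟩
  have hf' : ∀ s ∈ Ioc t₀ t, HasDerivAt f (2 * m s) s := by
    intro s hs
    refine ((h₁ s (hsubT s hs)).inner ℝ (h₁ s (hsubT s hs))).congr_deriv ?_
    simp only [hm]
    linarith [real_inner_comm (w s) (w₁ s)]
  have hm' : ∀ s ∈ Ioc t₀ t, HasDerivAt m (2 * ‖w₁ s‖ ^ 2) s := by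
    intro s hs
    refine ((h₂ s (hsubT s hs)).inner ℝ (h₁ s (hsubT s hs))).congr_deriv ?_
    rw [energy_eq_zero hw hw₁ hw₂ h₁ h₂ hsymm h0 h01 (hsubT s hs), real_inner_self_eq_norm_sq]
    ring
  have hq : ∀ s ∈ Ioc t₀ t, HasDerivAt (fun s => m s / f s)
      ((2 * ‖w₁ s‖ ^ 2 * f s - m s * (2 * m s)) / f s ^ 2) s := fun s hs =>
    (hm' s hs).div (hf' s hs) (hfpos s hs).ne'
  have hmono : MonotoneOn (fun s => m s / f s) (Ioc t₀ t) := by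
    refine monotoneOn_of_deriv_nonneg (convex_Ioc _ _)
      (fun s hs => (hq s hs).continuousAt.continuousWithinAt)
      (fun s hs => (hq s (interior_subset hs)).differentiableAt.differentiableWithinAt)
      fun s hs => ?_
    rw [(hq s (interior_subset hs)).deriv]
    refine div_nonneg ?_ (sq_nonneg _)
    have hcs := real_inner_mul_inner_self_le (w₁ s) (w s)
    rw [real_inner_self_eq_norm_sq (w₁ s)] at hcs
    simp only [hf, hm]
    linarith
  set M := m t / f t
  have hmM : ∀ s ∈ Ioc t₀ t, m s ≤ M * f s := fun s hs =>
    (div_le_iff₀ (hfpos s hs)).1 (hmono hs (right_mem_Ioc.2 hlt) hs.2)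
  have hanti : AntitoneOn (fun s => f s * Real.exp (-(2 * M) * s)) (Icc t₀ t) := by
    have hd : ∀ s ∈ Ioc t₀ t, HasDerivAt (fun s => f s * Real.exp (-(2 * M) * s))
        (2 * m s * Real.exp (-(2 * M) * s) + f s * (Real.exp (-(2 * M) * s) * (-(2 * M)))) s := by
      intro s hs
      have := ((hasDerivAt_id s).const_mul (-(2 * M))).exp
      simp only [mul_one, id] at this
      exact (hf' s hs).mul this
    refine antitoneOn_of_deriv_nonpos (convex_Icc _ _)
      ((hfc.mono (Icc_subset_Icc_left ht₀.1)).mul (by fun_prop)) ?_ ?_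
    · rw [interior_Icc]
      exact fun s hs => (hd s (Ioo_subset_Ioc_self hs)).differentiableAt.differentiableWithinAt
    · rw [interior_Icc]
      intro s hs
      rw [(hd s (Ioo_subset_Ioc_self hs)).deriv]
      have := hmM s (Ioo_subset_Ioc_self hs)
      have he := Real.exp_pos (-(2 * M) * s)
      nlinarith
  have := hanti (left_mem_Icc.2 hlt.le) (right_mem_Icc.2 hlt.le) hlt.le
  simp only [hft₀', zero_mul] at this
  have hpos := mul_pos (hfpos t (right_mem_Ioc.2 hlt)) (Real.exp_pos (-(2 * M) * t))
  linarith

end Uniqueness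

/-! ### Solutions are finite sums of separated solutions -/

namespace DegenerateElliptic

open scoped InnerProductSpace

/-- The graph of the operator `P`, as a set of pairs of classes of functions in `L²(0,1)`. -/
def opGraph (α : ℝ) : Set (Lp ℝ 2 μ01 × Lp ℝ 2 μ01) :=
  {F | ∃ ϑ, MemDomain α ϑ ∧ F.1 =ᵐ[μ01] ϑ ∧ F.2 =ᵐ[μ01] opP α ϑ}

lemma inner_opGraph {α : ℝ} {F G : Lp ℝ 2 μ01 × Lp ℝ 2 μ01} (hF : F ∈ opGraph α)
    (hG : G ∈ opGraph α) : ⟪F.2, G.1⟫_ℝ = ⟪F.1, G.2⟫_ℝ := by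
  obtain ⟨u, hu, hu1, hu2⟩ := hF
  obtain ⟨v, hv, hv1, hv2⟩ := hG
  rw [L2.inner_def, L2.inner_def]
  have h1 : ∫ x, ⟪F.2 x, G.1 x⟫_ℝ ∂μ01 = ∫ x in Ioo (0 : ℝ) 1, opP α u x * v x := by
    refine integral_congr_ae ?_
    filter_upwards [hu2, hv1] with x hx hx'
    rw [hx, hx', real_inner_comm]
    rfl
  have h2 : ∫ x, ⟪F.1 x, G.2 x⟫_ℝ ∂μ01 = ∫ x in Ioo (0 : ℝ) 1, u x * opP α v x := by
    refine integral_congr_ae ?_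
    filter_upwards [hu1, hv2] with x hx hx'
    rw [hx, hx', real_inner_comm]
    rfl
  rw [h1, h2, hu.integral_opP_mul_comm hv]

lemma inner_span_opGraph {α : ℝ} {F G : Lp ℝ 2 μ01 × Lp ℝ 2 μ01}
    (hF : F ∈ Submodule.span ℝ (opGraph α)) (hG : G ∈ Submodule.span ℝ (opGraph α)) :
    ⟪F.2, G.1⟫_ℝ = ⟪F.1, G.2⟫_ℝ := by
  induction hF using Submodule.span_induction with
  | zero => simp
  | add x y _ _ hx hy => simp [inner_add_left, hx, hy]
  | smul c x _ hx => simp [real_inner_smul_left, hx]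
  | mem x hx =>
    induction hG using Submodule.span_induction with
    | zero => simp
    | add y z _ _ hy hz => simp [inner_add_right, hy, hz]
    | smul c y _ hy => simp [real_inner_smul_right, hy]
    | mem y hy => exact inner_opGraph hx hy

/-- The data of a finite sum `∑ cᵢ(t) eᵢ(x)`, where `P eᵢ = λᵢ eᵢ` and `cᵢ'' = λᵢ cᵢ`. The
derivative of `c i` is `c' i`. -/
structure ModalSum (α : ℝ) (ι : Type) where
  /-- the functions `eᵢ` -/
  e : ι → ℝ → ℝ
  /-- the eigenvalues -/
  lam : ι → ℝ
  /-- the coefficients -/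
  c : ι → ℝ → ℝ
  /-- the derivatives of the coefficients -/
  c' : ι → ℝ → ℝ
  dom : ∀ i, MemDomain α (e i)
  eig : ∀ i, opP α (e i) =ᵐ[μ01] fun x => lam i * e i x
  hasDerivAt_c : ∀ i t, HasDerivAt (c i) (c' i t) t
  hasDerivAt_c' : ∀ i t, HasDerivAt (c' i) (lam i * c i t) t

lemma exists_timeCoeff (lam a b : ℝ) : ∃ c c' : ℝ → ℝ, (∀ t, HasDerivAt c (c' t) t) ∧
    (∀ t, HasDerivAt c' (lam * c t) t) ∧ c 0 = a ∧ c' 0 = b := by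
  rcases lt_trichotomy lam 0 with h | rfl | h
  · set k := √(-lam)
    have hk : 0 < k := Real.sqrt_pos.2 (by linarith)
    have hk2 : k * k = -lam := Real.mul_self_sqrt (by linarith)
    have hd : ∀ t : ℝ, HasDerivAt (fun t => k * t) k t := fun t => by
      simpa using (hasDerivAt_id t).const_mul k
    refine ⟨fun t => a * Real.cos (k * t) + b / k * Real.sin (k * t),
      fun t => -(a * k) * Real.sin (k * t) + b * Real.cos (k * t), fun t => ?_, fun t => ?_,
      by simp, by simp⟩
    · refine (((hd t).cos.const_mul a).add ((hd t).sin.const_mul (b / k))).congr_deriv ?_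
      field_simp
    · refine (((hd t).sin.const_mul (-(a * k))).add ((hd t).cos.const_mul b)).congr_deriv ?_
      rw [show lam = -(k * k) by linarith]
      field_simp
      ring
  · exact ⟨fun t => a + b * t, fun _ => b,
      fun t => by simpa using ((hasDerivAt_id t).const_mul b).const_add a,
      fun t => by simpa using hasDerivAt_const t b, by simp, rfl⟩
  · set k := √lam
    have hk : 0 < k := Real.sqrt_pos.2 h
    have hk2 : k * k = lam := Real.mul_self_sqrt h.le
    have hd : ∀ t : ℝ, HasDerivAt (fun t => k * t) k t := fun t => by
      simpa using (hasDerivAt_id t).const_mul k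
    refine ⟨fun t => a * Real.cosh (k * t) + b / k * Real.sinh (k * t),
      fun t => a * k * Real.sinh (k * t) + b * Real.cosh (k * t), fun t => ?_, fun t => ?_,
      by simp, by simp⟩
    · refine (((hd t).cosh.const_mul a).add ((hd t).sinh.const_mul (b / k))).congr_deriv ?_
      field_simp
    · refine (((hd t).sinh.const_mul (a * k)).add ((hd t).cosh.const_mul b)).congr_deriv ?_
      rw [← hk2]
      field_simp

lemma exists_eq_sum_of_mem_eigenSpan {α : ℝ} {φ : ℝ → ℝ} (h : φ ∈ eigenSpan α) :
    ∃ (n : ℕ) (a : Fin n → ℝ) (e : Fin n → ℝ → ℝ) (lam : Fin n → ℝ),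
      (∀ i, MemDomain α (e i) ∧ opP α (e i) =ᵐ[μ01] fun x => lam i * e i x) ∧
      ∀ x, φ x = ∑ i, a i * e i x := by
  obtain ⟨n, a, e, he⟩ := Submodule.mem_span_set'.1 h
  choose lam hlam using fun i => (e i).2.2.2
  refine ⟨n, a, fun i => e i, lam, fun i => ⟨(e i).2.1, hlam i⟩, fun x => ?_⟩
  rw [← he]
  simp

lemma exists_modalSum {α : ℝ} {φ₀ φ₁ : ℝ → ℝ} (h₀ : φ₀ ∈ eigenSpan α) (h₁ : φ₁ ∈ eigenSpan α) :
    ∃ (ι : Type) (_ : Fintype ι) (S : ModalSum α ι),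
      (∀ x, φ₀ x = ∑ i, S.c i 0 * S.e i x) ∧ ∀ x, φ₁ x = ∑ i, S.c' i 0 * S.e i x := by
  obtain ⟨n, a, e, lam, he, hs⟩ := exists_eq_sum_of_mem_eigenSpan h₀
  obtain ⟨n', a', e', lam', he', hs'⟩ := exists_eq_sum_of_mem_eigenSpan h₁
  choose c c' h1 h2 h3 h4 using fun i : Fin n ⊕ Fin n' =>
    exists_timeCoeff (Sum.elim lam lam' i) (Sum.elim a 0 i) (Sum.elim 0 a' i)
  refine ⟨Fin n ⊕ Fin n', inferInstance,
    ⟨Sum.elim e e', Sum.elim lam lam', c, c', ?_, ?_, h1, h2⟩, fun x => ?_, fun x => ?_⟩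
  · rintro (i | i)
    exacts [(he i).1, (he' i).1]
  · rintro (i | i)
    exacts [(he i).2, (he' i).2]
  · simp [h3, hs]
  · simp [h4, hs']

namespace ModalSum

variable {α : ℝ} {ι : Type} (S : ModalSum α ι)

lemma continuous_c (i : ι) : Continuous (S.c i) :=
  continuous_iff_continuousAt.2 fun t => (S.hasDerivAt_c i t).continuousAt

lemma continuous_c' (i : ι) : Continuous (S.c' i) :=
  continuous_iff_continuousAt.2 fun t => (S.hasDerivAt_c' i t).continuousAt

variable [Fintype ι]

/-- The function `∑ cᵢ(t) eᵢ(x)`. -/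
def val (x t : ℝ) : ℝ := ∑ i, S.c i t * S.e i x

/-- The classes of the functions `eᵢ` in `L²(0,1)`. -/
noncomputable def eLp (i : ι) : Lp ℝ 2 μ01 := (S.dom i).memH1Zero.memLp.toLp

lemma pair_mem_span (a : ι → ℝ) :
    ((∑ i, a i • S.eLp i, ∑ i, (S.lam i * a i) • S.eLp i) : Lp ℝ 2 μ01 × Lp ℝ 2 μ01) ∈
      Submodule.span ℝ (opGraph α) := by
  have : ((∑ i, a i • S.eLp i, ∑ i, (S.lam i * a i) • S.eLp i) : Lp ℝ 2 μ01 × Lp ℝ 2 μ01) =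
      ∑ i, a i • (S.eLp i, S.lam i • S.eLp i) := by
    ext1 <;> simp [Prod.fst_sum, Prod.snd_sum, smul_smul, mul_comm]
  rw [this]
  refine Submodule.sum_mem _ fun i _ => Submodule.smul_mem _ _ (Submodule.subset_span ?_)
  have h := (S.dom i).memH1Zero.memLp.coeFn_toLp
  refine ⟨S.e i, S.dom i, h, ?_⟩
  filter_upwards [h, S.eig i, Lp.coeFn_smul (S.lam i) (S.eLp i)] with x h1 h2 h3
  rw [h3, h2, Pi.smul_apply, smul_eq_mul, eLp, h1]

lemma coeFn_sum_smul (a : ι → ℝ) :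
    ((∑ i, a i • S.eLp i : Lp ℝ 2 μ01) : ℝ → ℝ) =ᵐ[μ01] fun x => ∑ i, a i * S.e i x := by
  have h1 : ∀ᵐ x ∂μ01, ∀ i, (a i • S.eLp i : Lp ℝ 2 μ01) x = a i * S.e i x := by
    refine ae_all_iff.2 fun i => ?_
    filter_upwards [Lp.coeFn_smul (a i) (S.eLp i), (S.dom i).memH1Zero.memLp.coeFn_toLp]
      with x h2 h3
    rw [h2, Pi.smul_apply, smul_eq_mul, eLp, h3]
  filter_upwards [h1, Lp.coeFn_finsetSum Finset.univ fun i => a i • S.eLp i] with x hx hx'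
  rw [hx']
  simp [hx]

lemma hasDerivAt_curve {c c' : ι → ℝ → ℝ} {t : ℝ} (h : ∀ i, HasDerivAt (c i) (c' i t) t) :
    HasDerivAt (fun t => ∑ i, c i t • S.eLp i) (∑ i, c' i t • S.eLp i) t :=
  HasDerivAt.fun_sum fun i _ => (h i).smul_const _

lemma continuous_curve {c : ι → ℝ → ℝ} (h : ∀ i, Continuous (c i)) :
    Continuous fun t => ∑ i, c i t • S.eLp i :=
  continuous_finsetSum _ fun i _ => (h i).smul continuous_const

/-- The solution with initial data `∑ cᵢ(0) eᵢ` and `∑ cᵢ'(0) eᵢ` is `∑ cᵢ(t) eᵢ(x)`. -/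
theorem eq_of_isSolution {T : ℝ} {φ₀ φ₁ : ℝ → ℝ} {φ : ℝ × ℝ → ℝ} (hφ : IsSolution α T φ₀ φ₁ φ)
    (h₀ : ∀ x, φ₀ x = ∑ i, S.c i 0 * S.e i x) (h₁ : ∀ x, φ₁ x = ∑ i, S.c' i 0 * S.e i x)
    {x t : ℝ} (hx : x ∈ Ioo (0 : ℝ) 1) (ht : t ∈ Ioo 0 T) : φ (x, t) = S.val x t := by
  obtain ⟨u, hu, hC1, hC2, hP, hu0, hu1⟩ := hφ
  have hT : 0 < T := ht.1.trans ht.2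
  set v : ℝ → Lp ℝ 2 μ01 := derivWithin u (Icc 0 T)
  have hvc : ContinuousOn v (Icc 0 T) :=
    hC1.continuousOn_derivWithin (uniqueDiffOn_Icc hT) le_rfl
  have hv : ∀ s ∈ Ioo 0 T, HasDerivAt u (v s) s := fun s hs =>
    ((hC1.differentiableOn one_ne_zero s
      (Ioo_subset_Icc_self hs)).hasDerivWithinAt).hasDerivAt (Icc_mem_nhds hs.1 hs.2)
  have hd : ContDiffOn ℝ 1 (deriv u) (Ioo 0 T) := hC2.deriv_of_isOpen isOpen_Ioo (by norm_num)
  have hdd : ContinuousOn (deriv (deriv u)) (Ioo 0 T) :=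
    (hd.deriv_of_isOpen (m := 0) isOpen_Ioo (by norm_num)).continuousOn
  have hv' : ∀ s ∈ Ioo 0 T, HasDerivAt v (deriv (deriv u) s) s := by
    intro s hs
    have h1 := (hd.differentiableOn one_ne_zero).differentiableAt (isOpen_Ioo.mem_nhds hs)
    refine h1.hasDerivAt.congr_of_eventuallyEq ?_
    filter_upwards [isOpen_Ioo.mem_nhds hs] with y hy using (hv y hy).deriv.symm
  set U : ℝ → Lp ℝ 2 μ01 := fun t => ∑ i, S.c i t • S.eLp i with hU
  set U₁ : ℝ → Lp ℝ 2 μ01 := fun t => ∑ i, S.c' i t • S.eLp i with hU₁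
  set U₂ : ℝ → Lp ℝ 2 μ01 := fun t => ∑ i, (S.lam i * S.c i t) • S.eLp i with hU₂
  have hUc : Continuous U := S.continuous_curve S.continuous_c
  have hU₁c : Continuous U₁ := S.continuous_curve S.continuous_c'
  have hU₂c : Continuous U₂ := S.continuous_curve fun i => continuous_const.mul (S.continuous_c i)
  have hspan : ∀ s ∈ Ioo 0 T, ((u s - U s, deriv (deriv u) s - U₂ s) :
      Lp ℝ 2 μ01 × Lp ℝ 2 μ01) ∈ Submodule.span ℝ (opGraph α) := by
    intro s hs
    have h1 : ((u s, deriv (deriv u) s) : Lp ℝ 2 μ01 × Lp ℝ 2 μ01) ∈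
        Submodule.span ℝ (opGraph α) :=
      Submodule.subset_span ⟨_, (hP s hs).1, hu s hs, (hP s hs).2⟩
    exact Submodule.sub_mem _ h1 (S.pair_mem_span fun i => S.c i s)
  have hzero := eq_zero_of_symm_of_initial_eq_zero (T := T) (w := fun s => u s - U s)
    (w₁ := fun s => v s - U₁ s) (w₂ := fun s => deriv (deriv u) s - U₂ s)
    (hC1.continuousOn.sub hUc.continuousOn) (hvc.sub hU₁c.continuousOn)
    (hdd.sub hU₂c.continuousOn)
    (fun s hs => (hv s hs).sub (S.hasDerivAt_curve fun i => S.hasDerivAt_c i s))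
    (fun s hs => (hv' s hs).sub
      (S.hasDerivAt_curve (c' := fun i t => S.lam i * S.c i t) fun i => S.hasDerivAt_c' i s))
    (fun s hs r hr => inner_span_opGraph (hspan s hs) (hspan r hr))
    (by
      rw [sub_eq_zero]
      refine Lp.ext (hu0.trans ?_)
      filter_upwards [S.coeFn_sum_smul fun i => S.c i 0] with y hy
      rw [h₀, hU, hy])
    (by
      rw [sub_eq_zero]
      refine Lp.ext (hu1.trans ?_)
      filter_upwards [S.coeFn_sum_smul fun i => S.c' i 0] with y hy
      rw [h₁, hU₁, hy]) ht
  have hae : (fun x => φ (x, t)) =ᵐ[μ01] fun x => S.val x t := by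
    have hut : u t = U t := sub_eq_zero.1 hzero
    filter_upwards [hu t ht, S.coeFn_sum_smul fun i => S.c i t] with y hy hy'
    rw [← hy, hut, hU, hy', val]
  exact Measure.eqOn_open_of_ae_eq hae isOpen_Ioo (hP t ht).1.continuousOn
    (continuousOn_finsetSum _ fun i _ => continuousOn_const.mul (S.dom i).continuousOn) hx

end ModalSum

/-! ### The fundamental theorem of calculus on rectangles -/

section Rectangle

variable {a b c d : ℝ} {F D : ℝ → ℝ → ℝ}

lemma integrableOn_rectangle {f : ℝ × ℝ → ℝ} (hf : ContinuousOn f (Icc a b ×ˢ Icc c d)) :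
    IntegrableOn f (Ioo a b ×ˢ Ioo c d) :=
  (hf.integrableOn_compact (isCompact_Icc.prod isCompact_Icc)).mono_set
    (prod_mono Ioo_subset_Icc_self Ioo_subset_Icc_self)

lemma setIntegral_Ioo_eq_sub {f f' : ℝ → ℝ} (hab : a ≤ b)
    (hf : ∀ x ∈ Icc a b, HasDerivAt f (f' x) x) (hc : ContinuousOn f' (Icc a b)) :
    ∫ x in Ioo a b, f' x = f b - f a := by
  rw [← integral_Ioc_eq_integral_Ioo, ← intervalIntegral.integral_of_le hab]
  refine intervalIntegral.integral_eq_sub_of_hasDerivAt (fun x hx => hf x ?_) ?_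
  · rwa [uIcc_of_le hab] at hx
  · exact ContinuousOn.intervalIntegrable (by rwa [uIcc_of_le hab])

lemma integral_partial_fst (hab : a ≤ b)
    (hF : ∀ x ∈ Icc a b, ∀ t ∈ Icc c d, HasDerivAt (fun x => F x t) (D x t) x)
    (hD : ContinuousOn (fun q : ℝ × ℝ => D q.1 q.2) (Icc a b ×ˢ Icc c d)) :
    ∫ q in Ioo a b ×ˢ Ioo c d, D q.1 q.2 = ∫ t in Ioo c d, (F b t - F a t) := by
  have hi : Integrable (fun q : ℝ × ℝ => D q.1 q.2)
      ((volume.restrict (Ioo a b)).prod (volume.restrict (Ioo c d))) := by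
    rw [Measure.prod_restrict]; exact integrableOn_rectangle hD
  rw [Measure.volume_eq_prod, ← Measure.prod_restrict, integral_prod_symm _ hi]
  refine setIntegral_congr_fun measurableSet_Ioo fun t ht => ?_
  have ht' := Ioo_subset_Icc_self ht
  exact setIntegral_Ioo_eq_sub hab (fun x hx => hF x hx t ht')
    (hD.comp (f := fun x => (x, t)) (by fun_prop) fun x hx => ⟨hx, ht'⟩)

lemma integral_partial_snd (hcd : c ≤ d)
    (hF : ∀ x ∈ Icc a b, ∀ t ∈ Icc c d, HasDerivAt (fun t => F x t) (D x t) t)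
    (hD : ContinuousOn (fun q : ℝ × ℝ => D q.1 q.2) (Icc a b ×ˢ Icc c d)) :
    ∫ q in Ioo a b ×ˢ Ioo c d, D q.1 q.2 = ∫ x in Ioo a b, (F x d - F x c) := by
  have hi : Integrable (fun q : ℝ × ℝ => D q.1 q.2)
      ((volume.restrict (Ioo a b)).prod (volume.restrict (Ioo c d))) := by
    rw [Measure.prod_restrict]; exact integrableOn_rectangle hD
  rw [Measure.volume_eq_prod, ← Measure.prod_restrict, integral_prod _ hi]
  refine setIntegral_congr_fun measurableSet_Ioo fun x hx => ?_
  have hx' := Ioo_subset_Icc_self hx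
  exact setIntegral_Ioo_eq_sub hcd (fun t ht => hF x hx' t ht)
    (hD.comp (f := fun t => (x, t)) (by fun_prop) fun t ht => ⟨hx', ht⟩)

end Rectangle

/-! ### The Carleman identity -/

section Identity

/-- The symbol `N = τ² + p r²` of the operator at the covector `(r, τ) = ∇ρ`. -/
def sym (τ p r : ℝ) : ℝ := τ ^ 2 + p * r ^ 2

/-- The derivative `W = τ z_t + p r z_x` along the conormal field of `ρ`. -/
def conormal (τ p r zx zt : ℝ) : ℝ := τ * zt + p * r * zx

/-- The energy density `(p z_x² + z_t² - s²λ²E² N z²) / 2`. -/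
noncomputable def density (s lam τ p r E z zx zt : ℝ) : ℝ :=
  (p * zx ^ 2 + zt ^ 2 - s ^ 2 * lam ^ 2 * E ^ 2 * sym τ p r * z ^ 2) / 2

/-- The `x`-component of the vector field whose divergence is `carlemanForm`. -/
noncomputable def fluxX (s lam τ p r E z zx zt : ℝ) : ℝ :=
  E * (p * zx * (lam * sym τ p r * z - conormal τ p r zx zt) +
    p * r * density s lam τ p r E z zx zt)

/-- The `t`-component of the vector field whose divergence is `carlemanForm`. -/
noncomputable def fluxT (s lam τ p r E z zx zt : ℝ) : ℝ :=
  E * (zt * (lam * sym τ p r * z - conormal τ p r zx zt) +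
    τ * density s lam τ p r E z zx zt)

/-- The `x`-derivative of `fluxX`, by the product rule. -/
noncomputable def dFluxX (s lam τ k p p₁ r E z zx zt zxx zxt : ℝ) : ℝ :=
  -(lam * r * E) * (p * zx * (lam * sym τ p r * z - conormal τ p r zx zt) +
      p * r * density s lam τ p r E z zx zt) +
    E * ((p₁ * zx + p * zxx) * (lam * sym τ p r * z - conormal τ p r zx zt) +
      p * zx * (lam * (p₁ * r ^ 2 + 2 * p * r * k) * z + lam * sym τ p r * zx -
        (τ * zxt + p₁ * r * zx + p * k * zx + p * r * zxx)) +
      (p₁ * r + p * k) * density s lam τ p r E z zx zt +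
      p * r * ((p₁ * zx ^ 2 + 2 * p * zx * zxx + 2 * zt * zxt -
        s ^ 2 * lam ^ 2 * (-(2 * lam * r) * E ^ 2 * sym τ p r * z ^ 2 +
          E ^ 2 * (p₁ * r ^ 2 + 2 * p * r * k) * z ^ 2 +
          E ^ 2 * sym τ p r * (2 * z * zx))) / 2))

/-- The `t`-derivative of `fluxT`, by the product rule. -/
noncomputable def dFluxT (s lam τ p r E z zx zt zxt ztt : ℝ) : ℝ :=
  -(lam * τ * E) * (zt * (lam * sym τ p r * z - conormal τ p r zx zt) +
      τ * density s lam τ p r E z zx zt) +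
    E * (ztt * (lam * sym τ p r * z - conormal τ p r zx zt) +
      zt * (lam * sym τ p r * zt - (τ * ztt + p * r * zxt)) +
      τ * ((2 * p * zx * zxt + 2 * zt * ztt -
        s ^ 2 * lam ^ 2 * (-(2 * lam * τ) * E ^ 2 * sym τ p r * z ^ 2 +
          E ^ 2 * sym τ p r * (2 * z * zt))) / 2))

/-- The quadratic form in `(z, z_x, z_t)` of the Carleman identity; `p₁` stands for `p'` and `k`
for `r' = ρ_xx`. -/
noncomputable def carlemanForm (s lam τ k p p₁ r E z zx zt : ℝ) : ℝ :=
  E * (lam * conormal τ p r zx zt ^ 2 + 2 * s * lam * E * conormal τ p r zx zt ^ 2 -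
    s * lam * E * (3 * lam * sym τ p r - (p₁ * r + p * k)) * z * conormal τ p r zx zt +
    lam * z * (p * (p₁ * r ^ 2 + 2 * p * r * k) * zx - lam * sym τ p r * conormal τ p r zx zt) +
    (lam * sym τ p r + (p₁ * r + p * k)) / 2 * (p * zx ^ 2 + zt ^ 2) -
    (k * p ^ 2 + p * p₁ * r / 2) * zx ^ 2 +
    z ^ 2 * (s ^ 2 * lam ^ 3 * E ^ 2 * sym τ p r ^ 2 / 2 -
      s ^ 2 * lam ^ 2 * E ^ 2 *
        (p * r * (p₁ * r ^ 2 + 2 * p * r * k) + (p₁ * r + p * k) * sym τ p r) / 2 +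
      s * lam ^ 2 * E * sym τ p r * (lam * sym τ p r - (p₁ * r + p * k))))

lemma hasDerivAt_fluxX {s lam τ k p₁ zxx zxt x : ℝ} {p r E z zx zt : ℝ → ℝ}
    (hp : HasDerivAt p p₁ x) (hr : HasDerivAt r k x)
    (hE : HasDerivAt E (-(lam * r x * E x)) x) (hz : HasDerivAt z (zx x) x)
    (hzx : HasDerivAt zx zxx x) (hzt : HasDerivAt zt zxt x) :
    HasDerivAt (fun x => fluxX s lam τ (p x) (r x) (E x) (z x) (zx x) (zt x))
      (dFluxX s lam τ k (p x) p₁ (r x) (E x) (z x) (zx x) (zt x) zxx zxt) x := by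
  have hN : HasDerivAt (fun x => sym τ (p x) (r x)) (p₁ * r x ^ 2 + 2 * p x * r x * k) x := by
    refine ((hp.mul (hr.pow 2)).const_add (τ ^ 2)).congr_deriv ?_
    simp; ring
  have hW : HasDerivAt (fun x => conormal τ (p x) (r x) (zx x) (zt x))
      (τ * zxt + p₁ * r x * zx x + p x * k * zx x + p x * r x * zxx) x := by
    refine ((hzt.const_mul τ).add ((hp.mul hr).mul hzx)).congr_deriv ?_
    simp only [Pi.mul_apply]; ring
  have hG : HasDerivAt (fun x => density s lam τ (p x) (r x) (E x) (z x) (zx x) (zt x))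
      ((p₁ * zx x ^ 2 + 2 * p x * zx x * zxx + 2 * zt x * zxt -
        s ^ 2 * lam ^ 2 * (-(2 * lam * r x) * E x ^ 2 * sym τ (p x) (r x) * z x ^ 2 +
          E x ^ 2 * (p₁ * r x ^ 2 + 2 * p x * r x * k) * z x ^ 2 +
          E x ^ 2 * sym τ (p x) (r x) * (2 * z x * zx x))) / 2) x := by
    refine ((((hp.mul (hzx.pow 2)).add (hzt.pow 2)).sub
      ((((hE.pow 2).const_mul (s ^ 2 * lam ^ 2)).mul hN).mul (hz.pow 2))).div_const
        2).congr_deriv ?_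
    simp; ring
  refine (hE.mul ((((hp.mul hzx).mul (((hN.const_mul lam).mul hz).sub hW)).add
    ((hp.mul hr).mul hG)))).congr_deriv ?_
  simp only [Pi.mul_apply, Pi.add_apply, Pi.sub_apply, dFluxX]; ring

lemma hasDerivAt_fluxT {s lam τ p r zxt ztt t : ℝ} {E z zx zt : ℝ → ℝ}
    (hE : HasDerivAt E (-(lam * τ * E t)) t) (hz : HasDerivAt z (zt t) t)
    (hzx : HasDerivAt zx zxt t) (hzt : HasDerivAt zt ztt t) :
    HasDerivAt (fun t => fluxT s lam τ p r (E t) (z t) (zx t) (zt t))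
      (dFluxT s lam τ p r (E t) (z t) (zx t) (zt t) zxt ztt) t := by
  have hW : HasDerivAt (fun t => conormal τ p r (zx t) (zt t)) (τ * ztt + p * r * zxt) t :=
    (hzt.const_mul τ).add (hzx.const_mul (p * r))
  have hG : HasDerivAt (fun t => density s lam τ p r (E t) (z t) (zx t) (zt t))
      ((2 * p * zx t * zxt + 2 * zt t * ztt -
        s ^ 2 * lam ^ 2 * (-(2 * lam * τ) * E t ^ 2 * sym τ p r * z t ^ 2 +
          E t ^ 2 * sym τ p r * (2 * z t * zt t))) / 2) t := by
    refine (((((hzx.pow 2).const_mul p).add (hzt.pow 2)).sub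
      ((((hE.pow 2).const_mul (s ^ 2 * lam ^ 2)).mul_const (sym τ p r)).mul
        (hz.pow 2))).div_const 2).congr_deriv ?_
    simp; ring
  refine (hE.mul ((hzt.mul ((hz.const_mul (lam * sym τ p r)).sub hW)).add
    (hG.const_mul τ))).congr_deriv ?_
  simp only [Pi.mul_apply, Pi.add_apply, Pi.sub_apply, dFluxT]

/-- The Carleman identity: if `z = e^{sE} φ` with `φ_tt + (p φ_x)_x = 0`, which is the hypothesis
on `z`, then the divergence of `(fluxX, fluxT)` is `carlemanForm`. -/
lemma dFluxX_add_dFluxT {s lam τ k p p₁ r E z zx zt zxx zxt ztt : ℝ}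
    (h : p * zxx + p₁ * zx + ztt = -(2 * s * lam * E) * conormal τ p r zx zt -
      (s ^ 2 * lam ^ 2 * E ^ 2 * sym τ p r -
        s * lam * E * (lam * sym τ p r - (p₁ * r + p * k))) * z) :
    dFluxX s lam τ k p p₁ r E z zx zt zxx zxt + dFluxT s lam τ p r E z zx zt zxt ztt =
      carlemanForm s lam τ k p p₁ r E z zx zt := by
  simp only [dFluxX, dFluxT, carlemanForm, density, conormal, sym] at *
  linear_combination E * (lam * (τ ^ 2 + p * r ^ 2) * z - (τ * zt + p * r * zx)) * h

end Identity

/-! ### Coercivity -/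

section Coercivity

/-- The bound on `carlemanForm / E` from below, under the conditions `h₁`, `h₂` that express that
`lam` is large; `m` stands for `(p r)'` and `n` for `N_x`. -/
lemma carlemanForm_inner_ge {s lam τ k p p₁ r E z zx zt N m n Nb mb nb : ℝ} (hs : 0 ≤ s)
    (hlam : 0 < lam) (hτ : 0 < τ) (hp : 0 < p) (hp1 : p ≤ 1) (hE : 0 < E) (hE1 : E ≤ 1)
    (hN : τ ^ 2 ≤ N) (hNb : N ≤ Nb) (hm : |m| ≤ mb) (hn : |n| ≤ nb)
    (h₁ : mb + 2 * |k * p + p₁ * r / 2| ≤ lam * τ ^ 2 / 2)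
    (h₂ : 2 * |p * r * n + m * N| ≤ lam * N ^ 2) (W : ℝ) :
    lam * τ ^ 2 / 8 * (p * zx ^ 2 + zt ^ 2) + (s ^ 2 * lam ^ 3 * E ^ 2 * N ^ 2 / 4 -
      (s * (lam * (3 * lam * Nb + mb) ^ 2 / 8 + lam ^ 2 * Nb * mb) +
        (lam ^ 3 * Nb ^ 2 / 4 + 2 * lam * nb ^ 2 / τ ^ 2))) * z ^ 2 ≤
    lam * W ^ 2 + 2 * s * lam * E * W ^ 2 - s * lam * E * (3 * lam * N - m) * z * W +
    lam * z * (p * n * zx - lam * N * W) + (lam * N + m) / 2 * (p * zx ^ 2 + zt ^ 2) -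
    (k * p ^ 2 + p * p₁ * r / 2) * zx ^ 2 +
    z ^ 2 * (s ^ 2 * lam ^ 3 * E ^ 2 * N ^ 2 / 2 -
      s ^ 2 * lam ^ 2 * E ^ 2 * (p * r * n + m * N) / 2 +
      s * lam ^ 2 * E * N * (lam * N - m)) := by
  have hτ2 : 0 < τ ^ 2 := by positivity
  have hN0 : 0 < N := hτ2.trans_le hN
  have hNb0 : 0 < Nb := hN0.trans_le hNb
  have hmb0 : 0 ≤ mb := (abs_nonneg _).trans hm
  have hm' := abs_le.1 hm
  have hn2 : n ^ 2 ≤ nb ^ 2 := by rw [← sq_abs n]; exact pow_le_pow_left₀ (abs_nonneg _) hn 2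
  have hz : 0 ≤ z ^ 2 := sq_nonneg z
  -- the terms with `s W²` and `s z W`
  have e1 : -(s * (lam * (3 * lam * Nb + mb) ^ 2 / 8) * z ^ 2) ≤
      2 * s * lam * E * W ^ 2 - s * lam * E * (3 * lam * N - m) * z * W := by
    have h : (3 * lam * N - m) ^ 2 ≤ (3 * lam * Nb + mb) ^ 2 := by
      have h1 : lam * N ≤ lam * Nb := by gcongr
      have h2 : 0 < lam * N := by positivity
      exact sq_le_sq' (by linarith [hm'.2]) (by linarith [hm'.1])
    have h' : s * lam * E * ((3 * lam * N - m) ^ 2 * z ^ 2) ≤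
        s * lam * 1 * ((3 * lam * Nb + mb) ^ 2 * z ^ 2) := by gcongr
    have h'' : 0 ≤ s * lam * E * (4 * W - (3 * lam * N - m) * z) ^ 2 := by positivity
    linear_combination h' / 8 + h'' / 8
  -- the terms with `W²` and `z W`
  have e2 : -(lam ^ 3 * Nb ^ 2 / 4 * z ^ 2) ≤ lam * W ^ 2 - lam * z * (lam * N * W) := by
    have h' : lam ^ 3 * N ^ 2 * z ^ 2 ≤ lam ^ 3 * Nb ^ 2 * z ^ 2 := by gcongr
    have h'' : 0 ≤ lam * (2 * W - lam * N * z) ^ 2 := by positivity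
    linear_combination h' / 4 + h'' / 4
  -- the term with `z z_x`
  have e3 : -(lam * τ ^ 2 / 8 * (p * zx ^ 2)) - 2 * lam * nb ^ 2 / τ ^ 2 * z ^ 2 ≤
      lam * z * (p * n * zx) := by
    have h1 : 0 ≤ lam * p / (8 * τ ^ 2) * (τ ^ 2 * zx + 4 * n * z) ^ 2 := by positivity
    have h2 : lam * p / (8 * τ ^ 2) * (τ ^ 2 * zx + 4 * n * z) ^ 2 =
        lam * τ ^ 2 / 8 * (p * zx ^ 2) + lam * z * (p * n * zx) +
          p * (2 * lam * n ^ 2 / τ ^ 2 * z ^ 2) := by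
      field_simp; ring
    have h3 : p * (2 * lam * n ^ 2 / τ ^ 2 * z ^ 2) ≤ 1 * (2 * lam * nb ^ 2 / τ ^ 2 * z ^ 2) := by
      gcongr
    linear_combination h1 + h2 + h3
  -- the gradient terms
  have e4 : lam * τ ^ 2 / 4 * (p * zx ^ 2 + zt ^ 2) ≤
      (lam * N + m) / 2 * (p * zx ^ 2 + zt ^ 2) - (k * p ^ 2 + p * p₁ * r / 2) * zx ^ 2 := by
    have hk := abs_le.1 (le_refl |k * p + p₁ * r / 2|)
    have hk0 := abs_nonneg (k * p + p₁ * r / 2)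
    have hlN : lam * τ ^ 2 ≤ lam * N := by gcongr
    have c1 : 0 ≤ (lam * N + m) / 2 - (k * p + p₁ * r / 2) - lam * τ ^ 2 / 4 := by linarith
    have c2 : 0 ≤ (lam * N + m) / 2 - lam * τ ^ 2 / 4 := by linarith
    have c3 := mul_nonneg c1 (show 0 ≤ p * zx ^ 2 by positivity)
    have c4 := mul_nonneg c2 (sq_nonneg zt)
    linear_combination c3 + c4
  -- the leading terms with `z²`
  have e5 : s ^ 2 * lam ^ 3 * E ^ 2 * N ^ 2 / 4 ≤ s ^ 2 * lam ^ 3 * E ^ 2 * N ^ 2 / 2 -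
      s ^ 2 * lam ^ 2 * E ^ 2 * (p * r * n + m * N) / 2 := by
    have hx := le_abs_self (p * r * n + m * N)
    have c1 : 0 ≤ lam * N ^ 2 - 2 * (p * r * n + m * N) := by linarith
    have c2 := mul_nonneg (show 0 ≤ s ^ 2 * lam ^ 2 * E ^ 2 by positivity) c1
    linear_combination c2 / 4
  have e6 : -(s * (lam ^ 2 * Nb * mb)) ≤ s * lam ^ 2 * E * N * (lam * N - m) := by
    have c1 : 0 ≤ s * lam ^ 2 * E * N * (lam * N) := by positivity
    have c2 : s * lam ^ 2 * E * N * m ≤ s * lam ^ 2 * 1 * Nb * mb := by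
      have : s * lam ^ 2 * E * N * m ≤ s * lam ^ 2 * E * N * mb :=
        mul_le_mul_of_nonneg_left hm'.2 (by positivity)
      refine this.trans ?_
      gcongr
    linear_combination c1 + c2
  have e7 := mul_le_mul_of_nonneg_left (add_le_add e5 e6) hz
  have e8 : 0 ≤ lam * τ ^ 2 / 8 * zt ^ 2 := by positivity
  linear_combination e1 + e2 + e3 + e4 + e7 + e8

/-- The bound of `exists_carlemanForm_ge`, for constants `lam` and `s` that are large enough. -/
lemma carlemanForm_ge {τ k P₀ M R lam c s p p₁ r E z zx zt Nb mb nb K₁ K₂ q e₀ : ℝ}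
    (hτ : 0 < τ) (hk : 0 < k) (hP₀ : 0 < P₀) (hM : 0 ≤ M) (hR : 0 ≤ R) (hlam : 0 < lam)
    (hNb_def : Nb = τ ^ 2 + R ^ 2) (hmb_def : mb = M * R + k)
    (hnb_def : nb = M * R ^ 2 + 2 * R * k)
    (hK₁_def : K₁ = lam * (3 * lam * Nb + mb) ^ 2 / 8 + lam ^ 2 * Nb * mb)
    (hK₂_def : K₂ = lam ^ 3 * Nb ^ 2 / 4 + 2 * lam * nb ^ 2 / τ ^ 2)
    (hq : q = lam ^ 3 * e₀ ^ 2 * τ ^ 4 / 8)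
    (hl1 : 2 * mb + 4 * (k + M * R) ≤ lam * τ ^ 2)
    (hl2 : 2 * (R * nb + mb * Nb) ≤ lam * τ ^ 4) (he₀ : 0 < e₀) (hc : 0 < c)
    (hc1 : c ≤ lam * τ ^ 2 / 8 * min P₀ 1) (hc2 : c ≤ q) (hs1 : 1 ≤ s)
    (hsq : K₁ + K₂ ≤ s * q) (hp : P₀ ≤ p) (hp1 : p ≤ 1) (hp₁ : |p₁| ≤ M) (hr : |r| ≤ R)
    (hE : e₀ ≤ E) (hE1 : E ≤ 1) :
    e₀ * c * (zx ^ 2 + zt ^ 2 + s ^ 2 * z ^ 2) ≤ carlemanForm s lam τ k p p₁ r E z zx zt := by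
  have hNb : 0 < Nb := by rw [hNb_def]; positivity
  have hmb : 0 ≤ mb := by rw [hmb_def]; positivity
  have hnb : 0 ≤ nb := by rw [hnb_def]; positivity
  have hK₂ : 0 ≤ K₂ := by rw [hK₂_def]; positivity
  have hs0 : 0 < s := by linarith
  have hp0 : 0 < p := hP₀.trans_le hp
  have hE0 : 0 < E := he₀.trans_le hE
  have hMR : 0 ≤ M * R := by positivity
  have hr2 : r ^ 2 ≤ R ^ 2 := by rw [← sq_abs r]; exact pow_le_pow_left₀ (abs_nonneg _) hr 2
  have hpr : |p₁ * r| ≤ M * R := by rw [abs_mul]; gcongr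
  have hm : |p₁ * r + p * k| ≤ mb := by
    rw [hmb_def]
    refine (abs_add_le _ _).trans (add_le_add hpr ?_)
    rw [abs_of_pos (by positivity)]
    exact mul_le_of_le_one_left hk.le hp1
  have hn : |p₁ * r ^ 2 + 2 * p * r * k| ≤ nb := by
    rw [hnb_def]
    refine (abs_add_le _ _).trans (add_le_add ?_ ?_)
    · rw [abs_mul, abs_of_nonneg (sq_nonneg r)]; gcongr
    · rw [abs_mul, abs_mul, abs_mul, abs_of_pos hp0, abs_of_pos hk, abs_of_pos (zero_lt_two' ℝ)]
      have : 2 * p * |r| * k ≤ 2 * 1 * R * k := by gcongr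
      linarith
  have hN : τ ^ 2 ≤ sym τ p r := le_add_of_nonneg_right (by positivity)
  have hNb' : sym τ p r ≤ Nb := by
    have : p * r ^ 2 ≤ 1 * R ^ 2 := by gcongr
    rw [sym, hNb_def]; linarith
  have hN4 : τ ^ 4 ≤ sym τ p r ^ 2 := by
    rw [show τ ^ 4 = (τ ^ 2) ^ 2 by ring]; gcongr
  have h₁ : mb + 2 * |k * p + p₁ * r / 2| ≤ lam * τ ^ 2 / 2 := by
    have h1 : |k * p + p₁ * r / 2| ≤ k + M * R := by
      refine (abs_add_le _ _).trans (add_le_add ?_ ?_)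
      · rw [abs_of_pos (by positivity)]
        exact mul_le_of_le_one_right hk.le hp1
      · rw [abs_div, abs_of_pos (zero_lt_two' ℝ)]
        have := abs_nonneg (p₁ * r)
        linarith
    linarith
  have h₂ : 2 * |p * r * (p₁ * r ^ 2 + 2 * p * r * k) + (p₁ * r + p * k) * sym τ p r| ≤
      lam * sym τ p r ^ 2 := by
    have h1 : |p * r * (p₁ * r ^ 2 + 2 * p * r * k) + (p₁ * r + p * k) * sym τ p r| ≤
        R * nb + mb * Nb := by
      refine (abs_add_le _ _).trans (add_le_add ?_ ?_)
      · rw [abs_mul, abs_mul, abs_of_pos hp0]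
        have : p * |r| * |p₁ * r ^ 2 + 2 * p * r * k| ≤ 1 * R * nb := by gcongr
        linarith
      · rw [abs_mul, abs_of_nonneg ((sq_nonneg τ).trans hN)]
        exact mul_le_mul hm hNb' ((sq_nonneg τ).trans hN) hmb
    have h3 : lam * τ ^ 4 ≤ lam * sym τ p r ^ 2 := by gcongr
    linarith
  have hmain : lam * τ ^ 2 / 8 * (p * zx ^ 2 + zt ^ 2) +
      (s ^ 2 * lam ^ 3 * E ^ 2 * sym τ p r ^ 2 / 4 - (s * K₁ + K₂)) * z ^ 2 ≤ _ :=
    hK₁_def ▸ hK₂_def ▸ carlemanForm_inner_ge (z := z) (zx := zx) (zt := zt) hs0.le hlam hτ hp0 hp1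
      hE0 hE1 hN hNb' hm hn h₁ h₂ (conormal τ p r zx zt)
  have hcoef : s ^ 2 * q ≤ s ^ 2 * lam ^ 3 * E ^ 2 * sym τ p r ^ 2 / 4 - (s * K₁ + K₂) := by
    have h1 : s ^ 2 * lam ^ 3 * e₀ ^ 2 * τ ^ 4 ≤ s ^ 2 * lam ^ 3 * E ^ 2 * sym τ p r ^ 2 := by
      gcongr
    have h2 : K₂ ≤ s * K₂ := le_mul_of_one_le_left hK₂ hs1
    have h3 : s * (K₁ + K₂) ≤ s * (s * q) := by gcongr
    linear_combination h1 / 4 + h2 + h3 + 2 * s ^ 2 * hq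
  have hgrad : c * (zx ^ 2 + zt ^ 2) ≤ lam * τ ^ 2 / 8 * (p * zx ^ 2 + zt ^ 2) := by
    have h1 : min P₀ 1 * (zx ^ 2 + zt ^ 2) ≤ p * zx ^ 2 + zt ^ 2 := by
      have := mul_le_mul_of_nonneg_right ((min_le_left P₀ 1).trans hp) (sq_nonneg zx)
      have := mul_le_mul_of_nonneg_right (min_le_right P₀ 1) (sq_nonneg zt)
      linarith
    calc c * (zx ^ 2 + zt ^ 2) ≤ lam * τ ^ 2 / 8 * min P₀ 1 * (zx ^ 2 + zt ^ 2) := by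
          gcongr
      _ = lam * τ ^ 2 / 8 * (min P₀ 1 * (zx ^ 2 + zt ^ 2)) := by ring
      _ ≤ _ := by gcongr
  have hzero : c * (s ^ 2 * z ^ 2) ≤ (s ^ 2 * lam ^ 3 * E ^ 2 * sym τ p r ^ 2 / 4 -
      (s * K₁ + K₂)) * z ^ 2 := by
    calc c * (s ^ 2 * z ^ 2) ≤ q * (s ^ 2 * z ^ 2) := by gcongr
      _ = s ^ 2 * q * z ^ 2 := by ring
      _ ≤ _ := by gcongr
  calc e₀ * c * (zx ^ 2 + zt ^ 2 + s ^ 2 * z ^ 2)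
      = e₀ * (c * (zx ^ 2 + zt ^ 2 + s ^ 2 * z ^ 2)) := by ring
    _ ≤ E * (c * (zx ^ 2 + zt ^ 2 + s ^ 2 * z ^ 2)) := by gcongr
    _ ≤ carlemanForm s lam τ k p p₁ r E z zx zt := by
        rw [carlemanForm]
        refine mul_le_mul_of_nonneg_left ?_ hE0.le
        linear_combination hmain + hgrad + hzero

/-- Coercivity of `carlemanForm` for large `lam`, and then large `s`, with constants that depend
only on the bounds on the coefficients. -/
lemma exists_carlemanForm_ge {τ k P₀ M R : ℝ} (hτ : 0 < τ) (hk : 0 < k) (hP₀ : 0 < P₀)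
    (hM : 0 ≤ M) (hR : 0 ≤ R) :
    ∃ lam : ℝ, 0 < lam ∧ ∃ c : ℝ, 0 < c ∧ ∃ s₀ : ℝ, 1 ≤ s₀ ∧ ∀ s p p₁ r E z zx zt : ℝ,
      s₀ ≤ s → P₀ ≤ p → p ≤ 1 → |p₁| ≤ M → |r| ≤ R → Real.exp (-lam) ≤ E → E ≤ 1 →
      c * (zx ^ 2 + zt ^ 2 + s ^ 2 * z ^ 2) ≤ carlemanForm s lam τ k p p₁ r E z zx zt := by
  set Nb := τ ^ 2 + R ^ 2
  set mb := M * R + k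
  set nb := M * R ^ 2 + 2 * R * k
  have hNb : 0 < Nb := by positivity
  set lam := (2 * mb + 4 * (k + M * R)) / τ ^ 2 + 2 * (R * nb + mb * Nb) / τ ^ 4 with hlam_def
  have hlam : 0 < lam := by positivity
  have hl1 : 2 * mb + 4 * (k + M * R) ≤ lam * τ ^ 2 := by
    rw [← div_le_iff₀ (by positivity), hlam_def]
    exact le_add_of_nonneg_right (by positivity)
  have hl2 : 2 * (R * nb + mb * Nb) ≤ lam * τ ^ 4 := by
    rw [← div_le_iff₀ (by positivity), hlam_def]
    exact le_add_of_nonneg_left (by positivity)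
  set e₀ := Real.exp (-lam)
  have he₀ : 0 < e₀ := Real.exp_pos _
  set K₁ := lam * (3 * lam * Nb + mb) ^ 2 / 8 + lam ^ 2 * Nb * mb
  set K₂ := lam ^ 3 * Nb ^ 2 / 4 + 2 * lam * nb ^ 2 / τ ^ 2
  have hK₁ : 0 ≤ K₁ := by positivity
  have hK₂ : 0 ≤ K₂ := by positivity
  set q := lam ^ 3 * e₀ ^ 2 * τ ^ 4 / 8 with hq
  have hq0 : 0 < q := by positivity
  set c := min (lam * τ ^ 2 / 8 * min P₀ 1) q
  have hc : 0 < c := by positivity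
  refine ⟨lam, hlam, e₀ * c, by positivity, 1 + (K₁ + K₂) / q,
    le_add_of_nonneg_right (by positivity), ?_⟩
  intro s p p₁ r E z zx zt hs hp hp1 hp₁ hr hE hE1
  have hs1 : 1 ≤ s := (le_add_of_nonneg_right (by positivity)).trans hs
  have hsq : K₁ + K₂ ≤ s * q := by
    rw [← div_le_iff₀ hq0]; linarith
  exact carlemanForm_ge hτ hk hP₀ hM hR hlam rfl rfl rfl rfl rfl rfl hl1 hl2 he₀ hc
    (min_le_left _ _) (min_le_right _ _) hs1 hsq hp hp1 hp₁ hr hE hE1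

/-- Bound on the vector field of the Carleman identity. -/
lemma abs_fluxX_fluxT_le {s lam τ p r E z zx zt R : ℝ} (hs : 1 ≤ s) (hlam : 0 < lam) (hτ : 0 < τ)
    (hp : 0 < p) (hp1 : p ≤ 1) (hr : |r| ≤ R) (hE : 0 < E) (hE1 : E ≤ 1) :
    |fluxX s lam τ p r E z zx zt| ≤ ((lam * (τ ^ 2 + R ^ 2) + (τ + R)) +
      (τ + R) * (1 + lam ^ 2 * (τ ^ 2 + R ^ 2))) * (zx ^ 2 + zt ^ 2 + s ^ 2 * z ^ 2) ∧
    |fluxT s lam τ p r E z zx zt| ≤ ((lam * (τ ^ 2 + R ^ 2) + (τ + R)) +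
      (τ + R) * (1 + lam ^ 2 * (τ ^ 2 + R ^ 2))) * (zx ^ 2 + zt ^ 2 + s ^ 2 * z ^ 2) := by
  set V := zx ^ 2 + zt ^ 2 + s ^ 2 * z ^ 2 with hV
  set Nb := τ ^ 2 + R ^ 2
  have hR : 0 ≤ R := (abs_nonneg r).trans hr
  have hNb : 0 < Nb := by positivity
  have hV0 : 0 ≤ V := by positivity
  have hsz : z ^ 2 ≤ s ^ 2 * z ^ 2 := le_mul_of_one_le_left (sq_nonneg z) (one_le_pow₀ hs)
  set v := √V
  have hv : v * v = V := Real.mul_self_sqrt hV0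
  have hv0 : 0 ≤ v := Real.sqrt_nonneg _
  have hzx : |zx| ≤ v := Real.abs_le_sqrt (by nlinarith [sq_nonneg zt, sq_nonneg (s * z)])
  have hzt : |zt| ≤ v := Real.abs_le_sqrt (by nlinarith [sq_nonneg zx, sq_nonneg (s * z)])
  have hz : |z| ≤ v := Real.abs_le_sqrt (by nlinarith [sq_nonneg zx, sq_nonneg zt])
  have hr2 : r ^ 2 ≤ R ^ 2 := by rw [← sq_abs r]; exact pow_le_pow_left₀ (abs_nonneg _) hr 2
  have hN0 : 0 ≤ sym τ p r := by rw [sym]; positivity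
  have hN : sym τ p r ≤ Nb := by
    have : p * r ^ 2 ≤ 1 * R ^ 2 := by gcongr
    simp only [sym, Nb]; linarith
  have hpr : p * |r| ≤ R := by
    have : p * |r| ≤ 1 * R := by gcongr
    linarith
  have hW : |lam * sym τ p r * z - conormal τ p r zx zt| ≤ (lam * Nb + (τ + R)) * v := by
    refine (abs_sub _ _).trans ?_
    have h1 : |lam * sym τ p r * z| ≤ lam * Nb * v := by
      rw [abs_mul, abs_of_nonneg (by positivity)]; gcongr
    have h2 : |conormal τ p r zx zt| ≤ τ * v + R * v := by
      refine (abs_add_le _ _).trans (add_le_add ?_ ?_)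
      · rw [abs_mul, abs_of_pos hτ]; gcongr
      · rw [abs_mul, abs_mul, abs_of_pos hp]; gcongr
    linarith
  have hd : |density s lam τ p r E z zx zt| ≤ (1 + lam ^ 2 * Nb) * V := by
    have hE2 : E ^ 2 ≤ 1 := pow_le_one₀ hE.le hE1
    have h1 : s ^ 2 * lam ^ 2 * E ^ 2 * sym τ p r * z ^ 2 ≤ s ^ 2 * lam ^ 2 * 1 * Nb * z ^ 2 := by
      gcongr
    have h0 : 0 ≤ s ^ 2 * lam ^ 2 * E ^ 2 * sym τ p r * z ^ 2 := by positivity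
    have h2 : p * zx ^ 2 ≤ 1 * zx ^ 2 := by gcongr
    have h3 : 0 ≤ p * zx ^ 2 := by positivity
    have h4 : 0 ≤ lam ^ 2 * Nb * (zx ^ 2 + zt ^ 2) := by positivity
    have h5 : 0 ≤ s ^ 2 * lam ^ 2 * 1 * Nb * z ^ 2 := by positivity
    have h6 : (1 + lam ^ 2 * Nb) * V = zx ^ 2 + zt ^ 2 + s ^ 2 * z ^ 2 +
        lam ^ 2 * Nb * (zx ^ 2 + zt ^ 2) + s ^ 2 * lam ^ 2 * 1 * Nb * z ^ 2 := by rw [hV]; ring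
    have h7 := sq_nonneg zt
    have h8 := sq_nonneg (s * z)
    rw [mul_pow] at h8
    rw [h6, density, abs_le]
    constructor <;> linarith
  have key : ∀ y κ : ℝ, |y| ≤ v → |κ| ≤ τ + R →
      |E * (y * (lam * sym τ p r * z - conormal τ p r zx zt) + κ * density s lam τ p r E z zx zt)| ≤
      ((lam * Nb + (τ + R)) + (τ + R) * (1 + lam ^ 2 * Nb)) * V := by
    intro y κ hy hκ
    rw [abs_mul, abs_of_pos hE]
    refine (mul_le_of_le_one_left (abs_nonneg _) hE1).trans ((abs_add_le _ _).trans ?_)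
    rw [add_mul]
    refine add_le_add ?_ ?_
    · rw [abs_mul]
      calc |y| * |lam * sym τ p r * z - conormal τ p r zx zt|
          ≤ v * ((lam * Nb + (τ + R)) * v) := by gcongr
        _ = (lam * Nb + (τ + R)) * V := by rw [← hv]; ring
    · rw [abs_mul, mul_assoc]; gcongr
  refine ⟨key _ _ ?_ ?_, key _ _ hzt ?_⟩
  · rw [abs_mul, abs_of_pos hp]
    exact (mul_le_of_le_one_left (abs_nonneg _) hp1).trans hzx
  · rw [abs_mul, abs_of_pos hp]; linarith
  · rw [abs_of_pos hτ]; linarith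

end Coercivity

/-! ### Functions with continuous second partial derivatives, and the conjugated equation -/

/-- `f` has the partial derivatives `fx`, `ft`, `fxx`, `fxt`, `ftt` at the points of `Ω`, and all
of these are continuous on `Ω`. -/
structure HasPartials (Ω : Set (ℝ × ℝ)) (f fx ft fxx fxt ftt : ℝ → ℝ → ℝ) : Prop where
  dx : ∀ x t, (x, t) ∈ Ω → HasDerivAt (fun x => f x t) (fx x t) x
  dt : ∀ x t, (x, t) ∈ Ω → HasDerivAt (fun t => f x t) (ft x t) t
  dxx : ∀ x t, (x, t) ∈ Ω → HasDerivAt (fun x => fx x t) (fxx x t) x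
  dxt : ∀ x t, (x, t) ∈ Ω → HasDerivAt (fun t => fx x t) (fxt x t) t
  dtx : ∀ x t, (x, t) ∈ Ω → HasDerivAt (fun x => ft x t) (fxt x t) x
  dtt : ∀ x t, (x, t) ∈ Ω → HasDerivAt (fun t => ft x t) (ftt x t) t
  cont : ContinuousOn (fun q : ℝ × ℝ => f q.1 q.2) Ω
  cont_x : ContinuousOn (fun q : ℝ × ℝ => fx q.1 q.2) Ω
  cont_t : ContinuousOn (fun q : ℝ × ℝ => ft q.1 q.2) Ω
  cont_xx : ContinuousOn (fun q : ℝ × ℝ => fxx q.1 q.2) Ω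
  cont_xt : ContinuousOn (fun q : ℝ × ℝ => fxt q.1 q.2) Ω
  cont_tt : ContinuousOn (fun q : ℝ × ℝ => ftt q.1 q.2) Ω

lemma HasPartials.exp_mul {Ω : Set (ℝ × ℝ)} {f fx ft fxx fxt ftt g gx gt gxx gxt gtt : ℝ → ℝ → ℝ}
    (hg : HasPartials Ω g gx gt gxx gxt gtt) (hf : HasPartials Ω f fx ft fxx fxt ftt) :
    HasPartials Ω (fun x t => Real.exp (g x t) * f x t)
      (fun x t => Real.exp (g x t) * (fx x t + gx x t * f x t))
      (fun x t => Real.exp (g x t) * (ft x t + gt x t * f x t))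
      (fun x t => Real.exp (g x t) *
        (fxx x t + 2 * gx x t * fx x t + (gxx x t + gx x t ^ 2) * f x t))
      (fun x t => Real.exp (g x t) *
        (fxt x t + gx x t * ft x t + gt x t * fx x t + (gxt x t + gx x t * gt x t) * f x t))
      (fun x t => Real.exp (g x t) *
        (ftt x t + 2 * gt x t * ft x t + (gtt x t + gt x t ^ 2) * f x t)) where
  dx x t h := ((hg.dx x t h).exp.mul (hf.dx x t h)).congr_deriv (by ring)
  dt x t h := ((hg.dt x t h).exp.mul (hf.dt x t h)).congr_deriv (by ring)
  dxx x t h := ((hg.dx x t h).exp.mul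
    ((hf.dxx x t h).add ((hg.dxx x t h).mul (hf.dx x t h)))).congr_deriv (by simp; ring)
  dxt x t h := ((hg.dt x t h).exp.mul
    ((hf.dxt x t h).add ((hg.dxt x t h).mul (hf.dt x t h)))).congr_deriv (by simp; ring)
  dtx x t h := ((hg.dx x t h).exp.mul
    ((hf.dtx x t h).add ((hg.dtx x t h).mul (hf.dx x t h)))).congr_deriv (by simp; ring)
  dtt x t h := ((hg.dt x t h).exp.mul
    ((hf.dtt x t h).add ((hg.dtt x t h).mul (hf.dt x t h)))).congr_deriv (by simp; ring)
  cont := hg.cont.rexp.mul hf.cont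
  cont_x := hg.cont.rexp.mul (hf.cont_x.add (hg.cont_x.mul hf.cont))
  cont_t := hg.cont.rexp.mul (hf.cont_t.add (hg.cont_t.mul hf.cont))
  cont_xx := hg.cont.rexp.mul ((hf.cont_xx.add ((continuousOn_const.mul hg.cont_x).mul
    hf.cont_x)).add ((hg.cont_xx.add (hg.cont_x.pow 2)).mul hf.cont))
  cont_xt := hg.cont.rexp.mul (((hf.cont_xt.add (hg.cont_x.mul hf.cont_t)).add
    (hg.cont_t.mul hf.cont_x)).add ((hg.cont_xt.add (hg.cont_x.mul hg.cont_t)).mul hf.cont))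
  cont_tt := hg.cont.rexp.mul ((hf.cont_tt.add ((continuousOn_const.mul hg.cont_t).mul
    hf.cont_t)).add ((hg.cont_tt.add (hg.cont_t.pow 2)).mul hf.cont))

/-- The function `ρ` whose sublevel sets exhaust the rectangle. -/
noncomputable def rho (τ k x₀ x t : ℝ) : ℝ := τ * t + k / 2 * (x - x₀) ^ 2

/-- The Carleman weight `E = e^{-λ ρ}`. -/
noncomputable def weight (lam τ k x₀ x t : ℝ) : ℝ := Real.exp (-(lam * rho τ k x₀ x t))

lemma hasDerivAt_rho_fst (τ k x₀ x t : ℝ) :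
    HasDerivAt (fun x => rho τ k x₀ x t) (k * (x - x₀)) x := by
  refine (((((hasDerivAt_id x).sub_const x₀).pow 2).const_mul (k / 2)).const_add
    (τ * t)).congr_deriv ?_
  simp; ring

lemma hasDerivAt_rho_snd (τ k x₀ x t : ℝ) : HasDerivAt (fun t => rho τ k x₀ x t) τ t := by
  refine (((hasDerivAt_id t).const_mul τ).add_const _).congr_deriv ?_
  simp

lemma hasDerivAt_weight_fst (lam τ k x₀ x t : ℝ) : HasDerivAt (fun x => weight lam τ k x₀ x t)
    (-(lam * (k * (x - x₀)) * weight lam τ k x₀ x t)) x :=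
  ((hasDerivAt_rho_fst τ k x₀ x t).const_mul lam).neg.exp.congr_deriv (by simp [weight]; ring)

lemma hasDerivAt_weight_snd (lam τ k x₀ x t : ℝ) : HasDerivAt (fun t => weight lam τ k x₀ x t)
    (-(lam * τ * weight lam τ k x₀ x t)) t :=
  ((hasDerivAt_rho_snd τ k x₀ x t).const_mul lam).neg.exp.congr_deriv (by simp [weight]; ring)

lemma continuous_rho (τ k x₀ : ℝ) : Continuous fun q : ℝ × ℝ => rho τ k x₀ q.1 q.2 := by
  unfold rho; fun_prop

lemma continuous_weight (lam τ k x₀ : ℝ) :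
    Continuous fun q : ℝ × ℝ => weight lam τ k x₀ q.1 q.2 := by
  unfold weight rho; fun_prop

lemma hasPartials_weight (Ω : Set (ℝ × ℝ)) (s lam τ k x₀ : ℝ) :
    HasPartials Ω (fun x t => s * weight lam τ k x₀ x t)
      (fun x t => -(s * lam * (k * (x - x₀)) * weight lam τ k x₀ x t))
      (fun x t => -(s * lam * τ * weight lam τ k x₀ x t))
      (fun x t => s * (lam ^ 2 * (k * (x - x₀)) ^ 2 - lam * k) * weight lam τ k x₀ x t)
      (fun x t => s * lam ^ 2 * τ * (k * (x - x₀)) * weight lam τ k x₀ x t)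
      (fun x t => s * lam ^ 2 * τ ^ 2 * weight lam τ k x₀ x t) where
  dx x t _ := ((hasDerivAt_weight_fst lam τ k x₀ x t).const_mul s).congr_deriv (by ring)
  dt x t _ := ((hasDerivAt_weight_snd lam τ k x₀ x t).const_mul s).congr_deriv (by ring)
  dxx x t _ := (((((hasDerivAt_id x).sub_const x₀).const_mul k).const_mul (s * lam)).mul
    (hasDerivAt_weight_fst lam τ k x₀ x t)).neg.congr_deriv (by simp; ring)
  dxt x t _ := ((hasDerivAt_weight_snd lam τ k x₀ x t).const_mul
    (s * lam * (k * (x - x₀)))).neg.congr_deriv (by ring)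
  dtx x t _ := ((hasDerivAt_weight_fst lam τ k x₀ x t).const_mul
    (s * lam * τ)).neg.congr_deriv (by ring)
  dtt x t _ := ((hasDerivAt_weight_snd lam τ k x₀ x t).const_mul
    (s * lam * τ)).neg.congr_deriv (by ring)
  cont := by have := continuous_weight lam τ k x₀; fun_prop
  cont_x := by have := continuous_weight lam τ k x₀; fun_prop
  cont_t := by have := continuous_weight lam τ k x₀; fun_prop
  cont_xx := by have := continuous_weight lam τ k x₀; fun_prop
  cont_xt := by have := continuous_weight lam τ k x₀; fun_prop
  cont_tt := by have := continuous_weight lam τ k x₀; fun_prop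

/-- The squared density `φ² + φ_x² + φ_t²` of the `H¹` norm is comparable with that of the
conjugated function `z = e^σ φ`, up to powers of `s`. Here `e = e^σ`. -/
lemma conjugate_density_bounds {s lam τ r R E e f fx ft : ℝ} (hs : 1 ≤ s) (hlam : 0 < lam)
    (hτ : 0 < τ) (hr : |r| ≤ R) (hE : 0 < E) (hE1 : E ≤ 1) :
    e ^ 2 * (f ^ 2 + fx ^ 2 + ft ^ 2) ≤ (2 + 2 * lam ^ 2 * (R ^ 2 + τ ^ 2)) *
      ((e * (fx + -(s * lam * r * E) * f)) ^ 2 + (e * (ft + -(s * lam * τ * E) * f)) ^ 2 +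
        s ^ 2 * (e * f) ^ 2) ∧
    (e * (fx + -(s * lam * r * E) * f)) ^ 2 + (e * (ft + -(s * lam * τ * E) * f)) ^ 2 +
        s ^ 2 * (e * f) ^ 2 ≤
      (2 + 2 * lam ^ 2 * (R ^ 2 + τ ^ 2)) * s ^ 2 * (e ^ 2 * (f ^ 2 + fx ^ 2 + ft ^ 2)) := by
  have hr2 : r ^ 2 ≤ R ^ 2 := by rw [← sq_abs r]; exact pow_le_pow_left₀ (abs_nonneg _) hr 2
  have hE2 : E ^ 2 ≤ 1 := pow_le_one₀ hE.le hE1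
  have hs2 : 1 ≤ s ^ 2 := one_le_pow₀ hs
  have hR2 : 0 ≤ R ^ 2 := sq_nonneg R
  have h1 : (s * lam * r * E) ^ 2 ≤ s ^ 2 * lam ^ 2 * R ^ 2 := by
    have : s ^ 2 * lam ^ 2 * r ^ 2 * E ^ 2 ≤ s ^ 2 * lam ^ 2 * R ^ 2 * 1 := by gcongr
    calc _ = s ^ 2 * lam ^ 2 * r ^ 2 * E ^ 2 := by ring
      _ ≤ _ := by linarith
  have h2 : (s * lam * τ * E) ^ 2 ≤ s ^ 2 * lam ^ 2 * τ ^ 2 := by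
    have : s ^ 2 * lam ^ 2 * τ ^ 2 * E ^ 2 ≤ s ^ 2 * lam ^ 2 * τ ^ 2 * 1 := by gcongr
    calc _ = s ^ 2 * lam ^ 2 * τ ^ 2 * E ^ 2 := by ring
      _ ≤ _ := by linarith
  have hf : 0 ≤ (e * f) ^ 2 := sq_nonneg _
  have h1f := mul_le_mul_of_nonneg_right h1 hf
  have h2f := mul_le_mul_of_nonneg_right h2 hf
  set A := s * lam * r * E
  set B := s * lam * τ * E
  have hK : 0 ≤ 2 * lam ^ 2 * (R ^ 2 + τ ^ 2) := by positivity
  have q1 : 0 ≤ 2 * lam ^ 2 * (R ^ 2 + τ ^ 2) *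
      ((e * (fx + -A * f)) ^ 2 + (e * (ft + -B * f)) ^ 2) := by positivity
  have q2 := mul_le_mul_of_nonneg_right hs2 hf
  constructor
  · have p1 : (e * fx) ^ 2 ≤ 2 * (e * (fx + -A * f)) ^ 2 + 2 * (A ^ 2 * (e * f) ^ 2) := by
      have := sq_nonneg (e * fx - 2 * e * A * f)
      linear_combination this
    have p2 : (e * ft) ^ 2 ≤ 2 * (e * (ft + -B * f)) ^ 2 + 2 * (B ^ 2 * (e * f) ^ 2) := by
      have := sq_nonneg (e * ft - 2 * e * B * f)
      linear_combination this
    have p3 : 0 ≤ s ^ 2 * (e * f) ^ 2 := by positivity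
    linear_combination p1 + p2 + 2 * h1f + 2 * h2f + q1 + q2 + p3
  · have p1 : (e * (fx + -A * f)) ^ 2 ≤ 2 * (e * fx) ^ 2 + 2 * (A ^ 2 * (e * f) ^ 2) := by
      have := sq_nonneg (e * fx + e * A * f)
      linear_combination this
    have p2 : (e * (ft + -B * f)) ^ 2 ≤ 2 * (e * ft) ^ 2 + 2 * (B ^ 2 * (e * f) ^ 2) := by
      have := sq_nonneg (e * ft + e * B * f)
      linear_combination this
    have p3 := mul_le_mul_of_nonneg_right hs2 (add_nonneg (sq_nonneg (e * fx)) (sq_nonneg (e * ft)))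
    have p4 : 0 ≤ 2 * lam ^ 2 * (R ^ 2 + τ ^ 2) * (s ^ 2 * ((e * fx) ^ 2 + (e * ft) ^ 2)) := by
      positivity
    have p5 : 0 ≤ s ^ 2 * (e * f) ^ 2 := by positivity
    linear_combination p1 + p2 + 2 * h1f + 2 * h2f + 2 * p3 + p4 + p5

/-! ### The cutoff -/

/-- A smooth step: `0` for `u ≤ 0` and `1` for `1 ≤ u`, with bounded derivative supported in
`[0, 1]`. -/
lemma exists_smoothStep : ∃ S S' : ℝ → ℝ, ∃ C : ℝ, 0 < C ∧ (∀ u, HasDerivAt S (S' u) u) ∧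
    Continuous S' ∧ (∀ u, 0 ≤ S u) ∧ (∀ u, S u ≤ 1) ∧ (∀ u ≤ 0, S u = 0) ∧ (∀ u, 1 ≤ u → S u = 1) ∧
    (∀ u ≤ 0, S' u = 0) ∧ (∀ u, 1 ≤ u → S' u = 0) ∧ ∀ u, |S' u| ≤ C := by
  have hd : ContDiff ℝ 1 Real.smoothTransition := Real.smoothTransition.contDiff
  have hc : Continuous (deriv Real.smoothTransition) := hd.continuous_deriv le_rfl
  have h0 : ∀ u ≤ (0 : ℝ), deriv Real.smoothTransition u = 0 := fun u hu =>
    IsLocalMin.deriv_eq_zero (Eventually.of_forall fun y => by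
      rw [Real.smoothTransition.zero_of_nonpos hu]; exact Real.smoothTransition.nonneg y)
  have h1 : ∀ u, (1 : ℝ) ≤ u → deriv Real.smoothTransition u = 0 := fun u hu =>
    IsLocalMax.deriv_eq_zero (Eventually.of_forall fun y => by
      rw [Real.smoothTransition.one_of_one_le hu]; exact Real.smoothTransition.le_one y)
  obtain ⟨C, hC⟩ := isCompact_Icc.exists_bound_of_continuousOn (s := Icc (0 : ℝ) 1) hc.continuousOn
  refine ⟨Real.smoothTransition, deriv Real.smoothTransition, max C 1, by positivity,
    fun u => (hd.differentiable one_ne_zero u).hasDerivAt, hc, Real.smoothTransition.nonneg,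
    Real.smoothTransition.le_one, fun u => Real.smoothTransition.zero_of_nonpos,
    fun u => Real.smoothTransition.one_of_one_le, h0, h1, fun u => ?_⟩
  rcases le_total u 0 with hu | hu
  · rw [h0 u hu]; simp
  · rcases le_total u 1 with hu' | hu'
    · exact (hC u ⟨hu, hu'⟩).trans (le_max_left _ _)
    · rw [h1 u hu']; simp

/-! ### The Carleman estimate -/

/-- The divergence theorem for `η (F₁, F₂)` on a rectangle, where `η` vanishes on all sides but
`t = 0`. -/
lemma integral_cutoff_mul_div {a b T : ℝ} {η ηx ηt F₁ D₁ F₂ D₂ : ℝ → ℝ → ℝ} (hab : a ≤ b)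
    (hT : 0 ≤ T)
    (hηx : ∀ x t, HasDerivAt (fun x => η x t) (ηx x t) x)
    (hηt : ∀ x t, HasDerivAt (fun t => η x t) (ηt x t) t)
    (hF₁ : ∀ x ∈ Icc a b, ∀ t ∈ Icc 0 T, HasDerivAt (fun x => F₁ x t) (D₁ x t) x)
    (hF₂ : ∀ x ∈ Icc a b, ∀ t ∈ Icc 0 T, HasDerivAt (fun t => F₂ x t) (D₂ x t) t)
    (hη : Continuous fun q : ℝ × ℝ => η q.1 q.2) (hηxc : Continuous fun q : ℝ × ℝ => ηx q.1 q.2)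
    (hηtc : Continuous fun q : ℝ × ℝ => ηt q.1 q.2)
    (hF₁c : ContinuousOn (fun q : ℝ × ℝ => F₁ q.1 q.2) (Icc a b ×ˢ Icc 0 T))
    (hF₂c : ContinuousOn (fun q : ℝ × ℝ => F₂ q.1 q.2) (Icc a b ×ˢ Icc 0 T))
    (hD₁c : ContinuousOn (fun q : ℝ × ℝ => D₁ q.1 q.2) (Icc a b ×ˢ Icc 0 T))
    (hD₂c : ContinuousOn (fun q : ℝ × ℝ => D₂ q.1 q.2) (Icc a b ×ˢ Icc 0 T))
    (ha0 : ∀ t ∈ Icc 0 T, η a t = 0) (hb0 : ∀ t ∈ Icc 0 T, η b t = 0) (hT0 : ∀ x, η x T = 0) :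
    ∫ q in Ioo a b ×ˢ Ioo 0 T, η q.1 q.2 * (D₁ q.1 q.2 + D₂ q.1 q.2) =
      -(∫ x in Ioo a b, η x 0 * F₂ x 0) -
        ∫ q in Ioo a b ×ˢ Ioo 0 T, (ηx q.1 q.2 * F₁ q.1 q.2 + ηt q.1 q.2 * F₂ q.1 q.2) := by
  have c1 : ContinuousOn (fun q : ℝ × ℝ => ηx q.1 q.2 * F₁ q.1 q.2 + η q.1 q.2 * D₁ q.1 q.2)
      (Icc a b ×ˢ Icc 0 T) :=
    (hηxc.continuousOn.mul hF₁c).add (hη.continuousOn.mul hD₁c)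
  have c2 : ContinuousOn (fun q : ℝ × ℝ => ηt q.1 q.2 * F₂ q.1 q.2 + η q.1 q.2 * D₂ q.1 q.2)
      (Icc a b ×ˢ Icc 0 T) :=
    (hηtc.continuousOn.mul hF₂c).add (hη.continuousOn.mul hD₂c)
  have c3 : ContinuousOn (fun q : ℝ × ℝ => ηx q.1 q.2 * F₁ q.1 q.2 + ηt q.1 q.2 * F₂ q.1 q.2)
      (Icc a b ×ˢ Icc 0 T) :=
    (hηxc.continuousOn.mul hF₁c).add (hηtc.continuousOn.mul hF₂c)
  have h1 := integral_partial_fst (F := fun x t => η x t * F₁ x t)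
    (D := fun x t => ηx x t * F₁ x t + η x t * D₁ x t) hab
    (fun x hx t ht => (hηx x t).mul (hF₁ x hx t ht)) c1
  have h2 := integral_partial_snd (F := fun x t => η x t * F₂ x t)
    (D := fun x t => ηt x t * F₂ x t + η x t * D₂ x t) hT
    (fun x hx t ht => (hηt x t).mul (hF₂ x hx t ht)) c2
  have h1' : ∫ t in Ioo 0 T, (η b t * F₁ b t - η a t * F₁ a t) = 0 := by
    rw [setIntegral_congr_fun (g := fun _ => (0 : ℝ)) measurableSet_Ioo]
    · simp
    · intro t ht
      simp [ha0 t (Ioo_subset_Icc_self ht), hb0 t (Ioo_subset_Icc_self ht)]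
  rw [h1'] at h1
  simp only [hT0, zero_mul, zero_sub] at h2
  rw [integral_neg] at h2
  have h3 : ∫ q in Ioo a b ×ˢ Ioo 0 T, η q.1 q.2 * (D₁ q.1 q.2 + D₂ q.1 q.2) =
      ∫ q in Ioo a b ×ˢ Ioo 0 T, ((ηx q.1 q.2 * F₁ q.1 q.2 + η q.1 q.2 * D₁ q.1 q.2) +
        ((ηt q.1 q.2 * F₂ q.1 q.2 + η q.1 q.2 * D₂ q.1 q.2) -
          (ηx q.1 q.2 * F₁ q.1 q.2 + ηt q.1 q.2 * F₂ q.1 q.2))) :=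
    integral_congr_ae (ae_of_all _ fun q => by ring)
  have c4 : ContinuousOn (fun q : ℝ × ℝ => (ηt q.1 q.2 * F₂ q.1 q.2 + η q.1 q.2 * D₂ q.1 q.2) -
      (ηx q.1 q.2 * F₁ q.1 q.2 + ηt q.1 q.2 * F₂ q.1 q.2)) (Icc a b ×ˢ Icc 0 T) := c2.sub c3
  rw [h3, integral_add (integrableOn_rectangle c1) (integrableOn_rectangle c4),
    integral_sub (integrableOn_rectangle c2) (integrableOn_rectangle c3), h1, h2]
  ring

lemma continuousOn_fluxX {s lam τ : ℝ} {Ω : Set (ℝ × ℝ)} {p r E z zx zt : ℝ × ℝ → ℝ}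
    (hp : ContinuousOn p Ω) (hr : ContinuousOn r Ω) (hE : ContinuousOn E Ω)
    (hz : ContinuousOn z Ω) (hzx : ContinuousOn zx Ω) (hzt : ContinuousOn zt Ω) :
    ContinuousOn (fun q => fluxX s lam τ (p q) (r q) (E q) (z q) (zx q) (zt q)) Ω := by
  unfold fluxX density conormal sym
  fun_prop

lemma continuousOn_fluxT {s lam τ : ℝ} {Ω : Set (ℝ × ℝ)} {p r E z zx zt : ℝ × ℝ → ℝ}
    (hp : ContinuousOn p Ω) (hr : ContinuousOn r Ω) (hE : ContinuousOn E Ω)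
    (hz : ContinuousOn z Ω) (hzx : ContinuousOn zx Ω) (hzt : ContinuousOn zt Ω) :
    ContinuousOn (fun q => fluxT s lam τ (p q) (r q) (E q) (z q) (zx q) (zt q)) Ω := by
  unfold fluxT density conormal sym
  fun_prop

lemma continuousOn_carlemanForm {s lam τ k : ℝ} {Ω : Set (ℝ × ℝ)}
    {p p₁ r E z zx zt : ℝ × ℝ → ℝ} (hp : ContinuousOn p Ω) (hp₁ : ContinuousOn p₁ Ω)
    (hr : ContinuousOn r Ω) (hE : ContinuousOn E Ω)
    (hz : ContinuousOn z Ω) (hzx : ContinuousOn zx Ω) (hzt : ContinuousOn zt Ω) :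
    ContinuousOn (fun q => carlemanForm s lam τ k (p q) (p₁ q) (r q) (E q) (z q) (zx q) (zt q))
      Ω := by
  unfold carlemanForm conormal sym
  fun_prop

lemma continuousOn_dFluxX {s lam τ k : ℝ} {Ω : Set (ℝ × ℝ)}
    {p p₁ r E z zx zt zxx zxt : ℝ × ℝ → ℝ} (hp : ContinuousOn p Ω) (hp₁ : ContinuousOn p₁ Ω)
    (hr : ContinuousOn r Ω) (hE : ContinuousOn E Ω) (hz : ContinuousOn z Ω)
    (hzx : ContinuousOn zx Ω) (hzt : ContinuousOn zt Ω) (hzxx : ContinuousOn zxx Ω)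
    (hzxt : ContinuousOn zxt Ω) :
    ContinuousOn (fun q => dFluxX s lam τ k (p q) (p₁ q) (r q) (E q) (z q) (zx q) (zt q) (zxx q)
      (zxt q)) Ω := by
  unfold dFluxX density conormal sym
  fun_prop

lemma continuousOn_dFluxT {s lam τ : ℝ} {Ω : Set (ℝ × ℝ)}
    {p r E z zx zt zxt ztt : ℝ × ℝ → ℝ} (hp : ContinuousOn p Ω)
    (hr : ContinuousOn r Ω) (hE : ContinuousOn E Ω) (hz : ContinuousOn z Ω)
    (hzx : ContinuousOn zx Ω) (hzt : ContinuousOn zt Ω) (hzxt : ContinuousOn zxt Ω)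
    (hztt : ContinuousOn ztt Ω) :
    ContinuousOn (fun q => dFluxT s lam τ (p q) (r q) (E q) (z q) (zx q) (zt q) (zxt q)
      (ztt q)) Ω := by
  unfold dFluxT density conormal sym
  fun_prop

/-- The integrated Carleman identity: for a solution `f` of `f_tt + (p f_x)_x = 0` and a cutoff
`η` that vanishes on all sides of the rectangle but `t = 0`, the integral of `η · carlemanForm` at
`z = e^{sE} f` is the sum of a boundary term and of a term with `∇η`. -/
lemma integral_cutoff_mul_carlemanForm {a b T s lam τ k x₀ : ℝ} (hab : a ≤ b) (hT : 0 ≤ T)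
    {p p₁ : ℝ → ℝ} (hp : ∀ x ∈ Icc a b, HasDerivAt p (p₁ x) x) (hp₁ : ContinuousOn p₁ (Icc a b))
    {f fx ft fxx fxt ftt z zx zt : ℝ → ℝ → ℝ}
    (hf : HasPartials (Icc a b ×ˢ Icc 0 T) f fx ft fxx fxt ftt)
    (heq : ∀ x ∈ Icc a b, ∀ t ∈ Icc 0 T, p x * fxx x t + p₁ x * fx x t + ftt x t = 0)
    (hz : z = fun x t => Real.exp (s * weight lam τ k x₀ x t) * f x t)
    (hzx : zx = fun x t => Real.exp (s * weight lam τ k x₀ x t) *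
      (fx x t + -(s * lam * (k * (x - x₀)) * weight lam τ k x₀ x t) * f x t))
    (hzt : zt = fun x t => Real.exp (s * weight lam τ k x₀ x t) *
      (ft x t + -(s * lam * τ * weight lam τ k x₀ x t) * f x t))
    {η ηx ηt : ℝ → ℝ → ℝ}
    (hηx : ∀ x t, HasDerivAt (fun x => η x t) (ηx x t) x)
    (hηt : ∀ x t, HasDerivAt (fun t => η x t) (ηt x t) t)
    (hη : Continuous fun q : ℝ × ℝ => η q.1 q.2) (hηxc : Continuous fun q : ℝ × ℝ => ηx q.1 q.2)
    (hηtc : Continuous fun q : ℝ × ℝ => ηt q.1 q.2)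
    (ha0 : ∀ t ∈ Icc 0 T, η a t = 0) (hb0 : ∀ t ∈ Icc 0 T, η b t = 0) (hT0 : ∀ x, η x T = 0) :
    ∫ q in Ioo a b ×ˢ Ioo 0 T, η q.1 q.2 * carlemanForm s lam τ k (p q.1) (p₁ q.1)
        (k * (q.1 - x₀)) (weight lam τ k x₀ q.1 q.2) (z q.1 q.2) (zx q.1 q.2) (zt q.1 q.2) =
      -(∫ x in Ioo a b, η x 0 * fluxT s lam τ (p x) (k * (x - x₀)) (weight lam τ k x₀ x 0)
        (z x 0) (zx x 0) (zt x 0)) -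
      ∫ q in Ioo a b ×ˢ Ioo 0 T,
        (ηx q.1 q.2 * fluxX s lam τ (p q.1) (k * (q.1 - x₀)) (weight lam τ k x₀ q.1 q.2)
          (z q.1 q.2) (zx q.1 q.2) (zt q.1 q.2) +
        ηt q.1 q.2 * fluxT s lam τ (p q.1) (k * (q.1 - x₀)) (weight lam τ k x₀ q.1 q.2)
          (z q.1 q.2) (zx q.1 q.2) (zt q.1 q.2)) := by
  obtain ⟨zxx, zxt, ztt, hZ, hZeq⟩ : ∃ zxx zxt ztt : ℝ → ℝ → ℝ,
      HasPartials (Icc a b ×ˢ Icc 0 T) z zx zt zxx zxt ztt ∧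
      ∀ x ∈ Icc a b, ∀ t ∈ Icc 0 T, p x * zxx x t + p₁ x * zx x t + ztt x t =
        -(2 * s * lam * weight lam τ k x₀ x t) *
            conormal τ (p x) (k * (x - x₀)) (zx x t) (zt x t) -
          (s ^ 2 * lam ^ 2 * weight lam τ k x₀ x t ^ 2 * sym τ (p x) (k * (x - x₀)) -
            s * lam * weight lam τ k x₀ x t * (lam * sym τ (p x) (k * (x - x₀)) -
              (p₁ x * (k * (x - x₀)) + p x * k))) * z x t := by
    subst hz hzx hzt
    refine ⟨_, _, _, (hasPartials_weight _ s lam τ k x₀).exp_mul hf, fun x hx t ht => ?_⟩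
    simp only [conormal, sym]
    linear_combination Real.exp (s * weight lam τ k x₀ x t) * heq x hx t ht
  have hr : ∀ x, HasDerivAt (fun x => k * (x - x₀)) k x := fun x => by
    simpa using ((hasDerivAt_id x).sub_const x₀).const_mul k
  have hpc : ContinuousOn (fun q : ℝ × ℝ => p q.1) (Icc a b ×ˢ Icc 0 T) :=
    ContinuousOn.comp (t := Icc a b) (fun x hx => (hp x hx).continuousAt.continuousWithinAt)
      continuousOn_fst fun q hq => hq.1
  have hp₁c : ContinuousOn (fun q : ℝ × ℝ => p₁ q.1) (Icc a b ×ˢ Icc 0 T) :=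
    hp₁.comp continuousOn_fst fun q hq => hq.1
  have hrc : ContinuousOn (fun q : ℝ × ℝ => k * (q.1 - x₀)) (Icc a b ×ˢ Icc 0 T) := by fun_prop
  have hEc := (continuous_weight lam τ k x₀).continuousOn (s := Icc a b ×ˢ Icc 0 T)
  rw [← integral_cutoff_mul_div (F₁ := fun x t => fluxX s lam τ (p x) (k * (x - x₀))
      (weight lam τ k x₀ x t) (z x t) (zx x t) (zt x t))
    (F₂ := fun x t => fluxT s lam τ (p x) (k * (x - x₀))
      (weight lam τ k x₀ x t) (z x t) (zx x t) (zt x t))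
    (D₁ := fun x t => dFluxX s lam τ k (p x) (p₁ x) (k * (x - x₀))
      (weight lam τ k x₀ x t) (z x t) (zx x t) (zt x t) (zxx x t) (zxt x t))
    (D₂ := fun x t => dFluxT s lam τ (p x) (k * (x - x₀))
      (weight lam τ k x₀ x t) (z x t) (zx x t) (zt x t) (zxt x t) (ztt x t))
    hab hT hηx hηt
    (fun x hx t ht => hasDerivAt_fluxX (zx := fun x => zx x t) (hp x hx) (hr x)
      (hasDerivAt_weight_fst lam τ k x₀ x t)
      (hZ.dx x t ⟨hx, ht⟩) (hZ.dxx x t ⟨hx, ht⟩) (hZ.dtx x t ⟨hx, ht⟩))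
    (fun x hx t ht => hasDerivAt_fluxT (zt := fun t => zt x t)
      (hasDerivAt_weight_snd lam τ k x₀ x t) (hZ.dt x t ⟨hx, ht⟩) (hZ.dxt x t ⟨hx, ht⟩) (hZ.dtt x t ⟨hx, ht⟩))
    hη hηxc hηtc (continuousOn_fluxX hpc hrc hEc hZ.cont hZ.cont_x hZ.cont_t)
    (continuousOn_fluxT hpc hrc hEc hZ.cont hZ.cont_x hZ.cont_t)
    (continuousOn_dFluxX hpc hp₁c hrc hEc hZ.cont hZ.cont_x hZ.cont_t hZ.cont_xx hZ.cont_xt)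
    (continuousOn_dFluxT hpc hrc hEc hZ.cont hZ.cont_x hZ.cont_t hZ.cont_xt hZ.cont_tt)
    ha0 hb0 hT0]
  refine setIntegral_congr_fun (measurableSet_Ioo.prod measurableSet_Ioo) fun q hq => ?_
  have := dFluxX_add_dFluxT (zxt := zxt q.1 q.2)
    (hZeq q.1 (Ioo_subset_Icc_self hq.1) q.2 (Ioo_subset_Icc_self hq.2))
  simp only [this]

/-- The Carleman estimate. The weight is at least `e^{-13λ/36}` on the inner rectangle, where
`ρ ≤ 1/4 + 1/9`, and at most `e^{-λ/2}` where the gradient of the cutoff does not vanish; the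
constants depend on the coefficient `p` only through its bounds. -/
theorem carleman_estimate {a b T P₀ M : ℝ} (hab : a < b) (hT : 0 < T) (hP₀ : 0 < P₀)
    (hM : 0 ≤ M) :
    ∃ lam : ℝ, 0 < lam ∧ ∃ C : ℝ, 0 < C ∧ ∃ s₀ : ℝ, 1 ≤ s₀ ∧ ∀ p p₁ : ℝ → ℝ,
      (∀ x ∈ Icc a b, HasDerivAt p (p₁ x) x) → ContinuousOn p₁ (Icc a b) →
      (∀ x ∈ Icc a b, P₀ ≤ p x ∧ p x ≤ 1 ∧ |p₁ x| ≤ M) →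
      ∀ f fx ft fxx fxt ftt : ℝ → ℝ → ℝ,
      HasPartials (Icc a b ×ˢ Icc 0 T) f fx ft fxx fxt ftt →
      (∀ x ∈ Icc a b, ∀ t ∈ Icc 0 T, p x * fxx x t + p₁ x * fx x t + ftt x t = 0) →
      ∀ s : ℝ, s₀ ≤ s →
      Real.exp (2 * s * Real.exp (-(lam * (13 / 36)))) *
        (∫ q in Ioo ((2 * a + b) / 3) ((a + 2 * b) / 3) ×ˢ Ioo 0 (T / 4),
          (f q.1 q.2 ^ 2 + fx q.1 q.2 ^ 2 + ft q.1 q.2 ^ 2)) ≤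
      C * s ^ 2 * (Real.exp (2 * s * Real.exp (-(lam * (1 / 2)))) *
        (∫ q in Ioo a b ×ˢ Ioo 0 T, (f q.1 q.2 ^ 2 + fx q.1 q.2 ^ 2 + ft q.1 q.2 ^ 2)) +
        Real.exp (2 * s) * ∫ x in Ioo a b, (f x 0 ^ 2 + fx x 0 ^ 2 + ft x 0 ^ 2)) := by
  have hℓ : 0 < b - a := sub_pos.2 hab
  obtain ⟨τ, hτ_def⟩ : ∃ τ, τ = 1 / T := ⟨_, rfl⟩
  obtain ⟨k, hk_def⟩ : ∃ k, k = 8 / (b - a) ^ 2 := ⟨_, rfl⟩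
  obtain ⟨x₀, hx₀⟩ : ∃ x₀, x₀ = (a + b) / 2 := ⟨_, rfl⟩
  obtain ⟨R, hR_def⟩ : ∃ R, R = k * (b - a) := ⟨_, rfl⟩
  have hτ : 0 < τ := by rw [hτ_def]; positivity
  have hk : 0 < k := by rw [hk_def]; positivity
  have hR : 0 < R := by rw [hR_def]; positivity
  have hτT : τ * T = 1 := by rw [hτ_def]; field_simp
  have hkℓ : k * (b - a) ^ 2 = 8 := by rw [hk_def]; field_simp
  obtain ⟨lam, hlam, c, hc, s₀, hs₀, hcoer⟩ := exists_carlemanForm_ge hτ hk hP₀ hM hR.le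
  obtain ⟨S, S', CS, hCS, hS, hS'c, hSnn, hSle, hS0, hS1, hS'0, hS'1, hS'b⟩ := exists_smoothStep
  obtain ⟨K, hK_def⟩ : ∃ K, K = (lam * (τ ^ 2 + R ^ 2) + (τ + R)) +
      (τ + R) * (1 + lam ^ 2 * (τ ^ 2 + R ^ 2)) := ⟨_, rfl⟩
  obtain ⟨Kl, hKl_def⟩ : ∃ Kl, Kl = 2 + 2 * lam ^ 2 * (R ^ 2 + τ ^ 2) := ⟨_, rfl⟩
  have hK : 0 < K := by rw [hK_def]; positivity
  have hKl : 0 < Kl := by rw [hKl_def]; positivity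
  obtain ⟨K', hK'_def⟩ : ∃ K', K' = (1 + CS * 2 * (R + τ)) * (K * Kl) := ⟨_, rfl⟩
  have hK' : 0 < K' := by rw [hK'_def]; positivity
  refine ⟨lam, hlam, Kl / c * K', by positivity, s₀, hs₀, ?_⟩
  intro p p₁ hp hp₁ hpb f fx ft fxx fxt ftt hf heq s hs
  have hs1 : 1 ≤ s := hs₀.trans hs
  have hs0 : 0 < s := by linarith
  have hr : ∀ x ∈ Icc a b, |k * (x - x₀)| ≤ R := by
    intro x hx
    rw [abs_mul, abs_of_pos hk, hR_def]
    refine mul_le_mul_of_nonneg_left ?_ hk.le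
    rw [abs_le]; constructor <;> linarith [hx.1, hx.2]
  have hρ0 : ∀ x t, 0 ≤ t → 0 ≤ rho τ k x₀ x t := fun x t ht => by rw [rho]; positivity
  have hE1 : ∀ x t, 0 ≤ t → weight lam τ k x₀ x t ≤ 1 := fun x t ht =>
    Real.exp_le_one_iff.2 (neg_nonpos.2 (mul_nonneg hlam.le (hρ0 x t ht)))
  have hE0 : ∀ x t, 0 < weight lam τ k x₀ x t := fun x t => Real.exp_pos _
  -- the cutoff: `η = 1` where `ρ ≤ 1/2` and `η = 0` where `1 ≤ ρ`
  set η : ℝ → ℝ → ℝ := fun x t => S (2 - 2 * rho τ k x₀ x t) with hη_def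
  set ηx : ℝ → ℝ → ℝ := fun x t => S' (2 - 2 * rho τ k x₀ x t) * (-(2 * (k * (x - x₀))))
    with hηx_def
  set ηt : ℝ → ℝ → ℝ := fun x t => S' (2 - 2 * rho τ k x₀ x t) * (-(2 * τ)) with hηt_def
  have hηx : ∀ x t, HasDerivAt (fun x => η x t) (ηx x t) x := fun x t =>
    (hS _).comp x (((hasDerivAt_rho_fst τ k x₀ x t).const_mul 2).const_sub 2)
  have hηt : ∀ x t, HasDerivAt (fun t => η x t) (ηt x t) t := fun x t =>
    (hS _).comp t (((hasDerivAt_rho_snd τ k x₀ x t).const_mul 2).const_sub 2)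
  have hρc := continuous_rho τ k x₀
  have hSc : Continuous S := continuous_iff_continuousAt.2 fun u => (hS u).continuousAt
  have hηc : Continuous fun q : ℝ × ℝ => η q.1 q.2 :=
    hSc.comp (continuous_const.sub (continuous_const.mul hρc))
  have hS'ρc : Continuous fun q : ℝ × ℝ => S' (2 - 2 * rho τ k x₀ q.1 q.2) :=
    hS'c.comp (continuous_const.sub (continuous_const.mul hρc))
  have hηxc : Continuous fun q : ℝ × ℝ => ηx q.1 q.2 := hS'ρc.mul (by fun_prop)
  have hηtc : Continuous fun q : ℝ × ℝ => ηt q.1 q.2 := hS'ρc.mul continuous_const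
  have hη0 : ∀ x t, 1 ≤ rho τ k x₀ x t → η x t = 0 := fun x t h => hS0 _ (by linarith)
  have hρside : ∀ t ∈ Icc 0 T, 1 ≤ rho τ k x₀ a t ∧ 1 ≤ rho τ k x₀ b t := by
    intro t ht
    have h1 : 0 ≤ τ * t := mul_nonneg hτ.le ht.1
    constructor
    · rw [rho, hx₀]; linear_combination h1 - hkℓ / 8
    · rw [rho, hx₀]; linear_combination h1 - hkℓ / 8
  have hρT : ∀ x, 1 ≤ rho τ k x₀ x T := fun x => by
    have : 0 ≤ k / 2 * (x - x₀) ^ 2 := by positivity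
    rw [rho]; linarith
  -- the conjugated function
  obtain ⟨w, hw⟩ : ∃ w : ℝ → ℝ → ℝ, w = fun x t => Real.exp (s * weight lam τ k x₀ x t) :=
    ⟨_, rfl⟩
  obtain ⟨z, hz⟩ : ∃ z : ℝ → ℝ → ℝ, z = fun x t => Real.exp (s * weight lam τ k x₀ x t) * f x t :=
    ⟨_, rfl⟩
  obtain ⟨zx, hzx⟩ : ∃ zx : ℝ → ℝ → ℝ, zx = fun x t => Real.exp (s * weight lam τ k x₀ x t) *
      (fx x t + -(s * lam * (k * (x - x₀)) * weight lam τ k x₀ x t) * f x t) := ⟨_, rfl⟩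
  obtain ⟨zt, hzt⟩ : ∃ zt : ℝ → ℝ → ℝ, zt = fun x t => Real.exp (s * weight lam τ k x₀ x t) *
      (ft x t + -(s * lam * τ * weight lam τ k x₀ x t) * f x t) := ⟨_, rfl⟩
  obtain ⟨G, hG⟩ : ∃ G : ℝ → ℝ → ℝ, G = fun x t => f x t ^ 2 + fx x t ^ 2 + ft x t ^ 2 := ⟨_, rfl⟩
  obtain ⟨V, hV⟩ : ∃ V : ℝ → ℝ → ℝ, V = fun x t => zx x t ^ 2 + zt x t ^ 2 + s ^ 2 * z x t ^ 2 :=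
    ⟨_, rfl⟩
  have hGnn : ∀ x t, 0 ≤ G x t := fun x t => by rw [hG]; positivity
  have hVnn : ∀ x t, 0 ≤ V x t := fun x t => by rw [hV]; positivity
  have hVG : ∀ x ∈ Icc a b, ∀ t, 0 ≤ t → w x t ^ 2 * G x t ≤ Kl * V x t ∧
      V x t ≤ Kl * s ^ 2 * (w x t ^ 2 * G x t) := by
    intro x hx t ht
    simp only [hG, hV, hw, hz, hzx, hzt, hKl_def]
    exact conjugate_density_bounds hs1 hlam hτ (hr x hx) (hE0 x t) (hE1 x t ht)
  have hw2 : ∀ x t, w x t ^ 2 = Real.exp (2 * s * weight lam τ k x₀ x t) := fun x t => by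
    rw [hw, sq, ← Real.exp_add]; congr 1; ring
  have hw2_le : ∀ x t y, weight lam τ k x₀ x t ≤ y → w x t ^ 2 ≤ Real.exp (2 * s * y) :=
    fun x t y h => by rw [hw2]; gcongr
  have hw2_ge : ∀ x t y, y ≤ weight lam τ k x₀ x t → Real.exp (2 * s * y) ≤ w x t ^ 2 :=
    fun x t y h => by rw [hw2]; gcongr
  obtain ⟨Q, hQ⟩ : ∃ Q : ℝ → ℝ → ℝ, Q = fun x t => carlemanForm s lam τ k (p x) (p₁ x)
    (k * (x - x₀)) (weight lam τ k x₀ x t) (z x t) (zx x t) (zt x t) := ⟨_, rfl⟩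
  obtain ⟨F₁, hF₁⟩ : ∃ F₁ : ℝ → ℝ → ℝ, F₁ = fun x t => fluxX s lam τ (p x)
    (k * (x - x₀)) (weight lam τ k x₀ x t) (z x t) (zx x t) (zt x t) := ⟨_, rfl⟩
  obtain ⟨F₂, hF₂⟩ : ∃ F₂ : ℝ → ℝ → ℝ, F₂ = fun x t => fluxT s lam τ (p x)
    (k * (x - x₀)) (weight lam τ k x₀ x t) (z x t) (zx x t) (zt x t) := ⟨_, rfl⟩
  have hid : ∫ q in Ioo a b ×ˢ Ioo 0 T, η q.1 q.2 * Q q.1 q.2 =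
      -(∫ x in Ioo a b, η x 0 * F₂ x 0) -
      ∫ q in Ioo a b ×ˢ Ioo 0 T, (ηx q.1 q.2 * F₁ q.1 q.2 + ηt q.1 q.2 * F₂ q.1 q.2) := by
    rw [hQ, hF₁, hF₂]
    exact integral_cutoff_mul_carlemanForm hab.le hT.le hp hp₁ hf heq hz hzx hzt hηx hηt hηc hηxc
      hηtc (fun t ht => hη0 a t (hρside t ht).1) (fun t ht => hη0 b t (hρside t ht).2)
      (fun x => hη0 x T (hρT x))
  have hQV : ∀ x ∈ Icc a b, ∀ t ∈ Icc 0 T, rho τ k x₀ x t ≤ 1 → c * V x t ≤ Q x t := by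
    intro x hx t ht hρ
    rw [hV, hQ]
    refine hcoer _ _ _ _ _ _ _ _ hs (hpb x hx).1 (hpb x hx).2.1 (hpb x hx).2.2 (hr x hx) ?_
      (hE1 x t ht.1)
    refine Real.exp_le_exp.2 (neg_le_neg ?_)
    exact mul_le_of_le_one_right hlam.le hρ
  have hF₁V : ∀ x ∈ Icc a b, ∀ t ∈ Icc 0 T, |F₁ x t| ≤ K * V x t ∧ |F₂ x t| ≤ K * V x t := by
    intro x hx t ht
    rw [hF₁, hF₂, hV, hK_def]
    exact abs_fluxX_fluxT_le hs1 hlam hτ (hP₀.trans_le (hpb x hx).1) (hpb x hx).2.1 (hr x hx)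
      (hE0 x t) (hE1 x t ht.1)
  -- the three integrands
  have hGc : ContinuousOn (fun q : ℝ × ℝ => G q.1 q.2) (Icc a b ×ˢ Icc 0 T) := by
    rw [hG]; exact ((hf.cont.pow 2).add (hf.cont_x.pow 2)).add (hf.cont_t.pow 2)
  have hGi : IntegrableOn (fun q : ℝ × ℝ => G q.1 q.2) (Ioo a b ×ˢ Ioo 0 T) :=
    integrableOn_rectangle hGc
  have hG0i : IntegrableOn (fun x => G x 0) (Ioo a b) := by
    have : ContinuousOn (fun x => G x 0) (Icc a b) :=
      hGc.comp (f := fun x => (x, (0 : ℝ))) (by fun_prop) fun x hx => ⟨hx, le_rfl, hT.le⟩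
    exact (this.integrableOn_compact isCompact_Icc).mono_set Ioo_subset_Icc_self
  have hQi : IntegrableOn (fun q : ℝ × ℝ => η q.1 q.2 * Q q.1 q.2) (Ioo a b ×ˢ Ioo 0 T) := by
    have hZ := (hasPartials_weight (Icc a b ×ˢ Icc 0 T) s lam τ k x₀).exp_mul hf
    refine integrableOn_rectangle (hηc.continuousOn.mul ?_)
    rw [hQ, hz, hzx, hzt]
    exact continuousOn_carlemanForm
      (ContinuousOn.comp (t := Icc a b) (fun x hx => (hp x hx).continuousAt.continuousWithinAt)
        continuousOn_fst fun q hq => hq.1)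
      (hp₁.comp continuousOn_fst fun q hq => hq.1) (by fun_prop)
      (continuous_weight lam τ k x₀).continuousOn hZ.cont hZ.cont_x hZ.cont_t
  have hsub : Ioo ((2 * a + b) / 3) ((a + 2 * b) / 3) ×ˢ Ioo 0 (T / 4) ⊆ Ioo a b ×ˢ Ioo 0 T :=
    prod_mono (Ioo_subset_Ioo (by linarith) (by linarith)) (Ioo_subset_Ioo le_rfl (by linarith))
  have hleft : c / Kl * (Real.exp (2 * s * Real.exp (-(lam * (13 / 36)))) *
      ∫ q in Ioo ((2 * a + b) / 3) ((a + 2 * b) / 3) ×ˢ Ioo 0 (T / 4), G q.1 q.2) ≤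
      ∫ q in Ioo a b ×ˢ Ioo 0 T, η q.1 q.2 * Q q.1 q.2 := by
    rw [← integral_const_mul, ← integral_const_mul]
    refine (setIntegral_mono_on (((hGi.mono_set hsub).const_mul _).const_mul _)
      (hQi.mono_set hsub) (measurableSet_Ioo.prod measurableSet_Ioo) ?_).trans
      (setIntegral_mono_set hQi ?_ hsub.eventuallyLE)
    · rintro ⟨x, t⟩ hq
      have hx := Ioo_subset_Icc_self (hsub hq).1
      have ht := Ioo_subset_Icc_self (hsub hq).2
      have hρ : rho τ k x₀ x t ≤ 13 / 36 := by
        have h1 : τ * t ≤ τ * (T / 4) := mul_le_mul_of_nonneg_left hq.2.2.le hτ.le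
        have h2 : (x - x₀) ^ 2 ≤ ((b - a) / 6) ^ 2 :=
          sq_le_sq' (by rw [hx₀]; linarith [hq.1.1]) (by rw [hx₀]; linarith [hq.1.2])
        have h3 := mul_le_mul_of_nonneg_left h2 (half_pos hk).le
        rw [rho]
        linear_combination h1 + h3 + hτT / 4 + hkℓ / 72
      have hη1 : η x t = 1 := hS1 _ (by linarith)
      have hw' := hw2_ge x t (Real.exp (-(lam * (13 / 36))))
        (Real.exp_le_exp.2 (neg_le_neg (mul_le_mul_of_nonneg_left hρ hlam.le)))
      simp only [hη1, one_mul]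
      calc c / Kl * (Real.exp (2 * s * Real.exp (-(lam * (13 / 36)))) * G x t)
          ≤ c / Kl * (w x t ^ 2 * G x t) := by
            have := hGnn x t
            gcongr
        _ ≤ c / Kl * (Kl * V x t) := by
            have := (hVG x hx t ht.1).1
            gcongr
        _ = c * V x t := by field_simp
        _ ≤ Q x t := hQV x hx t ht (by linarith)
    · filter_upwards [ae_restrict_mem (measurableSet_Ioo.prod measurableSet_Ioo)] with q hq
      rcases le_total (rho τ k x₀ q.1 q.2) 1 with h | h
      · exact mul_nonneg (hSnn _) ((mul_nonneg hc.le (hVnn _ _)).trans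
          (hQV _ (Ioo_subset_Icc_self hq.1) _ (Ioo_subset_Icc_self hq.2) h))
      · simp [hη0 _ _ h]
  have hbdry : |∫ x in Ioo a b, η x 0 * F₂ x 0| ≤
      K * (Kl * s ^ 2) * (Real.exp (2 * s) * ∫ x in Ioo a b, G x 0) := by
    rw [← integral_const_mul, ← integral_const_mul, ← Real.norm_eq_abs]
    refine norm_integral_le_of_norm_le ((hG0i.const_mul _).const_mul _) ?_
    filter_upwards [ae_restrict_mem measurableSet_Ioo] with x hx
    have hx' := Ioo_subset_Icc_self hx
    have hw' := hw2_le x 0 1 (hE1 x 0 le_rfl)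
    rw [mul_one] at hw'
    rw [norm_mul, Real.norm_of_nonneg (hSnn _), Real.norm_eq_abs]
    calc S (2 - 2 * rho τ k x₀ x 0) * |F₂ x 0| ≤ |F₂ x 0| :=
          mul_le_of_le_one_left (abs_nonneg _) (hSle _)
      _ ≤ K * V x 0 := (hF₁V x hx' 0 ⟨le_rfl, hT.le⟩).2
      _ ≤ K * (Kl * s ^ 2 * (w x 0 ^ 2 * G x 0)) := by
          have := (hVG x hx' 0 le_rfl).2
          gcongr
      _ ≤ K * (Kl * s ^ 2 * (Real.exp (2 * s) * G x 0)) := by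
          have := hGnn x 0
          gcongr
      _ = _ := by ring
  have hgrad : |∫ q in Ioo a b ×ˢ Ioo 0 T, (ηx q.1 q.2 * F₁ q.1 q.2 + ηt q.1 q.2 * F₂ q.1 q.2)| ≤
      CS * 2 * (R + τ) * K * (Kl * s ^ 2) * (Real.exp (2 * s * Real.exp (-(lam * (1 / 2)))) *
        ∫ q in Ioo a b ×ˢ Ioo 0 T, G q.1 q.2) := by
    rw [← integral_const_mul, ← integral_const_mul, ← Real.norm_eq_abs]
    refine norm_integral_le_of_norm_le ((hGi.const_mul _).const_mul _) ?_
    filter_upwards [ae_restrict_mem (measurableSet_Ioo.prod measurableSet_Ioo)]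
    rintro ⟨x, t⟩ hq
    have hx := Ioo_subset_Icc_self hq.1
    have ht := Ioo_subset_Icc_self hq.2
    have hG' := hGnn x t
    have hnn : 0 ≤ CS * 2 * (R + τ) * K * (Kl * s ^ 2) *
        (Real.exp (2 * s * Real.exp (-(lam * (1 / 2)))) * G x t) := by positivity
    rcases le_total (rho τ k x₀ x t) (1 / 2) with h | h
    · have h0 : S' (2 - 2 * rho τ k x₀ x t) = 0 := hS'1 _ (by linarith)
      simpa [ηx, ηt, h0] using hnn
    · have hw' := hw2_le x t (Real.exp (-(lam * (1 / 2))))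
        (Real.exp_le_exp.2 (neg_le_neg (mul_le_mul_of_nonneg_left h hlam.le)))
      have hVb : V x t ≤ Kl * s ^ 2 * (Real.exp (2 * s * Real.exp (-(lam * (1 / 2)))) * G x t) :=
        (hVG x hx t ht.1).2.trans (by gcongr)
      obtain ⟨hb1, hb2⟩ := hF₁V x hx t ht
      have hηxb : |ηx x t| ≤ CS * (2 * R) := by
        rw [hηx_def, abs_mul, abs_neg, abs_mul, abs_of_pos (zero_lt_two' ℝ)]
        have h1 := hS'b (2 - 2 * rho τ k x₀ x t)
        have h2 := hr x hx
        gcongr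
      have hηtb : |ηt x t| ≤ CS * (2 * τ) := by
        rw [hηt_def, abs_mul, abs_neg, abs_mul, abs_of_pos (zero_lt_two' ℝ), abs_of_pos hτ]
        have h1 := hS'b (2 - 2 * rho τ k x₀ x t)
        gcongr
      rw [Real.norm_eq_abs]
      calc |ηx x t * F₁ x t + ηt x t * F₂ x t|
          ≤ |ηx x t| * |F₁ x t| + |ηt x t| * |F₂ x t| := by
            rw [← abs_mul, ← abs_mul]; exact abs_add_le _ _
        _ ≤ CS * (2 * R) * (K * V x t) + CS * (2 * τ) * (K * V x t) := by
            have := hVnn x t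
            gcongr
        _ = CS * 2 * (R + τ) * K * V x t := by ring
        _ ≤ CS * 2 * (R + τ) * K * (Kl * s ^ 2 *
            (Real.exp (2 * s * Real.exp (-(lam * (1 / 2)))) * G x t)) := by gcongr
        _ = _ := by ring
  -- conclusion
  have hI0 : 0 ≤ ∫ x in Ioo a b, G x 0 := integral_nonneg fun x => hGnn x 0
  have hI : 0 ≤ ∫ q in Ioo a b ×ˢ Ioo 0 T, G q.1 q.2 := integral_nonneg fun q => hGnn _ _
  have hkey := (hleft.trans_eq hid).trans
    (show _ ≤ K' * s ^ 2 * (Real.exp (2 * s * Real.exp (-(lam * (1 / 2)))) *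
      (∫ q in Ioo a b ×ˢ Ioo 0 T, G q.1 q.2) + Real.exp (2 * s) * ∫ x in Ioo a b, G x 0) by
      have h1 := (abs_le.1 hbdry).1
      have h2 := (abs_le.1 hgrad).1
      have h3 : 0 ≤ K * Kl * s ^ 2 * (Real.exp (2 * s * Real.exp (-(lam * (1 / 2)))) *
        ∫ q in Ioo a b ×ˢ Ioo 0 T, G q.1 q.2) := by positivity
      have h4 : 0 ≤ CS * 2 * (R + τ) * (K * Kl) * s ^ 2 * (Real.exp (2 * s) *
        ∫ x in Ioo a b, G x 0) := by positivity
      rw [hK'_def]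
      linear_combination h1 + h2 + h3 + h4)
  have hfin := mul_le_mul_of_nonneg_left hkey (div_pos hKl hc).le
  rw [← mul_assoc, show Kl / c * (c / Kl) = 1 by field_simp, one_mul] at hfin
  rw [hG] at hfin
  refine hfin.trans_eq ?_
  ring

/-! ### Optimization in the Carleman parameter -/

/-- A bound with exponential factors in a large parameter `s` gives an interpolation inequality:
take `s` with `e^{(κ + μ) s} = B / D` if this is at least `s₀`; otherwise `B` is bounded by a
multiple of `D`. -/
lemma exists_interpolation {κ μ C s₀ : ℝ} (hκ : 0 < κ) (hμ : 0 < μ) (hC : 0 < C) :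
    ∃ K : ℝ, 0 < K ∧ ∀ A B D : ℝ, 0 ≤ B → 0 ≤ D → A ≤ B →
      (∀ s, s₀ ≤ s → A ≤ C * (Real.exp (-(κ * s)) * B + Real.exp (μ * s) * D)) →
      A ≤ K * B ^ (1 - κ / (κ + μ)) * D ^ (κ / (κ + μ)) := by
  obtain ⟨θ, hθ⟩ : ∃ θ, θ = κ / (κ + μ) := ⟨_, rfl⟩
  have hθ0 : 0 < θ := by rw [hθ]; positivity
  have hθκ : θ * (κ + μ) = κ := by rw [hθ]; field_simp
  rw [← hθ]
  refine ⟨2 * C + Real.exp (κ * s₀), by positivity, fun A B D hB hD hAB h => ?_⟩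
  have hnn : 0 ≤ (2 * C + Real.exp (κ * s₀)) * B ^ (1 - θ) * D ^ θ := by positivity
  rcases hB.eq_or_lt with rfl | hB0
  · exact hAB.trans hnn
  rcases hD.eq_or_lt with rfl | hD0
  · refine le_trans ?_ hnn
    have hlim : Tendsto (fun s : ℝ => C * (Real.exp (-(κ * s)) * B + Real.exp (μ * s) * 0)) atTop
        (𝓝 (C * (0 * B))) := by
      simp only [mul_zero, add_zero]
      refine Tendsto.const_mul _ (Tendsto.mul_const _ ?_)
      exact Real.tendsto_exp_neg_atTop_nhds_zero.comp (tendsto_id.const_mul_atTop hκ)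
    have := ge_of_tendsto hlim (eventually_atTop.2 ⟨s₀, fun s hs => h s hs⟩)
    linarith
  · obtain ⟨β, rfl⟩ : ∃ β, B = Real.exp β := ⟨_, (Real.exp_log hB0).symm⟩
    obtain ⟨d, rfl⟩ : ∃ d, D = Real.exp d := ⟨_, (Real.exp_log hD0).symm⟩
    have hX : Real.exp β ^ (1 - θ) * Real.exp d ^ θ = Real.exp (β * (1 - θ) + d * θ) := by
      rw [← Real.exp_mul, ← Real.exp_mul, ← Real.exp_add]
    rw [mul_assoc, hX]
    rcases le_total s₀ ((β - d) / (κ + μ)) with hs | hs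
    · refine (h _ hs).trans ?_
      obtain ⟨y, hy⟩ : ∃ y, y = (β - d) / (κ + μ) := ⟨_, rfl⟩
      have hyβ : y * (κ + μ) = β - d := by rw [hy]; field_simp
      rw [← hy, ← Real.exp_add, ← Real.exp_add]
      have e1 : -(κ * y) + β = β * (1 - θ) + d * θ := by
        linear_combination -θ * hyβ + y * hθκ
      have e2 : μ * y + d = β * (1 - θ) + d * θ := by
        linear_combination (1 - θ) * hyβ + y * hθκ
      rw [e1, e2]
      have := Real.exp_pos (β * (1 - θ) + d * θ)
      have := Real.exp_pos (κ * s₀)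
      nlinarith
    · have hs' : β - d ≤ s₀ * (κ + μ) := (div_le_iff₀ (by positivity)).1 hs
      have e1 : β ≤ κ * s₀ + (β * (1 - θ) + d * θ) := by
        linear_combination θ * hs' + s₀ * hθκ
      calc A ≤ Real.exp β := hAB
        _ ≤ Real.exp (κ * s₀) * Real.exp (β * (1 - θ) + d * θ) := by
          rw [← Real.exp_add]; exact Real.exp_le_exp.2 e1
        _ ≤ _ := by gcongr; linarith

/-- The interpolation inequality for the squares of the `H¹` norms of classical solutions. -/
theorem exists_interpolation_of_hasPartials {a b T P₀ M : ℝ} (hab : a < b) (hT : 0 < T)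
    (hP₀ : 0 < P₀) (hM : 0 ≤ M) :
    ∃ K : ℝ, 0 < K ∧ ∃ δ ∈ Ioo (0 : ℝ) 1, ∀ p p₁ : ℝ → ℝ,
      (∀ x ∈ Icc a b, HasDerivAt p (p₁ x) x) → ContinuousOn p₁ (Icc a b) →
      (∀ x ∈ Icc a b, P₀ ≤ p x ∧ p x ≤ 1 ∧ |p₁ x| ≤ M) →
      ∀ f fx ft fxx fxt ftt : ℝ → ℝ → ℝ,
      HasPartials (Icc a b ×ˢ Icc 0 T) f fx ft fxx fxt ftt →
      (∀ x ∈ Icc a b, ∀ t ∈ Icc 0 T, p x * fxx x t + p₁ x * fx x t + ftt x t = 0) →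
      (∫ q in Ioo ((2 * a + b) / 3) ((a + 2 * b) / 3) ×ˢ Ioo 0 (T / 4),
          (f q.1 q.2 ^ 2 + fx q.1 q.2 ^ 2 + ft q.1 q.2 ^ 2)) ≤
        K * (∫ q in Ioo a b ×ˢ Ioo 0 T,
          (f q.1 q.2 ^ 2 + fx q.1 q.2 ^ 2 + ft q.1 q.2 ^ 2)) ^ (1 - δ) *
          (∫ x in Ioo a b, (f x 0 ^ 2 + fx x 0 ^ 2 + ft x 0 ^ 2)) ^ δ := by
  obtain ⟨lam, hlam, C, hC, s₀, hs₀, hcarl⟩ := carleman_estimate hab hT hP₀ hM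
  obtain ⟨e₁, he₁⟩ : ∃ e₁, e₁ = Real.exp (-(lam * (1 / 2))) := ⟨_, rfl⟩
  obtain ⟨e₂, he₂⟩ : ∃ e₂, e₂ = Real.exp (-(lam * (13 / 36))) := ⟨_, rfl⟩
  obtain ⟨κ, hκ_def⟩ : ∃ κ, κ = e₂ - e₁ := ⟨_, rfl⟩
  obtain ⟨μ, hμ_def⟩ : ∃ μ, μ = κ + 2 * (1 - e₂) := ⟨_, rfl⟩
  have hκ : 0 < κ := by
    rw [hκ_def, he₁, he₂, sub_pos]
    exact Real.exp_lt_exp.2 (by linarith)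
  have he₂1 : e₂ < 1 := by
    rw [he₂, ← Real.exp_zero]; exact Real.exp_lt_exp.2 (by linarith)
  have hμ : 0 < μ := by rw [hμ_def]; linarith
  obtain ⟨K, hK, hinterp⟩ := exists_interpolation (s₀ := s₀) hκ hμ
    (show 0 < C * (2 / κ ^ 2) by positivity)
  refine ⟨K, hK, κ / (κ + μ), ⟨by positivity, (div_lt_one (by positivity)).2 (by linarith)⟩, ?_⟩
  intro p p₁ hp hp₁ hpb f fx ft fxx fxt ftt hf heq
  have hnn : ∀ x t, 0 ≤ f x t ^ 2 + fx x t ^ 2 + ft x t ^ 2 := fun x t => by positivity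
  have hGi : IntegrableOn (fun q : ℝ × ℝ => f q.1 q.2 ^ 2 + fx q.1 q.2 ^ 2 + ft q.1 q.2 ^ 2)
      (Ioo a b ×ˢ Ioo 0 T) :=
    integrableOn_rectangle (((hf.cont.pow 2).add (hf.cont_x.pow 2)).add (hf.cont_t.pow 2))
  have hsub : Ioo ((2 * a + b) / 3) ((a + 2 * b) / 3) ×ˢ Ioo 0 (T / 4) ⊆ Ioo a b ×ˢ Ioo 0 T :=
    prod_mono (Ioo_subset_Ioo (by linarith) (by linarith)) (Ioo_subset_Ioo le_rfl (by linarith))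
  have hB := integral_nonneg (μ := volume.restrict (Ioo a b ×ˢ Ioo 0 T))
    (f := fun q : ℝ × ℝ => f q.1 q.2 ^ 2 + fx q.1 q.2 ^ 2 + ft q.1 q.2 ^ 2)
    fun q => hnn q.1 q.2
  have hD := integral_nonneg (μ := volume.restrict (Ioo a b))
    (f := fun x => f x 0 ^ 2 + fx x 0 ^ 2 + ft x 0 ^ 2) fun x => hnn x 0
  refine hinterp _ _ _ hB hD
    (setIntegral_mono_set hGi (ae_of_all _ fun q => hnn q.1 q.2) hsub.eventuallyLE) fun s hs => ?_
  have h := hcarl p p₁ hp hp₁ hpb f fx ft fxx fxt ftt hf heq s hs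
  rw [← he₁, ← he₂] at h
  have hs0 : 0 ≤ s := zero_le_one.trans (hs₀.trans hs)
  -- the factor `s²` is absorbed by half of the exponential gain
  have hs2 : s ^ 2 ≤ 2 / κ ^ 2 * Real.exp (κ * s) := by
    have := Real.quadratic_le_exp_of_nonneg (mul_nonneg hκ.le hs0)
    have h1 : (κ * s) ^ 2 ≤ 2 * Real.exp (κ * s) := by
      have := mul_nonneg hκ.le hs0
      linarith
    rw [div_mul_eq_mul_div, le_div_iff₀ (by positivity)]
    linarith
  set A := ∫ q in Ioo ((2 * a + b) / 3) ((a + 2 * b) / 3) ×ˢ Ioo 0 (T / 4),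
    (f q.1 q.2 ^ 2 + fx q.1 q.2 ^ 2 + ft q.1 q.2 ^ 2)
  set B := ∫ q in Ioo a b ×ˢ Ioo 0 T, (f q.1 q.2 ^ 2 + fx q.1 q.2 ^ 2 + ft q.1 q.2 ^ 2)
  set D := ∫ x in Ioo a b, (f x 0 ^ 2 + fx x 0 ^ 2 + ft x 0 ^ 2)
  have hBD : 0 ≤ Real.exp (2 * s * e₁) * B + Real.exp (2 * s) * D :=
    add_nonneg (mul_nonneg (Real.exp_pos _).le hB) (mul_nonneg (Real.exp_pos _).le hD)
  calc A = Real.exp (-(2 * s * e₂)) * (Real.exp (2 * s * e₂) * A) := by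
        rw [← mul_assoc, ← Real.exp_add]; simp
    _ ≤ Real.exp (-(2 * s * e₂)) *
        (C * s ^ 2 * (Real.exp (2 * s * e₁) * B + Real.exp (2 * s) * D)) := by gcongr
    _ ≤ Real.exp (-(2 * s * e₂)) * (C * (2 / κ ^ 2 * Real.exp (κ * s)) *
        (Real.exp (2 * s * e₁) * B + Real.exp (2 * s) * D)) := by gcongr
    _ = C * (2 / κ ^ 2) * ((Real.exp (-(2 * s * e₂)) * Real.exp (κ * s) *
        Real.exp (2 * s * e₁)) * B + (Real.exp (-(2 * s * e₂)) * Real.exp (κ * s) *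
        Real.exp (2 * s)) * D) := by ring
    _ = _ := by
        rw [← Real.exp_add, ← Real.exp_add, ← Real.exp_add, hμ_def, hκ_def]
        congr 4 <;> ring_nf

/-! ### The Sobolev norms of continuously differentiable functions -/

lemma eLpNorm_two_sq {E : Type*} [MeasureSpace E] {Ω : Set E} {f : E → ℝ}
    (hf : MemLp f 2 (volume.restrict Ω)) :
    eLpNorm f 2 (volume.restrict Ω) ^ 2 = ENNReal.ofReal (∫ x in Ω, f x ^ 2) := by
  have h := hf.eLpNorm_eq_integral_rpow_norm (by norm_num) (by norm_num)
  rw [h, ← ENNReal.ofReal_pow (by positivity)]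
  congr 1
  rw [← Real.rpow_natCast, ← Real.rpow_mul (by positivity)]
  simp

lemma l2Norm_eq {E : Type*} [MeasureSpace E] {Ω : Set E} {f : E → ℝ}
    (hf : MemLp f 2 (volume.restrict Ω)) :
    l2Norm Ω f = √(∫ x in Ω, f x ^ 2) := by
  rw [l2Norm, eL2Norm, eq_comm, Real.sqrt_eq_iff_eq_sq (by positivity) ENNReal.toReal_nonneg,
    ← ENNReal.toReal_pow, eLpNorm_two_sq hf, ENNReal.toReal_ofReal (by positivity)]

section Sobolev

variable {E : Type*} [NormedAddCommGroup E] [NormedSpace ℝ E] [MeasureSpace E] {ι : Type*}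
  [Fintype ι]

/-- Weak derivatives are unique almost everywhere. -/
lemma HasWeakDeriv.ae_eq [FiniteDimensional ℝ E] [BorelSpace E] {Ω : Set E} (hΩ : IsOpen Ω) {v : E}
    {f g g' : E → ℝ} (h : HasWeakDeriv Ω v f g) (h' : HasWeakDeriv Ω v f g') :
    g =ᵐ[volume.restrict Ω] g' := by
  have hint : ∀ {k η : E → ℝ}, LocallyIntegrableOn k Ω volume → ContDiff ℝ ∞ η →
      HasCompactSupport η → tsupport η ⊆ Ω → Integrable (fun x => k x * η x) := by
    intro k η hk hη hc hs
    have h1 : IntegrableOn (fun x => k x * η x) (tsupport η) :=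
      (hk.integrableOn_compact_subset hs hc).mul_continuousOn hη.continuous.continuousOn hc
    refine (integrableOn_iff_integrable_of_support_subset ?_).1 h1
    exact (Function.support_mul_subset_right _ _).trans (subset_tsupport η)
  have key := hΩ.ae_eq_zero_of_integral_contDiff_smul_eq_zero (μ := volume)
    (f := fun x => g x - g' x) (h.2.1.sub h'.2.1) (by
      intro η hη hc hs
      have h1 := h.2.2 η hη hc hs
      rw [h'.2.2 η hη hc hs, neg_inj] at h1
      have hz : ∀ k : E → ℝ, ∫ x in Ω, k x * η x = ∫ x, k x * η x := fun k =>
        setIntegral_eq_integral_of_forall_compl_eq_zero fun x hx => by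
          rw [image_eq_zero_of_notMem_tsupport fun h => hx (hs h), mul_zero]
      rw [hz, hz] at h1
      have h2 : ∀ x, η x • (g x - g' x) = g x * η x - g' x * η x := fun x => by
        rw [smul_eq_mul]; ring
      simp_rw [h2]
      rw [integral_sub (hint h.2.1 hη hc hs) (hint h'.2.1 hη hc hs), h1, sub_self])
  rw [Filter.EventuallyEq, ae_restrict_iff' hΩ.measurableSet]
  filter_upwards [key] with x hx hxΩ using sub_eq_zero.1 (hx hxΩ)

lemma eH1Norm_eq [FiniteDimensional ℝ E] [BorelSpace E] {Ω : Set E} (hΩ : IsOpen Ω) {e : ι → E}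
    {f : E → ℝ} {g : ι → E → ℝ} (hg : ∀ i, HasWeakDeriv Ω (e i) f (g i)) :
    eH1Norm e Ω f = (eL2Norm Ω f ^ 2 + ∑ i, eL2Norm Ω (g i) ^ 2) ^ (1 / 2 : ℝ) := by
  refine le_antisymm (iInf₂_le g hg) (le_iInf₂ fun g' hg' => le_of_eq ?_)
  congr 3 with i
  rw [eL2Norm, eL2Norm, eLpNorm_congr_ae ((hg i).ae_eq hΩ (hg' i))]

lemma h1Norm_eq [FiniteDimensional ℝ E] [BorelSpace E] {Ω : Set E} (hΩ : IsOpen Ω) {e : ι → E}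
    {f : E → ℝ} {g : ι → E → ℝ} (hg : ∀ i, HasWeakDeriv Ω (e i) f (g i))
    (hfL : MemLp f 2 (volume.restrict Ω)) (hgL : ∀ i, MemLp (g i) 2 (volume.restrict Ω)) :
    h1Norm e Ω f = √((∫ x in Ω, f x ^ 2) + ∑ i, ∫ x in Ω, g i x ^ 2) := by
  have h : ∀ i, eL2Norm Ω (g i) ^ 2 = ENNReal.ofReal (∫ x in Ω, g i x ^ 2) := fun i =>
    eLpNorm_two_sq (hgL i)
  rw [h1Norm, eH1Norm_eq hΩ hg, Finset.sum_congr rfl fun i _ => h i, eL2Norm, eLpNorm_two_sq hfL,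
    ← ENNReal.ofReal_sum_of_nonneg fun i _ => by positivity,
    ← ENNReal.ofReal_add (by positivity) (by positivity), ← ENNReal.toReal_rpow,
    ENNReal.toReal_ofReal (by positivity), Real.sqrt_eq_rpow]

end Sobolev

lemma integrableOn_Ioo_of_continuousOn {a b : ℝ} {f : ℝ → ℝ} (hf : ContinuousOn f (Icc a b)) :
    IntegrableOn f (Ioo a b) :=
  (hf.integrableOn_compact isCompact_Icc).mono_set Ioo_subset_Icc_self

lemma memLp_Ioo_of_continuousOn {a b : ℝ} {f : ℝ → ℝ} (hf : ContinuousOn f (Icc a b)) :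
    MemLp f 2 (volume.restrict (Ioo a b)) :=
  (memLp_two_iff_integrable_sq
    ((hf.mono Ioo_subset_Icc_self).aestronglyMeasurable measurableSet_Ioo)).2
    (integrableOn_Ioo_of_continuousOn (hf.pow 2))

lemma memLp_rectangle {a b c d : ℝ} {f : ℝ × ℝ → ℝ} (hf : ContinuousOn f (Icc a b ×ˢ Icc c d)) :
    MemLp f 2 (volume.restrict (Ioo a b ×ˢ Ioo c d)) :=
  (memLp_two_iff_integrable_sq
    ((hf.mono (prod_mono Ioo_subset_Icc_self Ioo_subset_Icc_self)).aestronglyMeasurable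
      (measurableSet_Ioo.prod measurableSet_Ioo))).2 (integrableOn_rectangle (hf.pow 2))

lemma hasWeakDeriv_Ioo {a b : ℝ} (hab : a ≤ b) {f f' : ℝ → ℝ}
    (hf : ∀ x ∈ Icc a b, HasDerivAt f (f' x) x) (hf' : ContinuousOn f' (Icc a b)) :
    HasWeakDeriv (Ioo a b) 1 f f' := by
  have hfc : ContinuousOn f (Icc a b) := fun x hx => (hf x hx).continuousAt.continuousWithinAt
  refine ⟨(integrableOn_Ioo_of_continuousOn hfc).locallyIntegrableOn,
    (integrableOn_Ioo_of_continuousOn hf').locallyIntegrableOn, fun η hη _ hs => ?_⟩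
  have hd : ∀ x, HasDerivAt η (fderiv ℝ η x 1) x := fun x =>
    ((hη.differentiable (by simp)) x).hasFDerivAt.hasDerivAt
  have hdc : Continuous fun x => fderiv ℝ η x 1 :=
    (hη.continuous_fderiv (by simp)).clm_apply continuous_const
  have ha : η a = 0 := image_eq_zero_of_notMem_tsupport fun h => (hs h).1.false
  have hb : η b = 0 := image_eq_zero_of_notMem_tsupport fun h => (hs h).2.false
  have h := setIntegral_Ioo_eq_sub hab (f := fun x => f x * η x)
    (f' := fun x => f' x * η x + f x * fderiv ℝ η x 1) (fun x hx => (hf x hx).mul (hd x))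
    ((hf'.mul hη.continuous.continuousOn).add (hfc.mul hdc.continuousOn))
  rw [ha, hb, mul_zero, mul_zero, sub_self] at h
  have h' := integral_add (integrableOn_Ioo_of_continuousOn (hf'.mul hη.continuous.continuousOn))
    (integrableOn_Ioo_of_continuousOn (hfc.mul hdc.continuousOn))
  rw [eq_neg_iff_add_eq_zero, add_comm]
  exact h'.symm.trans h

lemma hasDerivAt_fst {η : ℝ × ℝ → ℝ} (hη : Differentiable ℝ η) (x t : ℝ) :
    HasDerivAt (fun x => η (x, t)) (fderiv ℝ η (x, t) (1, 0)) x :=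
  (hη (x, t)).hasFDerivAt.comp_hasDerivAt x ((hasDerivAt_id x).prodMk (hasDerivAt_const x t))

lemma hasDerivAt_snd {η : ℝ × ℝ → ℝ} (hη : Differentiable ℝ η) (x t : ℝ) :
    HasDerivAt (fun t => η (x, t)) (fderiv ℝ η (x, t) (0, 1)) t :=
  (hη (x, t)).hasFDerivAt.comp_hasDerivAt t ((hasDerivAt_const t x).prodMk (hasDerivAt_id t))

/-- On a rectangle, continuous partial derivatives are weak derivatives. The function `φ` need agree
with the regular function `f` only in the interior. -/
lemma hasWeakDeriv_rectangle {a b c d : ℝ} (hab : a ≤ b) (hcd : c ≤ d)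
    {f fx ft fxx fxt ftt : ℝ → ℝ → ℝ}
    (hf : HasPartials (Icc a b ×ˢ Icc c d) f fx ft fxx fxt ftt) {φ : ℝ × ℝ → ℝ}
    (hφ : EqOn φ (fun q => f q.1 q.2) (Ioo a b ×ˢ Ioo c d)) (i : Fin 2) :
    HasWeakDeriv (Ioo a b ×ˢ Ioo c d) (basis2 i) φ
      ((![fun q => fx q.1 q.2, fun q => ft q.1 q.2] : Fin 2 → ℝ × ℝ → ℝ) i) := by
  have hm : MeasurableSet (Ioo a b ×ˢ Ioo c d) := measurableSet_Ioo.prod measurableSet_Ioo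
  have hφi : IntegrableOn φ (Ioo a b ×ˢ Ioo c d) :=
    (integrableOn_rectangle hf.cont).congr_fun hφ.symm hm
  have hint : ∀ (η : ℝ × ℝ → ℝ) (v : ℝ × ℝ), ∫ q in Ioo a b ×ˢ Ioo c d, φ q * fderiv ℝ η q v =
      ∫ q in Ioo a b ×ˢ Ioo c d, f q.1 q.2 * fderiv ℝ η q v := fun η v =>
    setIntegral_congr_fun hm fun q hq => by simp only [hφ hq]
  have hdc : ∀ {η : ℝ × ℝ → ℝ} (v : ℝ × ℝ), ContDiff ℝ ∞ η → Continuous fun q => fderiv ℝ η q v :=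
    fun v hη => (hη.continuous_fderiv (by simp)).clm_apply continuous_const
  have hz : ∀ {η : ℝ × ℝ → ℝ} {q : ℝ × ℝ}, tsupport η ⊆ Ioo a b ×ˢ Ioo c d →
      q ∉ Ioo a b ×ˢ Ioo c d → η q = 0 := fun hs hq =>
    image_eq_zero_of_notMem_tsupport fun h => hq (hs h)
  fin_cases i
  · refine ⟨hφi.locallyIntegrableOn, (integrableOn_rectangle hf.cont_x).locallyIntegrableOn,
      fun η hη _ hs => ?_⟩
    change ∫ q in Ioo a b ×ˢ Ioo c d, φ q * fderiv ℝ η q (1, 0) =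
      -∫ q in Ioo a b ×ˢ Ioo c d, fx q.1 q.2 * η q
    have c1 := hf.cont_x.mul hη.continuous.continuousOn
    have c2 := hf.cont.mul (hdc (1, 0) hη).continuousOn
    have h := integral_partial_fst (F := fun x t => f x t * η (x, t))
      (D := fun x t => fx x t * η (x, t) + f x t * fderiv ℝ η (x, t) (1, 0)) hab
      (fun x hx t ht => (hf.dx x t ⟨hx, ht⟩).mul (hasDerivAt_fst (hη.differentiable (by simp)) x t))
      (c1.add c2)
    have h0 : ∫ t in Ioo c d, (f b t * η (b, t) - f a t * η (a, t)) = 0 := by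
      have h1 : ∀ t, η (b, t) = 0 := fun t => hz hs fun h => h.1.2.false
      have h2 : ∀ t, η (a, t) = 0 := fun t => hz hs fun h => h.1.1.false
      simp [h1, h2]
    rw [h0] at h
    have h' := integral_add (integrableOn_rectangle c1) (integrableOn_rectangle c2)
    rw [hint, eq_neg_iff_add_eq_zero, add_comm]
    exact h'.symm.trans h
  · refine ⟨hφi.locallyIntegrableOn, (integrableOn_rectangle hf.cont_t).locallyIntegrableOn,
      fun η hη _ hs => ?_⟩
    change ∫ q in Ioo a b ×ˢ Ioo c d, φ q * fderiv ℝ η q (0, 1) =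
      -∫ q in Ioo a b ×ˢ Ioo c d, ft q.1 q.2 * η q
    have c1 := hf.cont_t.mul hη.continuous.continuousOn
    have c2 := hf.cont.mul (hdc (0, 1) hη).continuousOn
    have h := integral_partial_snd (F := fun x t => f x t * η (x, t))
      (D := fun x t => ft x t * η (x, t) + f x t * fderiv ℝ η (x, t) (0, 1)) hcd
      (fun x hx t ht => (hf.dt x t ⟨hx, ht⟩).mul (hasDerivAt_snd (hη.differentiable (by simp)) x t))
      (c1.add c2)
    have h0 : ∫ x in Ioo a b, (f x d * η (x, d) - f x c * η (x, c)) = 0 := by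
      have h1 : ∀ x, η (x, d) = 0 := fun x => hz hs fun h => h.2.2.false
      have h2 : ∀ x, η (x, c) = 0 := fun x => hz hs fun h => h.2.1.false
      simp [h1, h2]
    rw [h0] at h
    have h' := integral_add (integrableOn_rectangle c1) (integrableOn_rectangle c2)
    rw [hint, eq_neg_iff_add_eq_zero, add_comm]
    exact h'.symm.trans h

lemma HasPartials.mono {Ω Ω' : Set (ℝ × ℝ)} {f fx ft fxx fxt ftt : ℝ → ℝ → ℝ}
    (h : HasPartials Ω f fx ft fxx fxt ftt) (hs : Ω' ⊆ Ω) : HasPartials Ω' f fx ft fxx fxt ftt where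
  dx x t hq := h.dx x t (hs hq)
  dt x t hq := h.dt x t (hs hq)
  dxx x t hq := h.dxx x t (hs hq)
  dxt x t hq := h.dxt x t (hs hq)
  dtx x t hq := h.dtx x t (hs hq)
  dtt x t hq := h.dtt x t (hs hq)
  cont := h.cont.mono hs
  cont_x := h.cont_x.mono hs
  cont_t := h.cont_t.mono hs
  cont_xx := h.cont_xx.mono hs
  cont_xt := h.cont_xt.mono hs
  cont_tt := h.cont_tt.mono hs

lemma memH1_and_h1Norm_rectangle {a b c d : ℝ} (hab : a ≤ b) (hcd : c ≤ d)
    {f fx ft fxx fxt ftt : ℝ → ℝ → ℝ}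
    (hf : HasPartials (Icc a b ×ˢ Icc c d) f fx ft fxx fxt ftt) {φ : ℝ × ℝ → ℝ}
    (hφ : EqOn φ (fun q => f q.1 q.2) (Ioo a b ×ˢ Ioo c d)) :
    MemH1 basis2 (Ioo a b ×ˢ Ioo c d) φ ∧ h1Norm basis2 (Ioo a b ×ˢ Ioo c d) φ =
      √(∫ q in Ioo a b ×ˢ Ioo c d, (f q.1 q.2 ^ 2 + fx q.1 q.2 ^ 2 + ft q.1 q.2 ^ 2)) := by
  have hm : MeasurableSet (Ioo a b ×ˢ Ioo c d) := measurableSet_Ioo.prod measurableSet_Ioo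
  have hφL : MemLp φ 2 (volume.restrict (Ioo a b ×ˢ Ioo c d)) := by
    refine (memLp_congr_ae ?_).2 (memLp_rectangle hf.cont)
    filter_upwards [ae_restrict_mem hm] with q hq using hφ hq
  have hg := hasWeakDeriv_rectangle hab hcd hf hφ
  have hgL : ∀ i : Fin 2, MemLp ((![fun q => fx q.1 q.2, fun q => ft q.1 q.2] :
      Fin 2 → ℝ × ℝ → ℝ) i) 2 (volume.restrict (Ioo a b ×ˢ Ioo c d)) := by
    intro i
    fin_cases i
    exacts [memLp_rectangle hf.cont_x, memLp_rectangle hf.cont_t]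
  refine ⟨⟨hφL, _, fun i => ⟨hg i, hgL i⟩⟩, ?_⟩
  rw [h1Norm_eq (isOpen_Ioo.prod isOpen_Ioo) hg hφL hgL]
  congr 1
  have h1 : ∫ q in Ioo a b ×ˢ Ioo c d, φ q ^ 2 = ∫ q in Ioo a b ×ˢ Ioo c d, f q.1 q.2 ^ 2 :=
    setIntegral_congr_fun hm fun q hq => by simp only [hφ hq]
  have c1 : ContinuousOn (fun q : ℝ × ℝ => f q.1 q.2 ^ 2) (Icc a b ×ˢ Icc c d) := hf.cont.pow 2
  have c2 : ContinuousOn (fun q : ℝ × ℝ => fx q.1 q.2 ^ 2) (Icc a b ×ˢ Icc c d) := hf.cont_x.pow 2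
  have c3 : ContinuousOn (fun q : ℝ × ℝ => ft q.1 q.2 ^ 2) (Icc a b ×ˢ Icc c d) := hf.cont_t.pow 2
  have c4 : ContinuousOn (fun q : ℝ × ℝ => f q.1 q.2 ^ 2 + fx q.1 q.2 ^ 2)
    (Icc a b ×ˢ Icc c d) := c1.add c2
  rw [h1, integral_add (integrableOn_rectangle c4) (integrableOn_rectangle c3),
    integral_add (integrableOn_rectangle c1) (integrableOn_rectangle c2)]
  simp [Fin.sum_univ_two, add_assoc]

lemma memH1_and_h1Norm_Ioo {a b : ℝ} (hab : a ≤ b) {f f' : ℝ → ℝ}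
    (hf : ∀ x ∈ Icc a b, HasDerivAt f (f' x) x) (hf' : ContinuousOn f' (Icc a b)) :
    MemH1 basis1 (Ioo a b) f ∧ h1Norm basis1 (Ioo a b) f =
      √((∫ x in Ioo a b, f x ^ 2) + ∫ x in Ioo a b, f' x ^ 2) := by
  have hfL : MemLp f 2 (volume.restrict (Ioo a b)) :=
    memLp_Ioo_of_continuousOn fun x hx => (hf x hx).continuousAt.continuousWithinAt
  have hfL' : MemLp f' 2 (volume.restrict (Ioo a b)) := memLp_Ioo_of_continuousOn hf'
  have hg : ∀ i : Fin 1, HasWeakDeriv (Ioo a b) (basis1 i) f ((fun _ => f') i) := by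
    intro i
    fin_cases i
    exact hasWeakDeriv_Ioo hab hf hf'
  refine ⟨⟨hfL, _, fun i => ⟨hg i, hfL'⟩⟩, ?_⟩
  rw [h1Norm_eq isOpen_Ioo hg hfL fun _ => hfL']
  simp

/-! ### The interpolation inequality for solutions -/

namespace ModalSum

variable {α : ℝ} {ι : Type} [Fintype ι] (S : ModalSum α ι)

/-- `∂ₓ` of `∑ cᵢ(t) eᵢ(x)`. -/
noncomputable def valX (x t : ℝ) : ℝ := ∑ i, S.c i t * deriv (S.e i) x

/-- `∂ₜ` of `∑ cᵢ(t) eᵢ(x)`. -/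
def valT (x t : ℝ) : ℝ := ∑ i, S.c' i t * S.e i x

/-- `∂ₓ²` of `∑ cᵢ(t) eᵢ(x)`. -/
noncomputable def valXX (x t : ℝ) : ℝ := ∑ i, S.c i t * secondDeriv α (S.lam i) (S.e i) x

/-- `∂ₓ∂ₜ` of `∑ cᵢ(t) eᵢ(x)`. -/
noncomputable def valXT (x t : ℝ) : ℝ := ∑ i, S.c' i t * deriv (S.e i) x

/-- `∂ₜ²` of `∑ cᵢ(t) eᵢ(x)`. -/
def valTT (x t : ℝ) : ℝ := ∑ i, S.lam i * S.c i t * S.e i x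

lemma continuousOn_sum_mul {c g : ι → ℝ → ℝ} {Ω : Set (ℝ × ℝ)} (hΩ : Ω ⊆ Ioo 0 1 ×ˢ univ)
    (hc : ∀ i, Continuous (c i)) (hg : ∀ i, ContinuousOn (g i) (Ioo 0 1)) :
    ContinuousOn (fun q : ℝ × ℝ => ∑ i, c i q.2 * g i q.1) Ω :=
  continuousOn_finsetSum _ fun i _ => ((hc i).comp continuous_snd).continuousOn.mul
    ((hg i).comp continuousOn_fst fun _ hq => (hΩ hq).1)

lemma hasPartials {Ω : Set (ℝ × ℝ)} (hΩ : Ω ⊆ Ioo 0 1 ×ˢ univ) :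
    HasPartials Ω S.val S.valX S.valT S.valXX S.valXT S.valTT where
  dx _ _ h := HasDerivAt.fun_sum fun i _ => ((S.dom i).hasDerivAt (hΩ h).1).const_mul _
  dt _ t _ := HasDerivAt.fun_sum fun i _ => (S.hasDerivAt_c i t).mul_const _
  dxx _ _ h := HasDerivAt.fun_sum fun i _ =>
    ((S.dom i).hasDerivAt_deriv (S.eig i) (hΩ h).1).const_mul _
  dxt _ t _ := HasDerivAt.fun_sum fun i _ => (S.hasDerivAt_c i t).mul_const _
  dtx _ _ h := HasDerivAt.fun_sum fun i _ => ((S.dom i).hasDerivAt (hΩ h).1).const_mul _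
  dtt _ t _ := HasDerivAt.fun_sum fun i _ => (S.hasDerivAt_c' i t).mul_const _
  cont := continuousOn_sum_mul hΩ S.continuous_c fun i => (S.dom i).continuousOn
  cont_x := continuousOn_sum_mul hΩ S.continuous_c fun i => (S.dom i).continuousOn_deriv
  cont_t := continuousOn_sum_mul hΩ S.continuous_c' fun i => (S.dom i).continuousOn
  cont_xx := continuousOn_sum_mul hΩ S.continuous_c fun i => (S.dom i).continuousOn_secondDeriv _
  cont_xt := continuousOn_sum_mul hΩ S.continuous_c' fun i => (S.dom i).continuousOn_deriv
  cont_tt := continuousOn_sum_mul (c := fun i t => S.lam i * S.c i t) hΩ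
    (fun i => continuous_const.mul (S.continuous_c i)) fun i => (S.dom i).continuousOn

lemma equation {x t : ℝ} (hx : 0 < x) :
    x ^ α * S.valXX x t + α * x ^ (α - 1) * S.valX x t + S.valTT x t = 0 := by
  simp only [valXX, valX, valTT, Finset.mul_sum, ← Finset.sum_add_distrib]
  refine Finset.sum_eq_zero fun i _ => ?_
  linear_combination S.c i t * rpow_mul_secondDeriv (α := α) (ϑ := S.e i) (lam := S.lam i) hx

end ModalSum

/-- The bounds on the coefficient `x^α` on `[a, b] ⊂ (0, 1)` that are uniform in `α ∈ [0, 2]`. -/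
lemma rpow_coefficient_bounds {a α x : ℝ} (ha : 0 < a) (hα : 0 ≤ α) (hα2 : α ≤ 2) (hx : a ≤ x)
    (hx1 : x ≤ 1) : a ^ 2 ≤ x ^ α ∧ x ^ α ≤ 1 ∧ |α * x ^ (α - 1)| ≤ 2 / a := by
  have hx0 : 0 < x := ha.trans_le hx
  have h1 : x ^ α ≤ 1 := Real.rpow_le_one hx0.le hx1 hα
  refine ⟨?_, h1, ?_⟩
  · calc a ^ 2 = a ^ (2 : ℝ) := (Real.rpow_two a).symm
      _ ≤ a ^ α := Real.rpow_le_rpow_of_exponent_ge ha (hx.trans hx1) hα2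
      _ ≤ x ^ α := Real.rpow_le_rpow ha.le hx hα
  · have h0 : 0 ≤ x ^ α := Real.rpow_nonneg hx0.le _
    rw [Real.rpow_sub_one hx0.ne', abs_of_nonneg (by positivity), ← mul_div_assoc]
    gcongr
    nlinarith

lemma sqrt_add_le {x y : ℝ} (hx : 0 ≤ x) (hy : 0 ≤ y) : √(x + y) ≤ √x + √y := by
  refine Real.sqrt_le_iff.2 ⟨by positivity, ?_⟩
  nlinarith [Real.sq_sqrt hx, Real.sq_sqrt hy, mul_nonneg (Real.sqrt_nonneg x) (Real.sqrt_nonneg y)]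

lemma sqrt_rpow {x : ℝ} (hx : 0 ≤ x) (y : ℝ) : √(x ^ y) = √x ^ y := by
  rw [Real.sqrt_eq_rpow, Real.sqrt_eq_rpow, ← Real.rpow_mul hx, ← Real.rpow_mul hx, mul_comm]

end DegenerateElliptic

theorem proposition2p2 (a b T : ℝ) (ha : 0 < a) (hab : a < b) (hb : b < 1) (hT : 0 < T) :
    ∃ c : ℝ, 0 < c ∧ ∃ δ : ℝ, δ ∈ Ioo (0 : ℝ) 1 ∧
      ∀ α ∈ Ico (0 : ℝ) 2, ∀ φ₀ ∈ eigenSpan α, ∀ φ₁ ∈ eigenSpan α,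
        ∀ φ : ℝ × ℝ → ℝ, IsSolution α T φ₀ φ₁ φ →
          MemH1 basis2 (Ioo a b ×ˢ Ioo 0 T) φ ∧
          MemH1 basis1 (Ioo a b) φ₀ ∧
          MemLp φ₁ 2 (volume.restrict (Ioo a b)) ∧
          h1Norm basis2 (Ioo ((2 * a + b) / 3) ((a + 2 * b) / 3) ×ˢ Ioo 0 (T / 4)) φ ≤
            c * h1Norm basis2 (Ioo a b ×ˢ Ioo 0 T) φ ^ (1 - δ) *
              (h1Norm basis1 (Ioo a b) φ₀ + l2Norm (Ioo a b) φ₁) ^ δ := by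
  obtain ⟨K, hK, δ, hδ, hinterp⟩ := exists_interpolation_of_hasPartials hab hT
    (show 0 < a ^ 2 by positivity) (show 0 ≤ 2 / a by positivity)
  refine ⟨√K, Real.sqrt_pos.2 hK, δ, hδ, ?_⟩
  intro α hα φ₀ hφ₀ φ₁ hφ₁ φ hφ
  obtain ⟨ι, _, S, h₀, h₁⟩ := exists_modalSum hφ₀ hφ₁
  obtain rfl : φ₀ = fun x => S.val x 0 := funext h₀
  obtain rfl : φ₁ = fun x => S.valT x 0 := funext h₁
  have hIcc : ∀ x ∈ Icc a b, x ∈ Ioo (0 : ℝ) 1 := fun x hx =>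
    ⟨ha.trans_le hx.1, hx.2.trans_lt hb⟩
  have hS : HasPartials (Icc a b ×ˢ Icc 0 T) S.val S.valX S.valT S.valXX S.valXT S.valTT :=
    S.hasPartials fun q hq => ⟨hIcc _ hq.1, mem_univ _⟩
  have hEq : EqOn φ (fun q => S.val q.1 q.2) (Ioo a b ×ˢ Ioo 0 T) := fun q hq =>
    S.eq_of_isSolution hφ h₀ h₁ (hIcc _ (Ioo_subset_Icc_self hq.1)) hq.2
  have hslice : ∀ {g : ℝ → ℝ → ℝ}, ContinuousOn (fun q : ℝ × ℝ => g q.1 q.2) (Icc a b ×ˢ Icc 0 T) →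
      ContinuousOn (fun x => g x 0) (Icc a b) := fun hg =>
    hg.comp (f := fun x => (x, (0 : ℝ))) (by fun_prop) fun x hx => ⟨hx, le_rfl, hT.le⟩
  have ha' : a ≤ (2 * a + b) / 3 := by linarith
  have hb' : (a + 2 * b) / 3 ≤ b := by linarith
  have hT' : T / 4 ≤ T := by linarith
  obtain ⟨hmem, hnorm⟩ := memH1_and_h1Norm_rectangle hab.le hT.le hS hEq
  obtain ⟨-, hnorm'⟩ := memH1_and_h1Norm_rectangle (by linarith) (by linarith)
    (hS.mono (prod_mono (Icc_subset_Icc ha' hb') (Icc_subset_Icc le_rfl hT')))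
    (hEq.mono (prod_mono (Ioo_subset_Ioo ha' hb') (Ioo_subset_Ioo le_rfl hT')))
  obtain ⟨hmem₀, hnorm₀⟩ := memH1_and_h1Norm_Ioo (f := fun x => S.val x 0)
    (f' := fun x => S.valX x 0) hab.le
    (fun x hx => hS.dx x 0 ⟨hx, le_rfl, hT.le⟩) (hslice hS.cont_x)
  have hmem₁ := memLp_Ioo_of_continuousOn (hslice hS.cont_t)
  refine ⟨hmem, hmem₀, hmem₁, ?_⟩
  have hmain := hinterp (fun x => x ^ α) (fun x => α * x ^ (α - 1))
    (fun x hx => Real.hasDerivAt_rpow_const (Or.inl (hIcc x hx).1.ne'))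
    (continuousOn_const.mul (continuousOn_id.rpow_const fun x hx => Or.inl (hIcc x hx).1.ne'))
    (fun x hx => rpow_coefficient_bounds ha hα.1 hα.2.le hx.1 (hIcc x hx).2.le)
    _ _ _ _ _ _ hS (fun x hx t _ => S.equation (hIcc x hx).1)
  rw [hnorm, hnorm', hnorm₀, l2Norm_eq hmem₁]
  have i1 := integrableOn_Ioo_of_continuousOn ((hslice hS.cont).pow 2)
  have i2 := integrableOn_Ioo_of_continuousOn ((hslice hS.cont_x).pow 2)
  have i3 := integrableOn_Ioo_of_continuousOn ((hslice hS.cont_t).pow 2)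
  have hD : ∫ x in Ioo a b, (S.val x 0 ^ 2 + S.valX x 0 ^ 2 + S.valT x 0 ^ 2) =
      ((∫ x in Ioo a b, S.val x 0 ^ 2) + ∫ x in Ioo a b, S.valX x 0 ^ 2) +
        ∫ x in Ioo a b, S.valT x 0 ^ 2 :=
    (integral_add (i1.add i2) i3).trans (congrArg (· + _) (integral_add i1 i2))
  rw [hD] at hmain
  have hn1 : 0 ≤ (∫ x in Ioo a b, S.val x 0 ^ 2) + ∫ x in Ioo a b, S.valX x 0 ^ 2 := by positivity
  have hn2 : 0 ≤ ∫ x in Ioo a b, S.valT x 0 ^ 2 := by positivity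
  have hn3 : 0 ≤ ∫ q in Ioo a b ×ˢ Ioo 0 T,
    (S.val q.1 q.2 ^ 2 + S.valX q.1 q.2 ^ 2 + S.valT q.1 q.2 ^ 2) := by positivity
  refine (Real.sqrt_le_sqrt hmain).trans ?_
  rw [Real.sqrt_mul (by positivity), Real.sqrt_mul hK.le, sqrt_rpow hn3, sqrt_rpow (by positivity)]
  exact mul_le_mul_of_nonneg_left
    (Real.rpow_le_rpow (Real.sqrt_nonneg _) (sqrt_add_le hn1 hn2) hδ.1.le) (by positivity)
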